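/- \textbf{Twisted arrow categories.} Let $Q$ be a coloured symmetric operad in sets, and let $A$ be a $Q$-algebra. Let $F(UA)\sqcup A$ be the coproduct, in the category of $Q$-algebras, of $A$ and of the free $Q$-algebra on the underlying coloured set $UA$ of $A$; its elements are represented by expressions $q(x_1,\dots,x_k,a_1,\dots,a_n)$, where $q$ is an operation of $Q$, the variables $x_i$ are marked by elements of $A$ (the generators of $F(UA)$), and $a_j\in A$; the equivalence relation on expressions is generated by the compatibility with the actions of the symmetric groups and by evaluating operations of $Q$ applied to the elements of the second summand $A$. The twisted arrow category $\mathrm{Tw}_Q(A)$ has the elements of $A$ as objects. A morphism from $a$ to $b$ is an element $[q(x,a_1,\dots,a_n)]$ of $F(UA)\sqcup A$ with exactly one variable $x$, where $x$ is marked by $a$, such that $q(a,a_1,\dots,a_n)=b$ in $A$. The composition of morphisms is the substitution of expressions for the variable, and the identity of $a$ is $[\mathrm{id}(x)]$ with $x$ marked by $a$. \textbf{The operad $cOp$.} The operad $cOp$ has the natural numbers $n\ge 0$ as colours. An operation with input colours $n_1,\dots,n_k$ and output colour $d$ is a finite tree with half-edges that has $k$ ordered vertices, the $i$-th of which has $n_i+1$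 half-edges ordered as $0,\dots,n_i$, and $d+1\ge 1$ leaves ordered as $0,\dots,d$. For $k=0$ and $d=1$ the exceptional edge, i.e. the edge with two ends and without vertices, is included. Composition is the substitution of trees for vertices, where the leaves of a substituted tree are identified with the half-edges of the vertex in the given orders; the identities are the corollas. An algebra over $cOp$ is a cyclic operad in sets. \textbf{The cyclic associative operad.} The $cOp$-algebra $uAs_c$ is the cyclic operad of unital associative monoids: the elements of $uAs_c$ of colour $n$, $n\ge 0$, are the cyclic orders on the set $\{0,\dots,n\}$. A tree whose vertices are marked by cyclic orders on their sets of half-edges is a planar tree, and it is evaluated to the resulting cyclic order on its leaves. \textbf{The cyclic category.} Connes' cyclic category $\Lambda$ has the objects $[n]$ for $n\ge 0$. The morphisms $[m]\to[n]$ are the nondecreasing maps $f:\mathbb Z\to\mathbb Z$ such that $f(i+m+1)=f(i)+n+1$ for all $i$, where $f$ and $g$ are identified if $g=f+k(n+1)$ for some $k\in\mathbb Z$. Composition is composition of maps. \textbf{Proposition.} The category $\mathrm{Tw}_{cOp}(uAs_c)$ is equivalent to the category $\Lambda$. -/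

import Mathlib

namespace OperadTw

/-- A coloured symmetric operad in sets, in coordinate-free form: the inputs of an operation are
indexed by a finite type, and the symmetric group actions are the relabellings along colour
preserving bijections. `comp` is the full (simultaneous) composition. -/
structure Operad (C : Type) where
  Op : {I : Type} → (I → C) → C → Type
  finite {I : Type} {c : I → C} {d : C} : Op c d → Finite I
  one (c : C) : Op (fun _ : Unit => c) c
  map {I I' : Type} {c : I → C} {c' : I' → C} {d d' : C} (e : I ≃ I')
    (h : ∀ i, c' (e i) = c i) (hd : d' = d) : Op c d → Op c' d'
  comp {I : Type} {J : I → Type} {c : I → C} {b : ∀ i, J i → C} {d : C} :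
    Op c d → (∀ i, Op (b i) (c i)) → Op (fun x : Σ i, J i => b x.1 x.2) d
  map_refl {I : Type} {c : I → C} {d : C} (p : Op c d) :
    map (Equiv.refl I) (fun _ => rfl) rfl p = p
  map_map {I I' I'' : Type} {c : I → C} {c' : I' → C} {c'' : I'' → C} {d d' d'' : C}
    (e : I ≃ I') (h : ∀ i, c' (e i) = c i) (hd : d' = d)
    (e' : I' ≃ I'') (h' : ∀ i, c'' (e' i) = c' i) (hd' : d'' = d') (p : Op c d) :
    map e' h' hd' (map e h hd p) =
      map (e.trans e') (fun i => (h' (e i)).trans (h i)) (hd'.trans hd) p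
  comp_map {I I' : Type} {J : I → Type} {J' : I' → Type} {c : I → C} {c' : I' → C}
    {b : ∀ i, J i → C} {b' : ∀ i, J' i → C} {d d' : C}
    (e : I ≃ I') (h : ∀ i, c' (e i) = c i) (hd : d' = d)
    (f : ∀ i, J i ≃ J' (e i)) (hf : ∀ i j, b' (e i) (f i j) = b i j)
    (p : Op c d) (q : ∀ i, Op (b i) (c i)) (q' : ∀ i, Op (b' i) (c' i))
    (hq : ∀ i, q' (e i) = map (f i) (hf i) (h i) (q i)) :
    comp (map e h hd p) q' =
      map (Equiv.sigmaCongr e f) (fun x => hf x.1 x.2) hd (comp p q)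
  one_comp {I : Type} {c : I → C} {d : C} (p : Op c d) :
    map (Equiv.uniqueSigma fun _ : Unit => I) (fun _ => rfl) rfl
      (comp (one d) (fun _ => p)) = p
  comp_one {I : Type} {c : I → C} {d : C} (p : Op c d) :
    map (Equiv.sigmaPUnit I) (fun _ => rfl) rfl (comp p (fun i => one (c i))) = p
  assoc {I : Type} {J : I → Type} {K : ∀ i, J i → Type} {c : I → C} {b : ∀ i, J i → C}
    {a : ∀ i j, K i j → C} {d : C} (p : Op c d) (q : ∀ i, Op (b i) (c i))
    (r : ∀ i j, Op (a i j) (b i j)) :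
    map (Equiv.sigmaAssoc K) (fun _ => rfl) rfl
        (comp (comp p q) (fun x : Σ i, J i => r x.1 x.2)) =
      comp p (fun i => comp (q i) (r i))

/-- An algebra over a coloured operad in sets. -/
structure Operad.Algebra {C : Type} (Q : Operad C) where
  carrier : C → Type
  act {I : Type} {c : I → C} {d : C} : Q.Op c d → (∀ i, carrier (c i)) → carrier d
  act_one (c : C) (a : carrier c) : act (Q.one c) (fun _ => a) = a
  act_map {I I' : Type} (e : I ≃ I') {c : I' → C} {d : C} (p : Q.Op (fun i => c (e i)) d)
    (a : ∀ i, carrier (c i)) :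
    act (Q.map e (fun _ => rfl) rfl p) a = act p (fun i => a (e i))
  act_comp {I : Type} {J : I → Type} {c : I → C} {b : ∀ i, J i → C} {d : C}
    (p : Q.Op c d) (q : ∀ i, Q.Op (b i) (c i)) (a : ∀ i j, carrier (b i j)) :
    act (Q.comp p q) (fun x : Σ i, J i => a x.1 x.2) = act p (fun i => act (q i) (a i))

/-! ### Twisted arrow categories -/

namespace Operad

variable {C : Type}

/-- The colours of inputs of an operation with one distinguished input of colour `c`. -/
def slots {I : Type} (c : C) (col : I → C) : Option I → C
  | none => c
  | some i => col i

theorem slots_congr {I I' : Type} (c : C) {col : I → C} {col' : I' → C} (e : I ≃ I')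
    (h : ∀ i, col' (e i) = col i) : ∀ o, slots c col' (Equiv.optionCongr e o) = slots c col o
  | none => rfl
  | some i => h i

/-- The index sets of the operations that are plugged into the inputs. -/
def plugIdx {I : Type} (K : Type) (J : I → Type) : Option I → Type
  | none => K
  | some i => J i

/-- The input colours of the operations that are plugged into the inputs. -/
def plugCol {I K : Type} {J : I → Type} (k : K → C) (b : ∀ i, J i → C) :
    ∀ o, plugIdx K J o → C
  | none => k
  | some i => b i

/-- The inputs of an operation `q` with the operation `q0` plugged into the distinguished
input, and with other operations plugged into the remaining inputs. -/
def plugEquiv {I I0 : Type} (J : I → Type) :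
    (Σ o, plugIdx (Option I0) J o) ≃ Option (I0 ⊕ Σ i, J i) where
  toFun
    | ⟨none, none⟩ => none
    | ⟨none, some i⟩ => some (Sum.inl i)
    | ⟨some i, j⟩ => some (Sum.inr ⟨i, j⟩)
  invFun
    | none => ⟨none, none⟩
    | some (Sum.inl i) => ⟨none, some i⟩
    | some (Sum.inr x) => ⟨some x.1, x.2⟩
  left_inv := by
    rintro ⟨_ | i, x⟩
    · rcases x with _ | j <;> rfl
    · rfl
  right_inv := by rintro (_ | _ | _) <;> rfl

theorem plugCol_eq {I I0 : Type} {J : I → Type} (c : C) (col0 : I0 → C) (b : ∀ i, J i → C) :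
    ∀ x : Σ o, plugIdx (Option I0) J o,
      slots c (Sum.elim col0 fun y : Σ i, J i => b y.1 y.2) (plugEquiv J x) =
        plugCol (slots c col0) b x.1 x.2
  | ⟨none, none⟩ => rfl
  | ⟨none, some _⟩ => rfl
  | ⟨some _, _⟩ => rfl

/-- The rearrangement of indices in iterated compositions. -/
def plugAssoc {I I0 : Type} {J : I → Type} (L : Type) (K : I0 ⊕ (Σ i, J i) → Type) :
    (L ⊕ Σ x, K x) ≃ ((L ⊕ Σ i, K (Sum.inl i)) ⊕ Σ i, Σ j, K (Sum.inr ⟨i, j⟩)) where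
  toFun
    | Sum.inl l => Sum.inl (Sum.inl l)
    | Sum.inr ⟨Sum.inl i, k⟩ => Sum.inl (Sum.inr ⟨i, k⟩)
    | Sum.inr ⟨Sum.inr ⟨i, j⟩, k⟩ => Sum.inr ⟨i, j, k⟩
  invFun
    | Sum.inl (Sum.inl l) => Sum.inl l
    | Sum.inl (Sum.inr x) => Sum.inr ⟨Sum.inl x.1, x.2⟩
    | Sum.inr x => Sum.inr ⟨Sum.inr ⟨x.1, x.2.1⟩, x.2.2⟩
  left_inv := by rintro (_ | ⟨_ | ⟨_, _⟩, _⟩) <;> rfl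
  right_inv := by rintro ((_ | _) | _) <;> rfl

variable (Q : Operad C)

/-- The operations that are plugged into the inputs. -/
def plugOp {I K : Type} {J : I → Type} {c : C} {col : I → C} {k : K → C} {b : ∀ i, J i → C}
    (q0 : Q.Op k c) (r : ∀ i, Q.Op (b i) (col i)) :
    ∀ o, Q.Op (plugCol k b o) (slots c col o)
  | none => q0
  | some i => r i

/-- The composition `q(q0(-), r(-), ..., r(-))`. -/
def plug {I I0 : Type} {J : I → Type} {c c' d : C} {col : I → C} {col0 : I0 → C}
    {b : ∀ i, J i → C} (q : Q.Op (slots c' col) d) (q0 : Q.Op (slots c col0) c')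
    (r : ∀ i, Q.Op (b i) (col i)) :
    Q.Op (slots c (Sum.elim col0 fun y : Σ i, J i => b y.1 y.2)) d :=
  Q.map (plugEquiv J) (plugCol_eq c col0 b) rfl (Q.comp q (Q.plugOp q0 r))

/-- The identity operation, as an operation with one distinguished input. -/
def idOp (c : C) : Q.Op (slots c (Empty.elim : Empty → C)) c :=
  Q.map (Equiv.ofUnique Unit (Option Empty)) (fun _ => rfl) rfl (Q.one c)

section lemmas

variable {Q}

theorem map_congr {I I' : Type} {c : I → C} {c' : I' → C} {d d' : C} {e e' : I ≃ I'}
    {h : ∀ i, c' (e i) = c i} {h' : ∀ i, c' (e' i) = c i} {hd : d' = d} {p : Q.Op c d}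
    (he : ∀ i, e i = e' i) : Q.map e h hd p = Q.map e' h' hd p := by
  obtain rfl : e = e' := Equiv.ext he
  rfl

theorem map_self {I : Type} {c : I → C} {d : C} {e : I ≃ I} {h : ∀ i, c (e i) = c i}
    {p : Q.Op c d} (he : ∀ i, e i = i) : Q.map e h rfl p = p :=
  (map_congr he).trans (Q.map_refl p)

theorem map2_congr {I I1 I1' I2 : Type} {c : I → C} {c1 : I1 → C} {c1' : I1' → C} {c2 : I2 → C}
    {d d1 d1' d2 : C} {e : I ≃ I1} {e' : I1 ≃ I2} {f : I ≃ I1'} {f' : I1' ≃ I2}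
    {h : ∀ i, c1 (e i) = c i} {h' : ∀ i, c2 (e' i) = c1 i} {k : ∀ i, c1' (f i) = c i}
    {k' : ∀ i, c2 (f' i) = c1' i} {hd : d1 = d} {hd' : d2 = d1} {kd : d1' = d} {kd' : d2 = d1'}
    {p : Q.Op c d} (he : ∀ i, e' (e i) = f' (f i)) :
    Q.map e' h' hd' (Q.map e h hd p) = Q.map f' k' kd' (Q.map f k kd p) := by
  rw [Q.map_map, Q.map_map]
  exact map_congr he

theorem map3_congr {I I1 I1' I2 I2' I3 : Type} {c : I → C} {c1 : I1 → C} {c1' : I1' → C}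
    {c2 : I2 → C} {c2' : I2' → C} {c3 : I3 → C}
    {d d1 d1' d2 d2' d3 : C} {e : I ≃ I1} {e' : I1 ≃ I2} {e'' : I2 ≃ I3}
    {f : I ≃ I1'} {f' : I1' ≃ I2'} {f'' : I2' ≃ I3}
    {h : ∀ i, c1 (e i) = c i} {h' : ∀ i, c2 (e' i) = c1 i} {h'' : ∀ i, c3 (e'' i) = c2 i}
    {k : ∀ i, c1' (f i) = c i} {k' : ∀ i, c2' (f' i) = c1' i} {k'' : ∀ i, c3 (f'' i) = c2' i}
    {hd : d1 = d} {hd' : d2 = d1} {hd'' : d3 = d2} {kd : d1' = d} {kd' : d2' = d1'}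
    {kd'' : d3 = d2'} {p : Q.Op c d} (he : ∀ i, e'' (e' (e i)) = f'' (f' (f i))) :
    Q.map e'' h'' hd'' (Q.map e' h' hd' (Q.map e h hd p)) =
      Q.map f'' k'' kd'' (Q.map f' k' kd' (Q.map f k kd p)) := by
  refine (congrArg (Q.map e'' h'' hd'') (Q.map_map e h hd e' h' hd' p)).trans
    (Eq.trans (map2_congr (e := e.trans e') (f := f.trans f') he)
      (congrArg (Q.map f'' k'' kd'') (Q.map_map f k kd f' k' kd' p)).symm)

theorem plug_congr {I I' I0 I0' : Type} {J : I → Type} {J' : I' → Type} {c c' d : C}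
    {col : I → C} {col' : I' → C} {col0 : I0 → C} {col0' : I0' → C}
    {b : ∀ i, J i → C} {b' : ∀ i, J' i → C}
    (e : I ≃ I') (h : ∀ i, col' (e i) = col i) (e0 : I0 ≃ I0')
    (h0 : ∀ i, col0' (e0 i) = col0 i) (f : ∀ i, J i ≃ J' (e i))
    (hf : ∀ i j, b' (e i) (f i j) = b i j)
    {q : Q.Op (slots c' col) d} {q0 : Q.Op (slots c col0) c'} {r : ∀ i, Q.Op (b i) (col i)}
    {q' : Q.Op (slots c' col') d} {q0' : Q.Op (slots c col0') c'}
    {r' : ∀ i, Q.Op (b' i) (col' i)}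
    (hq : q' = Q.map (Equiv.optionCongr e) (slots_congr c' e h) rfl q)
    (hq0 : q0' = Q.map (Equiv.optionCongr e0) (slots_congr c e0 h0) rfl q0)
    (hr : ∀ i, r' (e i) = Q.map (f i) (hf i) (h i) (r i)) :
    Q.plug q' q0' r' =
      Q.map (Equiv.optionCongr (Equiv.sumCongr e0 (Equiv.sigmaCongr e f)))
        (slots_congr c _ (by rintro (i | ⟨i, j⟩); exacts [h0 i, hf i j])) rfl
        (Q.plug q q0 r) := by
  subst hq hq0
  let f' : ∀ o, plugIdx (Option I0) J o ≃ plugIdx (Option I0') J' (Equiv.optionCongr e o) := fun o =>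
    match o with
    | none => Equiv.optionCongr e0
    | some i => f i
  have hf' : ∀ o x, plugCol (slots c col0') b' (Equiv.optionCongr e o) (f' o x) =
      plugCol (slots c col0) b o x := by
    rintro (_ | i) x
    · exact slots_congr c e0 h0 x
    · exact hf i x
  have key := Q.comp_map (Equiv.optionCongr e) (slots_congr c' e h) rfl f' hf' q (Q.plugOp q0 r)
    (Q.plugOp (Q.map (Equiv.optionCongr e0) (slots_congr c e0 h0) rfl q0) r') (by
      rintro (_ | i)
      · rfl
      · exact hr i)
  refine (congrArg (Q.map (plugEquiv J') (plugCol_eq c col0' b') rfl) key).trans (map2_congr ?_)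
  rintro ⟨_ | i, x⟩
  · rcases x with _ | j <;> rfl
  · rfl

theorem plug_plug {I I0 L : Type} {J : I → Type} {c c' c'' d : C}
    {K : I0 ⊕ (Σ i, J i) → Type} {col : I → C} {col0 : I0 → C} {colL : L → C}
    {b : ∀ i, J i → C}
    {a : ∀ x : I0 ⊕ (Σ i, J i), K x → C}
    (q : Q.Op (slots c'' col) d) (q0 : Q.Op (slots c' col0) c'') (r : ∀ i, Q.Op (b i) (col i))
    (q1 : Q.Op (slots c colL) c')
    (s : ∀ x, Q.Op (a x) (Sum.elim col0 (fun y : Σ i, J i => b y.1 y.2) x))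
    (h) :
    Q.map (Equiv.optionCongr (plugAssoc L K)) h rfl (Q.plug (Q.plug q q0 r) q1 s) =
      Q.plug q (Q.plug q0 q1 fun i => s (Sum.inl i))
        (fun i => Q.comp (r i) fun j => s (Sum.inr ⟨i, j⟩)) := by
  -- both sides are relabellings of the same iterated composition
  let M : ∀ o, plugIdx (Option I0) J o → Type := fun o =>
    match o with
    | none => plugIdx (Option L) fun i => K (Sum.inl i)
    | some i => fun j => K (Sum.inr ⟨i, j⟩)
  let m : ∀ o x, M o x → C := fun o =>
    match o with
    | none => plugCol (slots c colL) fun i => a (Sum.inl i)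
    | some i => fun j => a (Sum.inr ⟨i, j⟩)
  let R : ∀ o x, Q.Op (m o x) (plugCol (slots c' col0) b o x) := fun o =>
    match o with
    | none => Q.plugOp q1 fun i => s (Sum.inl i)
    | some i => fun j => s (Sum.inr ⟨i, j⟩)
  let X := Q.comp (Q.comp q (Q.plugOp q0 r)) (fun x : Σ o, plugIdx (Option I0) J o => R x.1 x.2)
  let g : ∀ x : Σ o, plugIdx (Option I0) J o, M x.1 x.2 ≃ plugIdx (Option L) K (plugEquiv J x) :=
    fun x =>
      match x with
      | ⟨none, none⟩ => Equiv.refl _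
      | ⟨none, some _⟩ => Equiv.refl _
      | ⟨some _, _⟩ => Equiv.refl _
  have hg : ∀ x y, plugCol (slots c colL) a (plugEquiv J x) (g x y) = m x.1 x.2 y := by
    rintro ⟨_ | i, x⟩ y
    · rcases x with _ | j <;> rfl
    · rfl
  have hl : Q.plug (Q.plug q q0 r) q1 s =
      Q.map (plugEquiv K) (plugCol_eq c colL a) rfl
        (Q.map (Equiv.sigmaCongr (plugEquiv J) g) (fun x => hg x.1 x.2) rfl X) := by
    change Q.map _ _ _ (Q.comp (Q.map _ _ _ _) _) = _
    refine congrArg _ (Q.comp_map (plugEquiv J) (plugCol_eq c' col0 b) rfl g hg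
      (Q.comp q (Q.plugOp q0 r)) (fun x : Σ o, plugIdx (Option I0) J o => R x.1 x.2) _ ?_)
    rintro ⟨_ | i, x⟩
    · rcases x with _ | j <;> exact (Q.map_refl _).symm
    · exact (Q.map_refl _).symm
  let g' : ∀ o, (Σ x, M o x) ≃
      plugIdx (Option (L ⊕ Σ i, K (Sum.inl i))) (fun i => Σ j, K (Sum.inr ⟨i, j⟩)) o := fun o =>
    match o with
    | none => plugEquiv fun i => K (Sum.inl i)
    | some _ => Equiv.refl _
  have hg' : ∀ o y, plugCol (slots c (Sum.elim colL fun y : Σ i, K (Sum.inl i) => a _ y.2))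
      (fun i (y : Σ j, K (Sum.inr ⟨i, j⟩)) => a _ y.2) o (g' o y) = m o y.1 y.2 := by
    rintro (_ | i) y
    · exact plugCol_eq c colL (fun i => a (Sum.inl i)) y
    · rfl
  have hr : Q.comp q (Q.plugOp (Q.plug q0 q1 fun i => s (Sum.inl i))
      (fun i => Q.comp (r i) fun j => s (Sum.inr ⟨i, j⟩))) =
      Q.map (Equiv.sigmaCongr (Equiv.refl _) g') (fun x => hg' x.1 x.2) rfl
        (Q.map (Equiv.sigmaAssoc M) (fun _ => rfl) rfl X) := by
    have key := Q.comp_map (Equiv.refl _) (fun _ => rfl) rfl g' hg' q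
      (fun o => Q.comp (Q.plugOp q0 r o) (R o))
      (Q.plugOp (Q.plug q0 q1 fun i => s (Sum.inl i))
        (fun i => Q.comp (r i) fun j => s (Sum.inr ⟨i, j⟩))) (by
        rintro (_ | i)
        · rfl
        · exact (Q.map_refl _).symm)
    rw [Q.map_refl] at key
    exact key.trans (congrArg (Q.map _ _ _) (Q.assoc q (Q.plugOp q0 r) R).symm)
  refine (congrArg (Q.map (Equiv.optionCongr (plugAssoc L K)) h rfl) hl).trans
    (Eq.trans ?_ (congrArg (Q.map (plugEquiv _) (plugCol_eq _ _ _) rfl) hr).symm)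
  refine map3_congr ?_
  rintro ⟨⟨_ | i, x⟩, y⟩
  · rcases x with _ | j
    · rcases y with _ | y <;> rfl
    · rfl
  · rfl

theorem map_comm {I I' : Type} {c : I → C} {c' : I' → C} {d d' : C} {e : I ≃ I'}
    {h : ∀ i, c' (e i) = c i} {hd : d' = d} {p : Q.Op c d} {p' : Q.Op c' d'}
    (hp : Q.map e h hd p = p') :
    p = Q.map e.symm (fun i => by rw [← h, e.apply_symm_apply]) hd.symm p' := by
  subst hd
  rw [← hp, Q.map_map]
  exact (map_self (by simp)).symm

theorem comp_one' {I : Type} {c : I → C} {d : C} (p : Q.Op c d) :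
    Q.comp p (fun i => Q.one (c i)) = Q.map (Equiv.sigmaPUnit I).symm (fun _ => rfl) rfl p :=
  map_comm (Q.comp_one p)

theorem one_comp' {I : Type} {c : I → C} {d : C} (p : Q.Op c d) :
    Q.comp (Q.one d) (fun _ => p) =
      Q.map (Equiv.uniqueSigma fun _ : Unit => I).symm (fun _ => rfl) rfl p :=
  map_comm (Q.one_comp p)

/-- Plugging an operation into the identity. -/
theorem plug_id_left {I0 : Type} {J : Empty → Type} {c c' : C} {col0 : I0 → C} {b : ∀ i, J i → C}
    (q0 : Q.Op (slots c col0) c') (r : ∀ i, Q.Op (b i) (Empty.elim i))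
    (e : I0 ≃ I0 ⊕ Σ i, J i) (he : ∀ i, e i = Sum.inl i) :
    Q.plug (Q.idOp c') q0 r = Q.map (Equiv.optionCongr e)
      (slots_congr c e fun i => by rw [he]; rfl) rfl q0 := by
  let f : ∀ u : Unit, Option I0 ≃ plugIdx (Option I0) J (Equiv.ofUnique Unit (Option Empty) u) :=
    fun _ => Equiv.refl _
  have h := Q.comp_map (Equiv.ofUnique Unit (Option Empty)) (c' := slots c' Empty.elim)
    (fun _ => rfl) rfl f (b' := plugCol (slots c col0) b) (fun _ _ => rfl) (Q.one c') (fun _ => q0)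
    (Q.plugOp q0 r) (fun _ => (Q.map_refl _).symm)
  have h1 := one_comp' q0
  have h2 := h.trans (congrArg _ h1)
  refine (congrArg (Q.map (plugEquiv J) (plugCol_eq c col0 b) rfl) h2).trans ?_
  refine (congrArg _ (Q.map_map ..)).trans ((Q.map_map ..).trans (map_congr ?_))
  rintro (_ | i)
  · rfl
  · exact congrArg some (he i).symm

/-- Plugging identities into an operation. -/
theorem plug_id_right {I : Type} {c d : C} {col : I → C} (q : Q.Op (slots c col) d)
    (e : I ≃ Empty ⊕ Σ _ : I, Unit) (he : ∀ i, e i = Sum.inr ⟨i, ()⟩) :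
    Q.plug q (Q.idOp c) (fun i => Q.one (col i)) = Q.map (Equiv.optionCongr e)
      (slots_congr c e fun i => by rw [he]; rfl) rfl q := by
  let f : ∀ o : Option I, Unit ≃ plugIdx (Option Empty) (fun _ : I => Unit) o := fun o =>
    match o with
    | none => Equiv.ofUnique Unit (Option Empty)
    | some _ => Equiv.refl _
  have hf : ∀ o x, plugCol (slots c (Empty.elim : Empty → C)) (fun i (_ : Unit) => col i) o (f o x) =
      slots c col o := by
    rintro (_ | i) x <;> rfl
  have h := Q.comp_map (Equiv.refl (Option I)) (fun _ => rfl) rfl f hf q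
    (fun o => Q.one (slots c col o)) (Q.plugOp (Q.idOp c) (fun i => Q.one (col i))) (by
      rintro (_ | i)
      · rfl
      · exact (Q.map_refl _).symm)
  rw [Q.map_refl] at h
  have h1 := comp_one' q
  have h2 := h.trans (congrArg _ h1)
  refine (congrArg (Q.map (plugEquiv _) (plugCol_eq c _ _) rfl) h2).trans ?_
  refine (congrArg _ (Q.map_map ..)).trans ((Q.map_map ..).trans (map_congr ?_))
  rintro (_ | i)
  · rfl
  · exact congrArg some (he i).symm

end lemmas


variable {Q}

/-- An expression `q(x, a_1, ..., a_n)`, where `q` is an operation of `Q` with output colour `d`,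
the elements `a_i` belong to the algebra `A`, and `x` is a variable of colour `c`. -/
structure OneVar (A : Q.Algebra) (c d : C) : Type 1 where
  I : Type
  col : I → C
  op : Q.Op (slots c col) d
  arg : ∀ i, A.carrier (col i)

namespace OneVar

variable {A : Q.Algebra}

/-- The value of the variable, together with the remaining arguments. -/
def fill {I : Type} {c : C} {col : I → C} (x : A.carrier c) (arg : ∀ i, A.carrier (col i)) :
    ∀ o, A.carrier (slots c col o)
  | none => x
  | some i => arg i

/-- The element `q(x, a_1, ..., a_n)` of the algebra, for a value `x` of the variable. -/
def eval {c d : C} (t : OneVar A c d) (x : A.carrier c) : A.carrier d :=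
  A.act t.op (fill x t.arg)

/-- The relations between expressions: compatibility with the symmetric group actions, and
the relations `(q ∘ (id, r_1, ..., r_n))(x, ..., a_ij, ...) = q(x, ..., r_i(a_i1, a_i2, ...), ...)`
that hold in the algebra `A`. -/
inductive Rel {c d : C} : OneVar A c d → OneVar A c d → Prop
  | relabel {I I' : Type} (e : I ≃ I') (col : I' → C) (q : Q.Op (slots c fun i => col (e i)) d)
      (arg : ∀ i, A.carrier (col i)) :
      Rel ⟨I, fun i => col (e i), q, fun i => arg (e i)⟩
        ⟨I', col, Q.map (Equiv.optionCongr e) (slots_congr c e fun _ => rfl) rfl q, arg⟩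
  | absorb {I : Type} {J : I → Type} {col : I → C} {b : ∀ i, J i → C} (q : Q.Op (slots c col) d)
      (r : ∀ i, Q.Op (b i) (col i)) (arg : ∀ i j, A.carrier (b i j)) :
      Rel ⟨Σ i, J i, fun x => b x.1 x.2,
          Q.map (Equiv.optionCongr (Equiv.emptySum Empty (Σ i, J i)))
            (slots_congr c _ (by rintro (i | x); exacts [i.elim, rfl])) rfl (Q.plug q (Q.idOp c) r),
          fun x => arg x.1 x.2⟩
        ⟨I, col, q, fun i => A.act (r i) (arg i)⟩

/-- The elements of the algebra `TO(A)` that have one variable, where the variable has colour `c`: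
expressions up to the equivalence relation generated by `Rel`. -/
def Cls (A : Q.Algebra) (c d : C) : Type 1 := Quot (Rel (A := A) (c := c) (d := d))

/-- The identity expression `id(x)`. -/
def id (A : Q.Algebra) (c : C) : OneVar A c c :=
  ⟨Empty, Empty.elim, Q.idOp c, fun i => i.elim⟩

/-- Substitution of the expression `t` for the variable of `t'`. -/
def comp {c d e : C} (t : OneVar A c d) (t' : OneVar A d e) : OneVar A c e where
  I := t.I ⊕ Σ _ : t'.I, Unit
  col := Sum.elim t.col fun x => t'.col x.1
  op := Q.plug t'.op t.op fun i => Q.one (t'.col i)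
  arg := fun x => match x with
    | Sum.inl i => t.arg i
    | Sum.inr y => t'.arg y.1

theorem mk_relabel {c d : C} {I I' : Type} {col : I → C} {col' : I' → C}
    {q : Q.Op (slots c col) d} {q' : Q.Op (slots c col') d} {arg : ∀ i, A.carrier (col i)}
    {arg' : ∀ i, A.carrier (col' i)} (e : I ≃ I') (h : ∀ i, col' (e i) = col i)
    (harg : ∀ i, arg' (e i) ≍ arg i)
    (hq : q' = Q.map (Equiv.optionCongr e) (slots_congr c e h) rfl q) :
    (Quot.mk Rel ⟨I, col, q, arg⟩ : Cls A c d) = Quot.mk Rel ⟨I', col', q', arg'⟩ := by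
  obtain rfl : col = fun i => col' (e i) := funext fun i => (h i).symm
  obtain rfl : arg = fun i => arg' (e i) := funext fun i => (eq_of_heq (harg i)).symm
  subst hq
  exact Quot.sound (Rel.relabel e col' q arg')

theorem mk_absorb {c d : C} {I V : Type} {J : I → Type} {col : I → C} {colV : V → C}
    {b : ∀ i, J i → C} {q : Q.Op (slots c col) d} {r : ∀ i, Q.Op (b i) (col i)}
    {m : ∀ i j, A.carrier (b i j)} {q' : Q.Op (slots c colV) d} {arg' : ∀ v, A.carrier (colV v)}
    {arg : ∀ i, A.carrier (col i)}
    (e : V ≃ Empty ⊕ Σ i, J i) (h) (f : V → Σ i, J i) (hf : ∀ v, e v = Sum.inr (f v))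
    (harg' : ∀ v, m (f v).1 (f v).2 ≍ arg' v) (harg : ∀ i, arg i = A.act (r i) (m i))
    (hq : Q.map (Equiv.optionCongr e) h rfl q' = Q.plug q (Q.idOp c) r) :
    (Quot.mk Rel ⟨V, colV, q', arg'⟩ : Cls A c d) = Quot.mk Rel ⟨I, col, q, arg⟩ := by
  obtain rfl : arg = fun i => A.act (r i) (m i) := funext harg
  refine Eq.trans ?_ (Quot.sound (Rel.absorb q r m))
  have h' : ∀ v, (e.trans (Equiv.emptySum Empty (Σ i, J i))) v = f v := by
    intro v
    rw [Equiv.trans_apply, hf]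
    rfl
  refine mk_relabel (e.trans (Equiv.emptySum Empty (Σ i, J i))) ?_ ?_ ?_
  · intro v
    have := h (some v)
    rw [h']
    rw [Equiv.optionCongr_apply, Option.map_some, hf] at this
    exact this
  · intro v
    have h3 : ∀ y, y = f v → (m y.1 y.2 ≍ arg' v) := by
      rintro y rfl
      exact harg' v
    exact h3 _ (h' v)
  · rw [← hq]
    refine (Q.map_map ..).trans (map_congr ?_)
    rintro (_ | v) <;> rfl

theorem comp_rel_left {c d e : C} {t1 t2 : OneVar A c d} (h : Rel t1 t2) (t' : OneVar A d e) :
    (Quot.mk Rel (comp t1 t') : Cls A c e) = Quot.mk Rel (comp t2 t') := by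
  obtain ⟨I', col', q', arg'⟩ := t'
  cases h with
  | relabel ε col q arg =>
    refine mk_relabel (Equiv.sumCongr ε (Equiv.sigmaCongr (Equiv.refl _) fun _ => Equiv.refl _))
      ?_ ?_ ?_
    · rintro (i | i) <;> rfl
    · rintro (i | i) <;> rfl
    · exact plug_congr (Equiv.refl _) (fun _ => rfl) ε (fun _ => rfl) (fun _ => Equiv.refl _)
        (fun _ _ => rfl) (map_self fun o => by simp).symm rfl (fun _ => (Q.map_refl _).symm)
  | @absorb I J col b q r m =>
    let JJ : I ⊕ (Σ _ : I', Unit) → Type := Sum.elim J fun _ => Unit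
    let B : ∀ x, JJ x → C := fun x => match x with
      | Sum.inl i => b i
      | Sum.inr y => fun _ => col' y.1
    let R : ∀ x, Q.Op (B x) (Sum.elim col (fun y : Σ _ : I', Unit => col' y.1) x) := fun x =>
      match x with
      | Sum.inl i => r i
      | Sum.inr y => Q.one (col' y.1)
    let M : ∀ x (y : JJ x), A.carrier (B x y) := fun x => match x with
      | Sum.inl i => m i
      | Sum.inr y => fun _ => arg' y.1
    have h1 := plug_plug q' q (fun i => Q.one (col' i)) (Q.idOp c) R
      (by rintro (_ | (i | ⟨i | ⟨i, j⟩, k⟩))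
          · rfl
          · exact i.elim
          · rfl
          · rfl)
    have h2 := plug_congr (Equiv.refl I') (fun _ => rfl) (Equiv.emptySum Empty (Σ i, J i))
      (col0' := fun x : Σ i, J i => b x.1 x.2) (by rintro (i | x); exacts [i.elim, rfl])
      (J' := fun _ => Unit) (fun _ => Equiv.uniqueSigma fun _ : Unit => Unit)
      (b := fun i (_ : Σ _ : Unit, Unit) => col' i) (b' := fun i _ => col' i) (fun _ _ => rfl)
      (q' := q') (map_self fun o => by simp).symm
      (q0 := Q.plug q (Q.idOp c) r) rfl (r' := fun i => Q.one (col' i))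
      (r := fun i => Q.comp (Q.one (col' i)) fun _ => Q.one (col' i))
      (fun i => (Q.one_comp (Q.one (col' i))).symm)
    let e1 : (Σ _ : I', Σ _ : Unit, Unit) ≃ Σ _ : I', Unit :=
      Equiv.sigmaCongr (Equiv.refl I') fun _ => Equiv.uniqueSigma fun _ : Unit => Unit
    let e' : (Empty ⊕ Σ x, JJ x) ≃ (Σ i, J i) ⊕ Σ _ : I', Unit :=
      (plugAssoc (J := fun _ : I' => Unit) Empty JJ).trans
        (Equiv.sumCongr (Equiv.emptySum Empty (Σ i, J i)) e1)
    let f : (Σ i, J i) ⊕ (Σ _ : I', Unit) → Σ x, JJ x := fun v => match v with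
      | Sum.inl x => ⟨Sum.inl x.1, x.2⟩
      | Sum.inr y => ⟨Sum.inr y, ()⟩
    refine mk_absorb (J := JJ) (b := B) (r := R) (m := M) e'.symm ?_ f ?_ ?_ ?_ ?_
    · rintro (_ | (v | v)) <;> rfl
    · rintro (v | v) <;> rfl
    · rintro (v | v) <;> rfl
    · rintro (i | y)
      · rfl
      · exact (A.act_one _ _).symm
    · refine (congrArg _ (h2.trans (congrArg _ h1.symm))).trans ?_
      refine (congrArg _ (Q.map_map ..)).trans ((Q.map_map ..).trans (map_self ?_))
      rintro (_ | (v | ⟨_ | _, v⟩))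
      · rfl
      · exact v.elim
      · rfl
      · rfl

theorem comp_rel_right {c d e : C} (t : OneVar A c d) {t1 t2 : OneVar A d e} (h : Rel t1 t2) :
    (Quot.mk Rel (comp t t1) : Cls A c e) = Quot.mk Rel (comp t t2) := by
  obtain ⟨I0, col0, q0, arg0⟩ := t
  cases h with
  | relabel ε col q arg =>
    refine mk_relabel (Equiv.sumCongr (Equiv.refl _) (Equiv.sigmaCongr ε fun _ => Equiv.refl _))
      ?_ ?_ ?_
    · rintro (i | i) <;> rfl
    · rintro (i | i) <;> rfl
    · exact plug_congr ε (fun _ => rfl) (Equiv.refl _) (fun _ => rfl) (fun _ => Equiv.refl _)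
        (fun _ _ => rfl) rfl (map_self fun o => by simp).symm (fun _ => (Q.map_refl _).symm)
  | @absorb I J col b q r m =>
    let X : OneVar A c e := ⟨I0 ⊕ Σ i, J i, Sum.elim col0 fun x => b x.1 x.2, Q.plug q q0 r,
      fun x => match x with
        | Sum.inl i => arg0 i
        | Sum.inr y => m y.1 y.2⟩
    trans Quot.mk Rel X
    · symm
      have h1 := map_comm (plug_plug q (Q.idOp d) r q0
        (fun x => Q.one (Sum.elim Empty.elim (fun y : Σ i, J i => b y.1 y.2) x))
        (by rintro (_ | (i | ⟨i | ⟨i, j⟩, k⟩))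
            · rfl
            · rfl
            · exact i.elim
            · rfl))
      have h2 := plug_congr (Equiv.emptySum Empty (Σ i, J i))
        (col' := fun x : Σ i, J i => b x.1 x.2) (by rintro (i | x); exacts [i.elim, rfl])
        (Equiv.refl I0) (fun _ => rfl) (fun _ => Equiv.refl Unit)
        (b := fun x (_ : Unit) => Sum.elim Empty.elim (fun y : Σ i, J i => b y.1 y.2) x)
        (b' := fun x _ => b x.1 x.2) (by rintro (i | x) _; exacts [i.elim, rfl])
        (q := Q.plug q (Q.idOp d) r) rfl (q0 := q0) (q0' := q0) (map_self fun o => by simp).symm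
        (r := fun x => Q.one (Sum.elim Empty.elim (fun y : Σ i, J i => b y.1 y.2) x))
        (r' := fun x => Q.one (b x.1 x.2)) (by
          rintro (i | x)
          · exact i.elim
          · exact (Q.map_refl _).symm)
      let ε : I0 ≃ I0 ⊕ Σ _ : Empty, Unit := (Equiv.sumEmpty I0 _).symm
      have h3 := plug_congr (Equiv.refl I) (fun _ => rfl) ε
        (col0' := Sum.elim col0 fun y : Σ _ : Empty, Unit => Empty.elim y.1)
        (fun _ => rfl) (J' := fun i => Σ _ : J i, Unit) (fun i => (Equiv.sigmaPUnit (J i)).symm)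
        (b := b) (b' := fun i x => b i x.1) (fun _ _ => rfl) (r := r)
        (r' := fun i => Q.comp (r i) fun j => Q.one (b i j))
        (q := q) (q' := q) (map_self fun o => by simp).symm
        (plug_id_left q0 (J := fun _ => Unit) (b := fun i _ => Empty.elim i)
          (fun i => Q.one (Empty.elim i)) ε fun _ => rfl)
        (fun i => comp_one' (r i))
      refine mk_relabel (Equiv.sumCongr (Equiv.refl I0) (Equiv.sigmaPUnit (Σ i, J i)).symm)
        ?_ ?_ ?_
      · rintro (v | v) <;> rfl
      · rintro (v | v) <;> rfl
      · refine (h2.trans (congrArg _ (h1.trans (congrArg _ h3)))).trans ?_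
        refine (congrArg _ (Q.map_map ..)).trans ((Q.map_map ..).trans (map_congr ?_))
        rintro (_ | (v | ⟨i, v⟩)) <;> rfl
    · let JJ : I0 ⊕ (Σ _ : I, Unit) → Type := Sum.elim (fun _ => Unit) fun y => J y.1
      let B : ∀ x, JJ x → C := fun x => match x with
        | Sum.inl i => fun _ => col0 i
        | Sum.inr y => b y.1
      let R : ∀ x, Q.Op (B x) (Sum.elim col0 (fun y : Σ _ : I, Unit => col y.1) x) := fun x =>
        match x with
        | Sum.inl i => Q.one (col0 i)
        | Sum.inr y => r y.1
      let M : ∀ x (y : JJ x), A.carrier (B x y) := fun x => match x with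
        | Sum.inl i => fun _ => arg0 i
        | Sum.inr y => m y.1
      have h1 := map_comm (plug_plug q q0 (fun i => Q.one (col i)) (Q.idOp c) R
        (by rintro (_ | (i | ⟨i | ⟨i, j⟩, k⟩))
            · rfl
            · exact i.elim
            · rfl
            · rfl))
      let ε : I0 ≃ Empty ⊕ Σ _ : I0, Unit :=
        ((Equiv.emptySum Empty _).trans (Equiv.sigmaPUnit I0)).symm
      have h3 := plug_congr (Equiv.refl I) (fun _ => rfl) ε
        (col0' := Sum.elim Empty.elim fun y : Σ _ : I0, Unit => col0 y.1)
        (fun _ => rfl) (J' := fun i => Σ _ : Unit, J i)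
        (fun i => (Equiv.uniqueSigma fun _ : Unit => J i).symm)
        (b := b) (b' := fun i x => b i x.2) (fun _ _ => rfl) (r := r)
        (r' := fun i => Q.comp (Q.one (col i)) fun _ => r i)
        (q := q) (q' := q) (map_self fun o => by simp).symm
        (plug_id_right q0 ε fun _ => rfl) (fun i => one_comp' (r i))
      let e' := (Equiv.sumCongr ε (Equiv.sigmaCongr (Equiv.refl I)
        fun i => (Equiv.uniqueSigma fun _ : Unit => J i).symm)).trans
          (plugAssoc (J := fun _ : I => Unit) Empty JJ).symm
      let f : I0 ⊕ (Σ i, J i) → Σ x, JJ x := fun v => match v with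
        | Sum.inl x => ⟨Sum.inl x, ()⟩
        | Sum.inr y => ⟨Sum.inr ⟨y.1, ()⟩, y.2⟩
      refine mk_absorb (J := JJ) (b := B) (r := R) (m := M) e' ?_ f ?_ ?_ ?_ ?_
      · rintro (_ | (v | v)) <;> rfl
      · rintro (v | v) <;> rfl
      · rintro (v | v) <;> rfl
      · rintro (i | y)
        · exact (A.act_one _ _).symm
        · rfl
      · refine Eq.trans ?_ (h1.trans (congrArg _ h3)).symm
        refine Eq.trans ?_ (Q.map_map ..).symm
        refine map_congr ?_
        rintro (_ | (v | v)) <;> rfl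

end OneVar

/-- Composition of classes of expressions. -/
def OneVar.Cls.comp {A : Q.Algebra} {c d e : C} (t : OneVar.Cls A c d) (t' : OneVar.Cls A d e) :
    OneVar.Cls A c e :=
  Quot.lift₂ (fun t t' => Quot.mk _ (OneVar.comp t t')) (fun t _ _ h => OneVar.comp_rel_right t h)
    (fun _ _ t' h => OneVar.comp_rel_left h t') t t'

/-- The identity expression. -/
def OneVar.Cls.id (A : Q.Algebra) (c : C) : OneVar.Cls A c c := Quot.mk _ (OneVar.id A c)

theorem OneVar.Cls.id_comp {A : Q.Algebra} {c d : C} (t : OneVar.Cls A c d) :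
    (OneVar.Cls.id A c).comp t = t := by
  obtain ⟨⟨I, col, q, arg⟩⟩ := t
  symm
  let ε : I ≃ Empty ⊕ Σ _ : I, Unit := ((Equiv.emptySum Empty _).trans (Equiv.sigmaPUnit I)).symm
  exact OneVar.mk_relabel ε (fun _ => rfl) (fun _ => HEq.rfl) (plug_id_right q ε fun _ => rfl)

theorem OneVar.Cls.comp_id {A : Q.Algebra} {c d : C} (t : OneVar.Cls A c d) :
    t.comp (OneVar.Cls.id A d) = t := by
  obtain ⟨⟨I, col, q, arg⟩⟩ := t
  symm
  let ε : I ≃ I ⊕ Σ _ : Empty, Unit := (Equiv.sumEmpty I _).symm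
  exact OneVar.mk_relabel ε (fun _ => rfl) (fun _ => HEq.rfl)
    (plug_id_left q _ ε fun _ => rfl)

theorem OneVar.Cls.assoc {A : Q.Algebra} {c d e f : C} (t1 : OneVar.Cls A c d)
    (t2 : OneVar.Cls A d e) (t3 : OneVar.Cls A e f) :
    (t1.comp t2).comp t3 = t1.comp (t2.comp t3) := by
  obtain ⟨⟨I1, col1, q1, arg1⟩⟩ := t1
  obtain ⟨⟨I2, col2, q2, arg2⟩⟩ := t2
  obtain ⟨⟨I3, col3, q3, arg3⟩⟩ := t3
  symm
  have h1 := plug_plug q3 q2 (fun i => Q.one (col3 i)) q1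
    (fun x => Q.one (Sum.elim col2 (fun y : Σ _ : I3, Unit => col3 y.1) x))
    (by rintro (_ | (i | ⟨i | ⟨i, j⟩, k⟩)) <;> rfl)
  have h2 := plug_congr (Equiv.refl I3) (fun _ => rfl) (Equiv.refl _)
    (fun _ => rfl) (J' := fun _ => Unit) (fun _ => Equiv.uniqueSigma fun _ : Unit => Unit)
    (b := fun i (_ : Σ _ : Unit, Unit) => col3 i) (b' := fun i _ => col3 i) (fun _ _ => rfl)
    (q := q3) (q' := q3) (map_self fun o => by simp).symm
    (q0 := Q.plug q2 q1 fun i => Q.one (col2 i)) (map_self fun o => by simp).symm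
    (r' := fun i => Q.one (col3 i))
    (r := fun i => Q.comp (Q.one (col3 i)) fun _ => Q.one (col3 i))
    (fun i => (Q.one_comp (Q.one (col3 i))).symm)
  refine OneVar.mk_relabel ((plugAssoc I1 fun _ : I2 ⊕ (Σ _ : I3, Unit) => Unit).trans
    (Equiv.sumCongr (Equiv.refl _) (Equiv.sigmaCongr (Equiv.refl I3)
        fun _ => Equiv.uniqueSigma fun _ : Unit => Unit))) ?_ ?_ ?_
  · rintro (i | ⟨i | ⟨i, j⟩, k⟩) <;> rfl
  · rintro (i | ⟨i | ⟨i, j⟩, k⟩) <;> rfl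
  · refine (h2.trans (congrArg _ h1.symm)).trans ((Q.map_map ..).trans (map_congr ?_))
    rintro (_ | (i | ⟨i | ⟨i, j⟩, k⟩)) <;> rfl

section eval

variable {A : Q.Algebra}

theorem Algebra.act_map' {I I' : Type} {c : I → C} {c' : I' → C} {d d' : C} {e : I ≃ I'}
    {h : ∀ i, c' (e i) = c i} {hd : d' = d} {p : Q.Op c d} {a : ∀ i, A.carrier (c i)}
    {a' : ∀ i, A.carrier (c' i)} (ha : ∀ i, a' (e i) ≍ a i) :
    A.act (Q.map e h hd p) a' ≍ A.act p a := by
  subst hd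
  obtain rfl : c = fun i => c' (e i) := funext fun i => (h i).symm
  obtain rfl : a = fun i => a' (e i) := funext fun i => (eq_of_heq (ha i)).symm
  exact heq_of_eq (A.act_map e p a')

theorem OneVar.act_idOp {c : C} (x : A.carrier c) (arg) :
    A.act (Q.idOp c) (OneVar.fill x arg) = x := by
  refine (eq_of_heq (Algebra.act_map' (a := fun _ : Unit => x) fun _ => HEq.rfl)).trans ?_
  exact A.act_one c x

theorem OneVar.act_plug {I I0 : Type} {J : I → Type} {c c' d : C} {col : I → C} {col0 : I0 → C}
    {b : ∀ i, J i → C} (q : Q.Op (slots c' col) d) (q0 : Q.Op (slots c col0) c')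
    (r : ∀ i, Q.Op (b i) (col i)) (x : A.carrier c) (arg0 : ∀ i, A.carrier (col0 i))
    (m : ∀ i j, A.carrier (b i j))
    (arg : ∀ i, A.carrier (Sum.elim col0 (fun y : Σ i, J i => b y.1 y.2) i))
    (h0 : ∀ i, arg (Sum.inl i) = arg0 i) (hm : ∀ i j, arg (Sum.inr ⟨i, j⟩) = m i j) :
    A.act (Q.plug q q0 r) (OneVar.fill x arg) =
      A.act q (OneVar.fill (A.act q0 (OneVar.fill x arg0)) fun i => A.act (r i) (m i)) := by
  let a : ∀ o (y : plugIdx (Option I0) J o), A.carrier (plugCol (slots c col0) b o y) := fun o =>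
    match o with
    | none => OneVar.fill x arg0
    | some i => m i
  refine (eq_of_heq (Algebra.act_map' (a := fun y : Σ o, plugIdx (Option I0) J o => a y.1 y.2)
    ?_)).trans ?_
  · rintro ⟨_ | i, y⟩
    · rcases y with _ | i
      · exact HEq.rfl
      · exact heq_of_eq (h0 i)
    · exact heq_of_eq (hm i y)
  · rw [A.act_comp]
    congr 1
    funext o
    rcases o with _ | i <;> rfl

theorem OneVar.eval_rel {c d : C} {t t' : OneVar A c d} (h : OneVar.Rel t t') (x : A.carrier c) :
    t.eval x = t'.eval x := by
  cases h with
  | relabel e col q arg =>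
    refine (eq_of_heq (Algebra.act_map' ?_)).symm
    rintro (_ | i) <;> exact HEq.rfl
  | @absorb I J col b q r arg =>
    let arg' : ∀ i, A.carrier
        (Sum.elim (Empty.elim : Empty → C) (fun y : Σ i, J i => b y.1 y.2) i) := fun i =>
      match i with
      | Sum.inl i => i.elim
      | Sum.inr y => arg y.1 y.2
    refine (eq_of_heq (Algebra.act_map' (a := OneVar.fill x arg') ?_)).trans ?_
    · rintro (_ | (i | i))
      · exact HEq.rfl
      · exact i.elim
      · exact HEq.rfl
    · rw [OneVar.act_plug q (Q.idOp c) r x (fun i => i.elim) arg arg' (fun i => i.elim)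
        (fun _ _ => rfl), OneVar.act_idOp]
      rfl

/-- The value of a class of expressions. -/
def OneVar.Cls.eval {c d : C} (t : OneVar.Cls A c d) (x : A.carrier c) : A.carrier d :=
  Quot.lift (fun t => OneVar.eval t x) (fun _ _ h => OneVar.eval_rel h x) t

theorem OneVar.Cls.eval_id (c : C) (x : A.carrier c) : (OneVar.Cls.id A c).eval x = x :=
  OneVar.act_idOp x _

theorem OneVar.Cls.eval_comp {c d e : C} (t : OneVar.Cls A c d) (t' : OneVar.Cls A d e)
    (x : A.carrier c) : (t.comp t').eval x = t'.eval (t.eval x) := by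
  obtain ⟨⟨I, col, q, arg⟩⟩ := t
  obtain ⟨⟨I', col', q', arg'⟩⟩ := t'
  refine (OneVar.act_plug q' q _ x arg (fun i _ => arg' i) _ (fun _ => rfl)
    (fun _ _ => rfl)).trans ?_
  simp only [A.act_one]
  rfl

end eval

/-- The objects of the twisted arrow category of the `Q`-algebra `A`: the elements of `A`. -/
structure Tw {Q : Operad C} (A : Q.Algebra) : Type where
  colour : C
  elt : A.carrier colour

/-- The twisted arrow category of an algebra `A` over an operad `Q`. Morphisms from `a` to `b` are the
elements `[q(a', a_1, ..., a_n)]` of `TO(A)` with one variable, marked by `a`, such that the value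
`q(a, a_1, ..., a_n)` is equal to `b`. The composition is substitution for the variable. -/
instance {A : Q.Algebra} : CategoryTheory.Category.{1} (Tw A) where
  Hom a b := {t : OneVar.Cls A a.colour b.colour // t.eval a.elt = b.elt}
  id a := ⟨OneVar.Cls.id A a.colour, OneVar.Cls.eval_id a.colour a.elt⟩
  comp s t := ⟨s.1.comp t.1, by rw [OneVar.Cls.eval_comp, s.2, t.2]⟩
  id_comp t := Subtype.ext t.1.id_comp
  comp_id t := Subtype.ext t.1.comp_id
  assoc r s t := Subtype.ext (OneVar.Cls.assoc r.1 s.1 t.1)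

end Operad

/-! ### Walks -/

/-- `Go nx x t`: the machine with transition function `nx`, which either moves to a new state or
stops with an output, goes from the state `x` to `t` in at least one step. -/
inductive Go {X O : Type} (nx : X → X ⊕ O) : X → X ⊕ O → Prop
  | single (x : X) : Go nx x (nx x)
  | cons {x x' : X} {t : X ⊕ O} : nx x = Sum.inl x' → Go nx x' t → Go nx x t

theorem Go.of_eq {X O : Type} {nx : X → X ⊕ O} {x : X} {t : X ⊕ O} (h : nx x = t) :
    Go nx x t := h ▸ Go.single x

theorem Go.trans {X O : Type} {nx : X → X ⊕ O} {x x' : X} {s t : X ⊕ O}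
    (h : Go nx x s) (hs : s = Sum.inl x') (h' : Go nx x' t) : Go nx x t := by
  induction h with
  | single x => exact Go.cons hs h'
  | cons h1 _ ih => exact Go.cons h1 (ih hs)

theorem Go.unique {X O : Type} {nx : X → X ⊕ O} {x : X} {o o' : O}
    (h : Go nx x (Sum.inr o)) (h' : Go nx x (Sum.inr o')) : o = o' := by
  generalize hs : (Sum.inr o : X ⊕ O) = s at h
  induction h with
  | single x =>
    generalize ht : (Sum.inr o' : X ⊕ O) = t at h'
    cases h' with
    | single => exact Sum.inr.inj (hs.trans ht.symm)
    | cons h1 _ => rw [h1] at hs; cases hs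
  | cons h1 _ ih =>
    refine ih ?_ hs
    generalize ht : (Sum.inr o' : X ⊕ O) = t at h'
    cases h' with
    | single => rw [h1] at ht; cases ht
    | cons h2 h3 => rw [h1] at h2; cases h2; exact h3

/-- Simulation of one machine by another one. -/
theorem Go.sim {X O X' O' : Type} {nx : X → X ⊕ O} {nx' : X' → X' ⊕ O'} (φ : X → X')
    (ψ : O → X' ⊕ O') (h : ∀ x, Go nx' (φ x) (Sum.elim (fun y => Sum.inl (φ y)) ψ (nx x)))
    {x : X} {t : X ⊕ O} (hx : Go nx x t) :
    Go nx' (φ x) (Sum.elim (fun y => Sum.inl (φ y)) ψ t) := by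
  induction hx with
  | single x => exact h x
  | cons h1 _ ih => exact Go.trans (h _) (by rw [h1]; rfl) ih

/-- On a finite state space, a reversible walk that starts at the border stops at the border. -/
theorem Go.exists_out {X O : Type} [Finite X] {nx : X → X ⊕ O} (ι : O → X)
    (hinj : Function.Injective fun x => Sum.elim id ι (nx x))
    (hne : ∀ x o, nx x ≠ Sum.inl (ι o)) (o : O) :
    ∃ o', Go nx (ι o) (Sum.inr o') := by
  by_contra hcon
  have key : ∀ n, (¬ ∃ o', Go nx ((fun x => Sum.elim id ι (nx x))^[n] (ι o)) (Sum.inr o')) ∧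
      ∀ o', (fun x => Sum.elim id ι (nx x))^[n + 1] (ι o) ≠ ι o' := by
    intro n
    have aux : ∀ x, (¬ ∃ o', Go nx x (Sum.inr o')) → ∃ x', nx x = Sum.inl x' := by
      intro x hx
      cases hn : nx x with
      | inl x' => exact ⟨x', rfl⟩
      | inr o' => exact absurd ⟨o', Go.of_eq hn⟩ hx
    induction n with
    | zero =>
      refine ⟨hcon, fun o' h => ?_⟩
      obtain ⟨x', hx'⟩ := aux _ hcon
      simp only [Function.iterate_succ, Function.iterate_zero, Function.comp, id, hx',
        Sum.elim_inl] at h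
      exact hne _ _ (h ▸ hx')
    | succ n ih =>
      obtain ⟨x', hx'⟩ := aux _ ih.1
      have h1 : ¬ ∃ o', Go nx ((fun x => Sum.elim id ι (nx x))^[n + 1] (ι o)) (Sum.inr o') := by
        rintro ⟨o', h⟩
        rw [Function.iterate_succ_apply'] at h
        simp only [hx', Sum.elim_inl, id] at h
        exact ih.1 ⟨o', Go.cons hx' h⟩
      refine ⟨h1, fun o' h => ?_⟩
      obtain ⟨x'', hx''⟩ := aux _ h1
      rw [Function.iterate_succ_apply'] at h
      simp only [hx'', Sum.elim_inl, id] at h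
      exact hne _ _ (h ▸ hx'')
  obtain ⟨n, hn, hp⟩ := hinj.mem_periodicPts (ι o)
  obtain ⟨m, rfl⟩ : ∃ m, n = m + 1 := ⟨n - 1, by omega⟩
  exact (key m).2 o hp

/-! ### Trees with half-edges -/

/-- The half-edges of an operadic graph whose vertices are indexed by `I`, with `c i + 1` ordered
half-edges at the vertex `i`, together with labels `0, ..., d` of its leaves. -/
abbrev Port {I : Type} (c : I → ℕ) (d : ℕ) : Type := (Σ i, Fin (c i + 1)) ⊕ Fin (d + 1)

/-- Operadic graphs that are trees, with at least one leaf. The vertices (indexed by `I`), the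
half-edges at every vertex and the leaves are ordered, so that such graphs have no nontrivial
isomorphisms; a graph is determined by the involution `inv`, which exchanges the two half-edges
of every inner edge, and exchanges the half-edge of every leaf with the label of this leaf.
If `I` is empty, then `inv` exchanges the two leaf labels, and the graph is the exceptional edge
(an edge without vertices).
The graph is connected (`conn`), and `euler` says that the number of vertices is the number of
inner edges plus `1`, as the number of half-edges is `∑ i, (c i + 1)`, and `d + 1` of these are
leaves. -/
@[ext] structure CycTree {I : Type} (c : I → ℕ) (d : ℕ) where
  finite : Finite I
  inv : Port c d → Port c d
  inv_inv : ∀ x, inv (inv x) = x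
  inv_ne : ∀ x, inv x ≠ x
  conn : ∀ S : Set (Port c d), S.Nonempty → (∀ x ∈ S, inv x ∈ S) →
    (∀ i k k', Sum.inl ⟨i, k⟩ ∈ S → Sum.inl ⟨i, k'⟩ ∈ S) → ∀ x, x ∈ S
  euler : (∑ᶠ i, c i) + 1 = d + Nat.card I

namespace CycTree

/-- The corolla: the identity operation. -/
def one (n : ℕ) : CycTree (fun _ : Unit => n) n where
  finite := inferInstance
  inv := Sum.elim (fun x => Sum.inr x.2) (fun k => Sum.inl ⟨(), k⟩)
  inv_inv := by rintro (⟨_, k⟩ | k) <;> rfl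
  inv_ne := by rintro (⟨_, k⟩ | k) <;> simp
  conn := by
    rintro S ⟨x, hx⟩ h1 h2
    have h0 : ∃ k, Sum.inl ⟨(), k⟩ ∈ S := by
      rcases x with ⟨_, k⟩ | k
      · exact ⟨k, hx⟩
      · exact ⟨k, h1 _ hx⟩
    obtain ⟨k, hk⟩ := h0
    rintro (⟨_, k'⟩ | k')
    · exact h2 _ _ _ hk
    · exact h1 _ (h2 _ k k' hk)
  euler := by simp [finsum_unique]

/-- Relabelling of half-edges. -/
def portEquiv {I I' : Type} {c : I → ℕ} {c' : I' → ℕ} {d d' : ℕ} (e : I ≃ I')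
    (h : ∀ i, c' (e i) = c i) (hd : d' = d) : Port c d ≃ Port c' d' :=
  Equiv.sumCongr (Equiv.sigmaCongr e fun i => finCongr (by rw [h i])) (finCongr (by rw [hd]))

/-- Relabelling of vertices. -/
def map {I I' : Type} {c : I → ℕ} {c' : I' → ℕ} {d d' : ℕ} (e : I ≃ I')
    (h : ∀ i, c' (e i) = c i) (hd : d' = d) (p : CycTree c d) : CycTree c' d' where
  finite := have := p.finite; Finite.of_equiv I e
  inv x := portEquiv e h hd (p.inv ((portEquiv e h hd).symm x))
  inv_inv x := by simp [p.inv_inv]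
  inv_ne x := by
    rw [Ne, ← Equiv.eq_symm_apply]
    exact p.inv_ne _
  conn := by
    intro S hS h1 h2
    obtain rfl : c = fun i => c' (e i) := funext fun i => (h i).symm
    subst hd
    have key := p.conn ((portEquiv e h rfl) ⁻¹' S) ?_ ?_ ?_
    · intro x
      simpa using key ((portEquiv e h rfl).symm x)
    · obtain ⟨x, hx⟩ := hS
      exact ⟨(portEquiv e h rfl).symm x, by simpa using hx⟩
    · intro x hx
      simpa using h1 _ hx
    · intro i k k' hk
      exact h2 _ _ _ hk
  euler := by
    rw [← Nat.card_congr e, hd, ← p.euler, ← finsum_comp_equiv e]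
    simp only [h]

/-! Composition of trees: the vertex `i` of `p` is replaced by the tree `q i`, and the leaves of
`q i` are identified with the half-edges of the vertex `i`. -/

section comp

variable {I : Type} {J : I → Type} {c : I → ℕ} {b : ∀ i, J i → ℕ} {d : ℕ}

/-- All half-edges and leaf labels of the trees `q i` and of `p`. -/
abbrev CPort (c : I → ℕ) (b : ∀ i, J i → ℕ) (d : ℕ) : Type :=
  (Σ i, Port (b i) (c i)) ⊕ Port c d

/-- The involutions of `q i` and of `p`. -/
def edge (p : CycTree c d) (q : ∀ i, CycTree (b i) (c i)) : CPort c b d → CPort c b d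
  | Sum.inl ⟨i, x⟩ => Sum.inl ⟨i, (q i).inv x⟩
  | Sum.inr x => Sum.inr (p.inv x)

/-- Passage from the `k`-th leaf label of `q i` to the `k`-th half-edge of the vertex `i` of `p`, and
back. The remaining half-edges and labels are those of the composition. -/
def cross : CPort c b d → CPort c b d ⊕ Port (fun x : Σ i, J i => b x.1 x.2) d
  | Sum.inl ⟨i, Sum.inl ⟨j, k⟩⟩ => Sum.inr (Sum.inl ⟨⟨i, j⟩, k⟩)
  | Sum.inl ⟨i, Sum.inr k⟩ => Sum.inl (Sum.inr (Sum.inl ⟨i, k⟩))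
  | Sum.inr (Sum.inl ⟨i, k⟩) => Sum.inl (Sum.inl ⟨i, Sum.inr k⟩)
  | Sum.inr (Sum.inr k) => Sum.inr (Sum.inr k)

/-- The inclusion of the half-edges of the composition. -/
def outer : Port (fun x : Σ i, J i => b x.1 x.2) d → CPort c b d
  | Sum.inl ⟨⟨i, j⟩, k⟩ => Sum.inl ⟨i, Sum.inl ⟨j, k⟩⟩
  | Sum.inr k => Sum.inr (Sum.inr k)

/-- The walk along edges of the trees `p` and `q i` until the end of an edge of the composition is
reached. -/
def nx (p : CycTree c d) (q : ∀ i, CycTree (b i) (c i)) (x : CPort c b d) :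
    CPort c b d ⊕ Port (fun x : Σ i, J i => b x.1 x.2) d :=
  cross (edge p q x)

variable (p : CycTree c d) (q : ∀ i, CycTree (b i) (c i))

theorem edge_edge (x : CPort c b d) : edge p q (edge p q x) = x := by
  rcases x with ⟨i, x⟩ | x <;> simp [edge, inv_inv]

theorem edge_ne (x : CPort c b d) : edge p q x ≠ x := by
  rcases x with ⟨i, x⟩ | x <;> simp [edge, inv_ne]

theorem cross_outer (o : Port (fun x : Σ i, J i => b x.1 x.2) d) :
    cross (c := c) (outer o) = Sum.inr o := by
  rcases o with ⟨⟨i, j⟩, k⟩ | k <;> rfl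

theorem outer_of_cross {x : CPort c b d} {o} (h : cross x = Sum.inr o) : outer o = x := by
  rcases x with ⟨i, ⟨j, k⟩ | k⟩ | ⟨i, k⟩ | k <;> simp [cross] at h <;> subst h <;> rfl

theorem cross_of_cross {x y : CPort c b d} (h : cross x = Sum.inl y) : cross y = Sum.inl x := by
  rcases x with ⟨i, ⟨j, k⟩ | k⟩ | ⟨i, k⟩ | k <;> simp [cross] at h <;> subst h <;> rfl

theorem cross_ne {x y : CPort c b d} (h : cross x = Sum.inl y) : x ≠ y := by
  rintro rfl
  rcases x with ⟨i, ⟨j, k⟩ | k⟩ | ⟨i, k⟩ | k <;> simp [cross] at h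

theorem exists_out (o : Port (fun x : Σ i, J i => b x.1 x.2) d) :
    ∃ o', Go (nx p q) (outer o) (Sum.inr o') := by
  have := p.finite
  have := fun i => (q i).finite
  refine Go.exists_out outer ?_ ?_ o
  · have hw : Function.Involutive fun x : CPort c b d => Sum.elim id outer (cross x) := by
      rintro (⟨i, ⟨j, k⟩ | k⟩ | ⟨i, k⟩ | k) <;> rfl
    have he : Function.Involutive (edge p q) := edge_edge p q
    exact hw.injective.comp he.injective
  · intro x o h
    have := cross_of_cross h
    rw [cross_outer] at this
    cases this

/-- The involution of the composition. -/
noncomputable def compInv (o : Port (fun x : Σ i, J i => b x.1 x.2) d) :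
    Port (fun x : Σ i, J i => b x.1 x.2) d :=
  (exists_out p q o).choose

theorem compInv_spec (o) : Go (nx p q) (outer o) (Sum.inr (compInv p q o)) :=
  (exists_out p q o).choose_spec

theorem go_edge {x : CPort c b d} {o} (h : Go (nx p q) x (Sum.inr o)) :
    Go (nx p q) (edge p q x) (Sum.inr (compInv p q o)) := by
  -- the reversed walk
  have key : ∀ {x : CPort c b d} {t}, Go (nx p q) x t → t = Sum.inr o →
      edge p q x = outer o ∨ Go (nx p q) (outer o) (Sum.inl (edge p q x)) := by
    intro x t h
    induction h with
    | single x => exact fun ht => Or.inl (outer_of_cross ht).symm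
    | @cons x x' t h1 h2 ih =>
      intro ht
      right
      have h3 : nx p q (edge p q x') = Sum.inl (edge p q x) := by
        rw [nx, edge_edge]
        exact cross_of_cross h1
      rcases ih ht with h4 | h4
      · rw [← h4]
        exact Go.of_eq h3
      · exact Go.trans h4 rfl (Go.of_eq h3)
  have fwd : ∀ {x : CPort c b d} {s} {y}, Go (nx p q) x s → s = Sum.inl y →
      ∀ o', Go (nx p q) x (Sum.inr o') → Go (nx p q) y (Sum.inr o') := by
    intro x s y h
    induction h with
    | single x =>
      intro hs o' ho
      generalize ht : Sum.inr o' = t at ho ⊢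
      cases ho with
      | single => rw [hs] at ht; cases ht
      | cons h5 h6 => rw [hs] at h5; cases h5; exact h6
    | cons h1 _ ih =>
      intro hs o' ho
      refine ih hs o' ?_
      generalize ht : Sum.inr o' = t at ho ⊢
      cases ho with
      | single => rw [h1] at ht; cases ht
      | cons h5 h6 => rw [h1] at h5; cases h5; exact h6
  rcases key h rfl with h4 | h4
  · rw [h4]
    exact compInv_spec p q o
  · exact fwd h4 rfl _ (compInv_spec p q o)

theorem compInv_compInv (o) : compInv p q (compInv p q o) = o := by
  refine (go_edge p q (compInv_spec p q o)).unique (Go.of_eq ?_)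
  rw [nx, edge_edge, cross_outer]

theorem compInv_ne (o) : compInv p q o ≠ o := by
  intro hcon
  have h := compInv_spec p q o
  rw [hcon] at h
  -- a walk of length `n` in terms of lengths
  have len : ∀ {x : CPort c b d} {t}, Go (nx p q) x t → t = Sum.inr o →
      ∃ n, ∃ f : ℕ → CPort c b d, f 0 = x ∧ (∀ i < n, nx p q (f i) = Sum.inl (f (i + 1))) ∧
        edge p q (f n) = outer o := by
    intro x t h
    induction h with
    | single x => exact fun ht => ⟨0, fun _ => x, rfl, by simp, (outer_of_cross ht).symm⟩
    | @cons x x' t h1 _ ih =>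
      intro ht
      obtain ⟨n, f, h0, h2, h3⟩ := ih ht
      refine ⟨n + 1, fun i => Nat.casesOn i x f, rfl, ?_, h3⟩
      rintro (_ | i) hi
      · simpa [h0] using h1
      · exact h2 i (by omega)
  obtain ⟨n, f, h0, h2, h3⟩ := len h rfl
  have refl : ∀ i ≤ n, f (n - i) = edge p q (f i) := by
    intro i
    induction i with
    | zero =>
      intro _
      rw [h0, ← h3, edge_edge, Nat.sub_zero]
    | succ i ih =>
      intro hi
      have h4 := ih (by omega)
      have h5 := h2 i (by omega)
      have h6 := h2 (n - (i + 1)) (by omega)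
      rw [show n - (i + 1) + 1 = n - i by omega, h4] at h6
      have h7 := cross_of_cross h5
      have h8 := cross_of_cross h6
      have h9 := h8.symm.trans h5
      rw [Sum.inl.injEq] at h9
      rw [← h9, edge_edge]
  rcases Nat.even_or_odd' n with ⟨m, rfl | rfl⟩
  · have := refl m (by omega)
    rw [show 2 * m - m = m by omega] at this
    exact edge_ne p q _ this.symm
  · have h4 := refl m (by omega)
    rw [show 2 * m + 1 - m = m + 1 by omega] at h4
    have h5 := h2 m (by omega)
    rw [h4] at h5
    exact cross_ne h5 rfl

theorem comp_conn (S : Set (Port (fun x : Σ i, J i => b x.1 x.2) d)) (hS : S.Nonempty)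
    (h1 : ∀ x ∈ S, compInv p q x ∈ S)
    (h2 : ∀ i k k', Sum.inl ⟨i, k⟩ ∈ S → Sum.inl ⟨i, k'⟩ ∈ S) (x) : x ∈ S := by
  let T : Set (CPort c b d) := {x | ∃ o ∈ S, Go (nx p q) x (Sum.inr o)}
  have hT : ∀ o, outer o ∈ T ↔ o ∈ S := by
    intro o
    constructor
    · rintro ⟨o', ho', h⟩
      rw [← compInv_compInv p q o, (compInv_spec p q o).unique h]
      exact h1 _ ho'
    · exact fun ho => ⟨_, h1 _ ho, compInv_spec p q o⟩
  have hE : ∀ x ∈ T, edge p q x ∈ T := by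
    rintro x ⟨o, ho, h⟩
    exact ⟨_, h1 _ ho, go_edge p q h⟩
  have hW : ∀ x y, cross x = Sum.inl y → x ∈ T → y ∈ T := by
    rintro x y hxy hx
    obtain ⟨o, ho, h⟩ := hE x hx
    refine ⟨o, ho, ?_⟩
    have h3 : nx p q (edge p q x) = Sum.inl y := by rw [nx, edge_edge, hxy]
    generalize ht : Sum.inr o = t at h ⊢
    cases h with
    | single => rw [h3] at ht; cases ht
    | cons h5 h6 => rw [h3] at h5; cases h5; exact h6
  have hV : ∀ i j k k', Sum.inl ⟨i, Sum.inl ⟨j, k⟩⟩ ∈ T → Sum.inl ⟨i, Sum.inl ⟨j, k'⟩⟩ ∈ T := by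
    intro i j k k' h
    exact (hT (Sum.inl ⟨⟨i, j⟩, k'⟩)).2 (h2 _ _ _ ((hT (Sum.inl ⟨⟨i, j⟩, k⟩)).1 h))
  have hq : ∀ i x y, Sum.inl ⟨i, x⟩ ∈ T → Sum.inl ⟨i, y⟩ ∈ T := by
    intro i x y hx
    exact (q i).conn {x | (Sum.inl ⟨i, x⟩ : CPort c b d) ∈ T} ⟨x, hx⟩
      (fun z hz => hE (Sum.inl ⟨i, z⟩) hz) (fun j k k' hk => hV i j k k' hk) y
  have hp : ∀ x y, Sum.inr x ∈ T → Sum.inr y ∈ T := by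
    intro x y hx
    refine p.conn {x | Sum.inr x ∈ T} ⟨x, hx⟩ (fun z hz => hE _ hz) ?_ y
    intro i k k' hk
    exact hW (Sum.inl ⟨i, Sum.inr k'⟩) _ rfl
      (hq i (Sum.inr k) _ (hW (Sum.inr (Sum.inl ⟨i, k⟩)) _ rfl hk))
  obtain ⟨o, ho⟩ := hS
  have h0 : Sum.inr (Sum.inr 0) ∈ T := by
    have := (hT o).2 ho
    rcases o with ⟨⟨i, j⟩, k⟩ | k
    · exact hp _ _ (hW (Sum.inl ⟨i, Sum.inr 0⟩) _ rfl (hq i _ _ this))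
    · exact hp _ _ this
  rw [← hT]
  rcases x with ⟨⟨i, j⟩, k⟩ | k
  · exact hq i _ _ (hW (Sum.inr (Sum.inl ⟨i, 0⟩)) _ rfl (hp _ _ h0))
  · exact hp _ _ h0

/-- Substitution of trees into the vertices of a tree. -/
noncomputable def comp : CycTree (fun x : Σ i, J i => b x.1 x.2) d where
  finite := by
    have := p.finite
    have := fun i => (q i).finite
    infer_instance
  inv := compInv p q
  inv_inv := compInv_compInv p q
  inv_ne := compInv_ne p q
  conn := comp_conn p q
  euler := by
    have := p.finite
    have := fun i => (q i).finite
    have := Fintype.ofFinite I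
    have := fun i => Fintype.ofFinite (J i)
    have hp := p.euler
    have hq := fun i => (q i).euler
    simp only [finsum_eq_sum_of_fintype, Nat.card_eq_fintype_card, Fintype.sum_sigma,
      Fintype.card_sigma] at hp hq ⊢
    have := Finset.sum_congr (s₁ := Finset.univ) rfl fun i _ => hq i
    simp only [Finset.sum_add_distrib, Finset.sum_const, Finset.card_univ, smul_eq_mul,
      mul_one] at this
    omega

end comp

/-! The operad laws. -/

section laws

variable {I : Type} {J : I → Type} {c : I → ℕ} {b : ∀ i, J i → ℕ} {d : ℕ}

theorem comp_inv_eq {p : CycTree c d} {q : ∀ i, CycTree (b i) (c i)} {o o'}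
    (h : Go (nx p q) (outer o) (Sum.inr o')) : (comp p q).inv o = o' :=
  (compInv_spec p q o).unique h

theorem map_eq {I I' : Type} {c : I → ℕ} {c' : I' → ℕ} {d d' : ℕ} {e : I ≃ I'}
    {h : ∀ i, c' (e i) = c i} {hd : d' = d} {p : CycTree c d} {p' : CycTree c' d'}
    (H : ∀ x, p'.inv (portEquiv e h hd x) = portEquiv e h hd (p.inv x)) :
    map e h hd p = p' := by
  apply CycTree.ext
  funext x
  change portEquiv e h hd (p.inv ((portEquiv e h hd).symm x)) = _
  rw [← H, Equiv.apply_symm_apply]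

theorem map_inv_apply {I I' : Type} {c : I → ℕ} {c' : I' → ℕ} {d d' : ℕ} (e : I ≃ I')
    (h : ∀ i, c' (e i) = c i) (hd : d' = d) (p : CycTree c d) (x : Port c d) :
    (map e h hd p).inv (portEquiv e h hd x) = portEquiv e h hd (p.inv x) := by
  simp [map]

theorem map_refl (p : CycTree c d) : map (Equiv.refl I) (fun _ => rfl) rfl p = p := by
  have h : ∀ x, portEquiv (c := c) (c' := c) (Equiv.refl I) (fun i => rfl) (rfl : d = d) x = x := by
    rintro (⟨i, k⟩ | k) <;> rfl
  exact map_eq fun x => (congrArg p.inv (h x)).trans (h _).symm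

theorem map_map {I I' I'' : Type} {c : I → ℕ} {c' : I' → ℕ} {c'' : I'' → ℕ} {d d' d'' : ℕ}
    (e : I ≃ I') (h : ∀ i, c' (e i) = c i) (hd : d' = d)
    (e' : I' ≃ I'') (h' : ∀ i, c'' (e' i) = c' i) (hd' : d'' = d') (p : CycTree c d) :
    map e' h' hd' (map e h hd p) =
      map (e.trans e') (fun i => (h' (e i)).trans (h i)) (hd'.trans hd) p := by
  have h0 : ∀ x, portEquiv (e.trans e') (fun i => (h' (e i)).trans (h i)) (hd'.trans hd) x =
      portEquiv e' h' hd' (portEquiv e h hd x) := by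
    rintro (⟨i, k⟩ | k) <;> rfl
  refine (map_eq fun x => ?_).symm
  rw [h0, h0, map_inv_apply, map_inv_apply]

theorem comp_map {I I' : Type} {J : I → Type} {J' : I' → Type} {c : I → ℕ} {c' : I' → ℕ}
    {b : ∀ i, J i → ℕ} {b' : ∀ i, J' i → ℕ} {d d' : ℕ}
    (e : I ≃ I') (h : ∀ i, c' (e i) = c i) (hd : d' = d)
    (f : ∀ i, J i ≃ J' (e i)) (hf : ∀ i j, b' (e i) (f i j) = b i j)
    (p : CycTree c d) (q : ∀ i, CycTree (b i) (c i)) (q' : ∀ i, CycTree (b' i) (c' i))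
    (hq : ∀ i, q' (e i) = map (f i) (hf i) (h i) (q i)) :
    comp (map e h hd p) q' =
      map (Equiv.sigmaCongr e f) (fun x => hf x.1 x.2) hd (comp p q) := by
  let φ : CPort c b d → CPort c' b' d' := Sum.elim
    (fun x => Sum.inl ⟨e x.1, portEquiv (f x.1) (hf x.1) (h x.1) x.2⟩)
    (fun x => Sum.inr (portEquiv e h hd x))
  let E := portEquiv (c := fun x : Σ i, J i => b x.1 x.2)
    (c' := fun x : Σ i, J' i => b' x.1 x.2) (Equiv.sigmaCongr e f) (fun x => hf x.1 x.2) hd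
  have hedge : ∀ x, edge (map e h hd p) q' (φ x) = φ (edge p q x) := by
    rintro (⟨i, x⟩ | x)
    · simp only [φ, edge, Sum.elim_inl, hq, map_inv_apply]
    · simp only [φ, edge, Sum.elim_inr, map_inv_apply]
  have hcross : ∀ x, cross (φ x) = Sum.elim (fun y => Sum.inl (φ y))
      (fun o => Sum.inr (E o)) (cross x) := by
    rintro (⟨i, ⟨j, k⟩ | k⟩ | ⟨i, k⟩ | k) <;> rfl
  have houter : ∀ o, φ (outer o) = outer (E o) := by
    rintro (⟨⟨i, j⟩, k⟩ | k) <;> rfl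
  have key : ∀ o, (comp (map e h hd p) q').inv (E o) = E ((comp p q).inv o) := by
    intro o
    apply comp_inv_eq
    rw [← houter]
    refine Go.sim φ (fun o => Sum.inr (E o)) (fun x => Go.of_eq ?_) (compInv_spec p q o)
    rw [nx, hedge, hcross]
    rfl
  exact (map_eq key).symm

theorem one_comp (p : CycTree c d) :
    map (Equiv.uniqueSigma fun _ : Unit => I) (fun _ => rfl) rfl
      (comp (one d) (fun _ => p)) = p := by
  let E := portEquiv (c := fun x : Σ _ : Unit, I => c x.2) (c' := c) (d := d)
    (Equiv.uniqueSigma fun _ : Unit => I) (fun _ => rfl) rfl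
  let E' : Port c d → Port (fun x : Σ _ : Unit, I => c x.2) d :=
    Sum.elim (fun x => Sum.inl ⟨⟨(), x.1⟩, x.2⟩) Sum.inr
  have hE : ∀ x, E (E' x) = x := by rintro (⟨i, k⟩ | k) <;> rfl
  have hE' : ∀ x, E' (E x) = x := by rintro (⟨⟨_, i⟩, k⟩ | k) <;> rfl
  have key : ∀ x, (comp (one d) (fun _ => p)).inv (E' x) = E' (p.inv x) := by
    intro x
    apply comp_inv_eq
    have step : ∀ x, Go (nx (one d) fun _ => p) (Sum.inl ⟨(), x⟩) (Sum.inr (E' (p.inv x))) := by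
      intro x
      cases hx : p.inv x with
      | inl y =>
        refine Go.of_eq ?_
        simp only [nx, edge, hx]
        rfl
      | inr k =>
        refine Go.cons (x' := Sum.inr (Sum.inl ⟨(), k⟩)) ?_ (Go.of_eq rfl)
        simp only [nx, edge, hx]
        rfl
    rcases x with ⟨i, k⟩ | k
    · exact step _
    · exact Go.cons (x' := Sum.inl ⟨(), Sum.inr k⟩) rfl (step _)
  refine map_eq fun x => ?_
  change p.inv (E x) = E _
  rw [← hE' x, key, hE, hE]

theorem comp_one (p : CycTree c d) :
    map (Equiv.sigmaPUnit I) (fun _ => rfl) rfl (comp p (fun i => one (c i))) = p := by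
  let E := portEquiv (c := fun x : Σ _ : I, Unit => c x.1) (c' := c) (d := d)
    (Equiv.sigmaPUnit I) (fun _ => rfl) rfl
  let E' : Port c d → Port (fun x : Σ _ : I, Unit => c x.1) d :=
    Sum.elim (fun x => Sum.inl ⟨⟨x.1, ()⟩, x.2⟩) Sum.inr
  have hE : ∀ x, E (E' x) = x := by rintro (⟨i, k⟩ | k) <;> rfl
  have hE' : ∀ x, E' (E x) = x := by rintro (⟨⟨i, _⟩, k⟩ | k) <;> rfl
  have key : ∀ x, (comp p (fun i => one (c i))).inv (E' x) = E' (p.inv x) := by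
    intro x
    apply comp_inv_eq
    have step : ∀ x, Go (nx p fun i => one (c i)) (Sum.inr x) (Sum.inr (E' (p.inv x))) := by
      intro x
      cases hx : p.inv x with
      | inl y =>
        refine Go.cons (x' := Sum.inl ⟨y.1, Sum.inr y.2⟩) ?_ (Go.of_eq rfl)
        simp only [nx, edge, hx]
        rfl
      | inr k =>
        refine Go.of_eq ?_
        simp only [nx, edge, hx]
        rfl
    rcases x with ⟨i, k⟩ | k
    · exact Go.cons (x' := Sum.inr (Sum.inl ⟨i, k⟩)) rfl (step _)
    · exact step _
  refine map_eq fun x => ?_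
  change p.inv (E x) = E _
  rw [← hE' x, key, hE, hE]

variable {K : ∀ i, J i → Type} {a : ∀ i j, K i j → ℕ}

/-- All half-edges and leaf labels in an iterated composition. -/
abbrev CPort3 (c : I → ℕ) (b : ∀ i, J i → ℕ) (a : ∀ i j, K i j → ℕ) (d : ℕ) : Type :=
  (Σ x : Σ i, J i, Port (a x.1 x.2) (b x.1 x.2)) ⊕ CPort c b d

/-- The walk along edges in an iterated composition. -/
def nx3 (p : CycTree c d) (q : ∀ i, CycTree (b i) (c i)) (r : ∀ i j, CycTree (a i j) (b i j)) :
    CPort3 c b a d →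
      CPort3 c b a d ⊕ Port (fun x : Σ i, Σ j, K i j => a x.1 x.2.1 x.2.2) d := fun x =>
  match Sum.map (fun y : Σ x : Σ i, J i, Port (a x.1 x.2) (b x.1 x.2) =>
      (⟨y.1, (r y.1.1 y.1.2).inv y.2⟩ : Σ x : Σ i, J i, Port (a x.1 x.2) (b x.1 x.2)))
      (edge p q) x with
  | Sum.inl ⟨⟨i, j⟩, Sum.inl ⟨k, l⟩⟩ => Sum.inr (Sum.inl ⟨⟨i, j, k⟩, l⟩)
  | Sum.inl ⟨⟨i, j⟩, Sum.inr l⟩ => Sum.inl (Sum.inr (Sum.inl ⟨i, Sum.inl ⟨j, l⟩⟩))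
  | Sum.inr (Sum.inl ⟨i, Sum.inl ⟨j, l⟩⟩) => Sum.inl (Sum.inl ⟨⟨i, j⟩, Sum.inr l⟩)
  | Sum.inr (Sum.inl ⟨i, Sum.inr l⟩) => Sum.inl (Sum.inr (Sum.inr (Sum.inl ⟨i, l⟩)))
  | Sum.inr (Sum.inr (Sum.inl ⟨i, l⟩)) => Sum.inl (Sum.inr (Sum.inl ⟨i, Sum.inr l⟩))
  | Sum.inr (Sum.inr (Sum.inr l)) => Sum.inr (Sum.inr l)

theorem assoc (p : CycTree c d) (q : ∀ i, CycTree (b i) (c i))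
    (r : ∀ i j, CycTree (a i j) (b i j)) :
    map (Equiv.sigmaAssoc K) (fun _ => rfl) rfl
        (comp (comp p q) (fun x : Σ i, J i => r x.1 x.2)) =
      comp p (fun i => comp (q i) (r i)) := by
  let E := portEquiv (c := fun x : Σ y : Σ i, J i, K y.1 y.2 => a x.1.1 x.1.2 x.2)
    (c' := fun x : Σ i, Σ j, K i j => a x.1 x.2.1 x.2.2) (d := d)
    (Equiv.sigmaAssoc K) (fun _ => rfl) rfl
  let N := nx3 p q r
  let out3 : Port (fun x : Σ i, Σ j, K i j => a x.1 x.2.1 x.2.2) d → CPort3 c b a d :=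
    Sum.elim (fun x => Sum.inl ⟨⟨x.1.1, x.1.2.1⟩, Sum.inl ⟨x.1.2.2, x.2⟩⟩)
      (fun l => Sum.inr (Sum.inr (Sum.inr l)))
  -- the left hand side
  have hl : ∀ o, Go N (out3 (E o))
      (Sum.inr (E ((comp (comp p q) (fun x : Σ i, J i => r x.1 x.2)).inv o))) := by
    let ψ : Port (fun x : Σ i, J i => b x.1 x.2) d →
        CPort3 c b a d ⊕ Port (fun x : Σ i, Σ j, K i j => a x.1 x.2.1 x.2.2) d :=
      Sum.elim (fun x => Sum.inl (Sum.inl ⟨x.1, Sum.inr x.2⟩)) (fun l => Sum.inr (Sum.inr l))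
    have h1 : ∀ o, Go N (Sum.inr (outer o)) (ψ ((comp p q).inv o)) := by
      intro o
      refine Go.sim Sum.inr ψ (fun x => Go.of_eq ?_) (compInv_spec p q o)
      simp only [N, nx3, nx, Sum.map_inr]
      rcases edge p q x with ⟨i, ⟨j, l⟩ | l⟩ | ⟨i, l⟩ | l <;> rfl
    let φ : CPort (fun x : Σ i, J i => b x.1 x.2) (fun (x : Σ i, J i) => a x.1 x.2) d →
        CPort3 c b a d := Sum.map id outer
    intro o
    have h2 := Go.sim (nx' := N) φ (fun o => Sum.inr (E o)) ?_
      (compInv_spec (comp p q) (fun x : Σ i, J i => r x.1 x.2) o)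
    · have h4 : out3 (E o) = φ (outer o) := by
        rcases o with ⟨⟨⟨i, j⟩, k⟩, l⟩ | l <;> rfl
      rw [h4]
      exact h2
    · rintro (⟨⟨i, j⟩, x⟩ | x)
      · refine Go.of_eq ?_
        simp only [N, nx3, nx, φ, edge, Sum.map_inl, id]
        rcases (r i j).inv x with ⟨k, l⟩ | l <;> rfl
      · have h3 := h1 x
        simp only [nx, edge]
        revert h3
        rcases (comp p q).inv x with ⟨⟨i, j⟩, l⟩ | l <;> exact id
  -- the right hand side
  have hr : ∀ o, Go N (out3 o) (Sum.inr ((comp p (fun i => comp (q i) (r i))).inv o)) := by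
    let ψ : ∀ i, Port (fun x : Σ j, K i j => a i x.1 x.2) (c i) →
        CPort3 c b a d ⊕ Port (fun x : Σ i, Σ j, K i j => a x.1 x.2.1 x.2.2) d := fun i =>
      Sum.elim (fun x => Sum.inr (Sum.inl ⟨⟨i, x.1⟩, x.2⟩))
        (fun l => Sum.inl (Sum.inr (Sum.inr (Sum.inl ⟨i, l⟩))))
    let φ1 : ∀ i, CPort (b i) (a i) (c i) → CPort3 c b a d := fun i =>
      Sum.elim (fun x => Sum.inl ⟨⟨i, x.1⟩, x.2⟩) (fun x => Sum.inr (Sum.inl ⟨i, x⟩))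
    have h1 : ∀ i o, Go N (φ1 i (outer o)) (ψ i ((comp (q i) (r i)).inv o)) := by
      intro i o
      refine Go.sim (φ1 i) (ψ i) (fun x => Go.of_eq ?_) (compInv_spec (q i) (r i) o)
      rcases x with ⟨j, x⟩ | x
      · simp only [N, nx3, nx, φ1, edge, Sum.elim_inl, Sum.map_inl]
        rcases (r i j).inv x with ⟨k, l⟩ | l <;> rfl
      · simp only [N, nx3, nx, φ1, edge, Sum.elim_inr, Sum.map_inr]
        rcases (q i).inv x with ⟨k, l⟩ | l <;> rfl
    let φ : CPort c (fun i (x : Σ j, K i j) => a i x.1 x.2) d → CPort3 c b a d :=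
      Sum.elim (fun x => φ1 x.1 (outer x.2)) (fun x => Sum.inr (Sum.inr x))
    intro o
    have h2 := Go.sim (nx' := N) φ Sum.inr ?_ (compInv_spec p (fun i => comp (q i) (r i)) o)
    · have h4 : out3 o = φ (outer o) := by
        rcases o with ⟨⟨i, j, k⟩, l⟩ | l <;> rfl
      rw [h4]
      exact h2
    · rintro (⟨i, x⟩ | x)
      · have h3 := h1 i x
        simp only [nx, edge]
        revert h3
        rcases (comp (q i) (r i)).inv x with ⟨⟨j, k⟩, l⟩ | l <;> exact id
      · refine Go.of_eq ?_
        simp only [N, nx3, nx, φ, edge, Sum.elim_inr, Sum.map_inr]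
        rcases p.inv x with ⟨i, l⟩ | l <;> rfl
  exact map_eq fun o => ((hl o).unique (hr (E o))).symm

end laws

end CycTree

/-- The operad `cOp` of cyclic operads: its colours are natural numbers, the colour of a vertex with
`n + 1` half-edges is `n`, its operations are trees with at least one leaf, and composition is
substitution of trees into vertices. -/
noncomputable def cOp : Operad ℕ where
  Op c d := CycTree c d
  finite p := p.finite
  one := CycTree.one
  map := CycTree.map
  comp := CycTree.comp
  map_refl := CycTree.map_refl
  map_map := CycTree.map_map
  comp_map := CycTree.comp_map
  one_comp := CycTree.one_comp
  comp_one := CycTree.comp_one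
  assoc := CycTree.assoc

/-! ### Cyclic orders -/

section faces

variable {X : Type} [Finite X]

open Equiv

/-- Multiplication by a transposition joins two cycles. -/
theorem sameCycle_mul_swap [DecidableEq X] (f : Perm X) {x y : X} (h : ¬ f.SameCycle x y) :
    (f * swap x y).SameCycle x y ∧ ∀ a, (f * swap x y).SameCycle a (f a) := by
  set g := f * swap x y with hg
  have hgx : g x = f y := by simp [hg]
  have hgy : g y = f x := by simp [hg]
  have hstep : ∀ z, z ≠ x → z ≠ y → g z = f z := by
    intro z h1 h2
    simp [hg, swap_apply_of_ne_of_ne h1 h2]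
  have h1 : ∀ n : ℕ, g.SameCycle (f y) ((f ^ (n + 1)) y) := by
    intro n
    induction n with
    | zero => simp [Perm.SameCycle.refl]
    | succ n ih =>
      rw [pow_succ', Perm.mul_apply]
      by_cases hy : (f ^ (n + 1)) y = y
      · rw [hy]
      · have hx : (f ^ (n + 1)) y ≠ x := by
          rintro rfl
          exact h (Perm.SameCycle.symm ⟨((n + 1 : ℕ) : ℤ), by simp only [zpow_natCast]⟩)
        rw [← hstep _ hx hy]
        exact Perm.sameCycle_apply_right.2 ih
  have hxy : g.SameCycle x y := by
    have h2 := h1 (orderOf f - 1)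
    rw [Nat.sub_add_cancel (orderOf_pos f), pow_orderOf_eq_one, Perm.one_apply, ← hgx] at h2
    exact Perm.sameCycle_apply_left.1 h2
  refine ⟨hxy, fun a => ?_⟩
  by_cases hax : a = x
  · subst hax
    rw [← hgy]
    exact Perm.sameCycle_apply_right.2 hxy
  by_cases hay : a = y
  · subst hay
    rw [← hgx]
    exact Perm.sameCycle_apply_right.2 hxy.symm
  rw [← hstep a hax hay]
  exact Perm.sameCycle_apply_right.2 (Perm.SameCycle.refl _ _)

/-- A planar tree has one face. Here `K` is the set of vertices, `ρ` rotates the half-edges around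
vertices, and `α` exchanges the half-edges of every edge. -/
theorem one_face {K : Type} [Finite K] (ρ : Perm X) (α : Perm X) (κ : X → K)
    (hα : ∀ x, α (α x) = x) (hne : ∀ x, α x ≠ x) (hκ : Function.Surjective κ)
    (hρ : ∀ x, κ (ρ x) = κ x) (hcard : Nat.card X + 2 = 2 * Nat.card K)
    (hconn : ∀ S : Set X, S.Nonempty → (∀ x ∈ S, α x ∈ S) → (∀ x ∈ S, ρ x ∈ S) → ∀ x, x ∈ S)
    (x y : X) : (ρ * α).SameCycle x y := by
  classical
  have := Fintype.ofFinite X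
  have := Fintype.ofFinite K
  let G : X → SimpleGraph K := fun x0 =>
    SimpleGraph.fromRel fun u v => ∃ x, x ≠ x0 ∧ x ≠ α x0 ∧ κ x = u ∧ κ (α x) = v
  have hadj : ∀ x0 x, x ≠ x0 → x ≠ α x0 → (G x0).Reachable (κ x) (κ (α x)) := by
    intro x0 x h1 h2
    by_cases h : κ x = κ (α x)
    · rw [← h]
    · refine SimpleGraph.Adj.reachable ?_
      rw [SimpleGraph.fromRel_adj]
      exact ⟨h, Or.inl ⟨x, h1, h2, rfl, rfl⟩⟩
  -- every edge is a bridge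
  have bridge : ∀ x0, ¬ (G x0).Reachable (κ x0) (κ (α x0)) := by
    intro x0 h0
    have hall : ∀ x, (G x0).Reachable (κ x0) (κ x) := by
      refine hconn {x | (G x0).Reachable (κ x0) (κ x)} ⟨x0, SimpleGraph.Reachable.refl _⟩ ?_ ?_
      · intro x hx
        by_cases h1 : x = x0
        · subst h1; exact h0
        by_cases h2 : x = α x0
        · subst h2
          change (G x0).Reachable (κ x0) (κ (α (α x0)))
          rw [hα]
        · exact SimpleGraph.Reachable.trans hx (hadj x0 x h1 h2)
      · intro x hx
        change (G x0).Reachable (κ x0) (κ (ρ x))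
        rw [hρ]
        exact hx
    have hc : (G x0).Connected := by
      have : Nonempty K := ⟨κ x0⟩
      refine ⟨fun u v => ?_⟩
      obtain ⟨u, rfl⟩ := hκ u
      obtain ⟨v, rfl⟩ := hκ v
      exact (hall u).symm.trans (hall v)
    have h1 := hc.card_vert_le_card_edgeSet_add_one
    let T : Finset X := (Finset.univ.erase x0).erase (α x0)
    have hT : T.card + 2 = Nat.card X := by
      have h2 : α x0 ∈ Finset.univ.erase x0 := by simp [hne]
      have h3 : T.card + 1 = _ := Finset.card_erase_add_one h2
      have h4 := Finset.card_erase_add_one (Finset.mem_univ x0)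
      rw [Nat.card_eq_fintype_card, ← Finset.card_univ]
      omega
    let F : X → Sym2 K := fun x => s(κ x, κ (α x))
    have hE : Nat.card (G x0).edgeSet ≤ (T.image F).card := by
      rw [Nat.card_coe_set_eq, ← Set.ncard_coe_finset]
      refine Set.ncard_le_ncard ?_ (Finset.finite_toSet _)
      intro e
      refine Sym2.ind (fun u v huv => ?_) e
      rw [SimpleGraph.mem_edgeSet, SimpleGraph.fromRel_adj] at huv
      simp only [Finset.coe_image, Set.mem_image, Finset.mem_coe]
      rcases huv.2 with ⟨x, h1, h2, rfl, rfl⟩ | ⟨x, h1, h2, rfl, rfl⟩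
      · exact ⟨x, by simp [T, h1, h2], rfl⟩
      · exact ⟨x, by simp [T, h1, h2], Sym2.eq_swap⟩
    have h2 : 2 * (T.image F).card ≤ T.card := by
      refine Finset.mul_card_image_le_card T 2 ?_
      intro e he
      obtain ⟨x, hx, rfl⟩ := Finset.mem_image.1 he
      have h3 : ({x, α x} : Finset X).card = 2 := Finset.card_pair (hne x).symm
      rw [← h3]
      refine Finset.card_le_card ?_
      simp only [T, Finset.mem_erase, Finset.mem_univ, and_true] at hx
      intro z hz
      rw [Finset.mem_insert, Finset.mem_singleton] at hz
      rcases hz with rfl | rfl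
      · simp [T, hx]
      · simp only [T, F, Finset.mem_filter, Finset.mem_erase, Finset.mem_univ, and_true, hα]
        refine ⟨⟨fun h => hx.2 (α.injective h), fun h => hx.1 ?_⟩, Sym2.eq_swap⟩
        rw [← h, hα]
    omega
  -- adding edges one by one
  let g : Finset X → Perm X := fun T =>
    Function.Involutive.toPerm (fun x => if x ∈ T ∨ α x ∈ T then α x else x) (by
      intro x
      by_cases h : x ∈ T ∨ α x ∈ T
      · simp only [h, if_true, hα, or_comm.1 h]
      · simp only [h, if_false])
  have hg : ∀ T x, g T x = if x ∈ T ∨ α x ∈ T then α x else x := fun _ _ => rfl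
  have key : ∀ T : Finset X, (∀ a, (ρ * g T).SameCycle a (ρ a)) ∧
      ∀ a ∈ T, (ρ * g T).SameCycle a (α a) := by
    intro T
    induction T using Finset.induction_on with
    | empty =>
      have h1 : g ∅ = 1 := by ext x; simp [hg]
      simp only [h1, mul_one, Finset.notMem_empty, false_implies, implies_true, and_true]
      exact fun a => Perm.sameCycle_apply_right.2 (Perm.SameCycle.refl _ _)
    | insert x0 T hx0 ih =>
      by_cases hαx0 : α x0 ∈ T
      · have h1 : g (insert x0 T) = g T := by
          ext z
          rw [hg, hg]
          by_cases h2 : z = x0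
          · subst h2; simp [hαx0]
          by_cases h3 : α z = x0
          · have : α x0 = z := by rw [← h3, hα]
            simp [this ▸ hαx0]
          simp [h2, h3]
        rw [h1]
        refine ⟨ih.1, fun a ha => ?_⟩
        rcases Finset.mem_insert.1 ha with rfl | ha
        · have := ih.2 _ hαx0
          rw [hα] at this
          exact this.symm
        · exact ih.2 a ha
      · have h1 : ρ * g (insert x0 T) = ρ * g T * swap x0 (α x0) := by
          rw [mul_assoc]
          congr 1
          ext z
          rw [Perm.mul_apply]
          by_cases h2 : z = x0
          · subst h2; simp [hg, hα, hx0, hαx0]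
          by_cases h3 : z = α x0
          · subst h3; simp [hg, hα, hx0, hαx0]
          rw [swap_apply_of_ne_of_ne h2 h3, hg, hg]
          have h4 : α z ≠ x0 := fun h => h3 (by rw [← h, hα])
          simp [h2, h4]
        have hreach : ∀ a b, (ρ * g T).SameCycle a b → (G x0).Reachable (κ a) (κ b) := by
          have hs : ∀ a, (G x0).Reachable (κ a) (κ ((ρ * g T) a)) := by
            intro a
            rw [Perm.mul_apply, hρ, hg]
            split_ifs with h2
            · refine hadj x0 a ?_ ?_
              · rintro rfl; exact h2.elim hx0 hαx0
              · rintro rfl; rw [hα] at h2; exact h2.elim hαx0 hx0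
            · exact SimpleGraph.Reachable.refl _
          intro a b hab
          obtain ⟨n, hn, rfl⟩ := hab.exists_pow_eq'
          clear hab hn
          induction n with
          | zero => exact SimpleGraph.Reachable.refl _
          | succ n ihn =>
            rw [pow_succ', Perm.mul_apply]
            exact ihn.trans (hs _)
        obtain ⟨h2, h3⟩ := sameCycle_mul_swap (ρ * g T) fun h => bridge x0 (hreach _ _ h)
        rw [← h1] at h2 h3
        have h4 : ∀ a b, (ρ * g T).SameCycle a b → (ρ * g (insert x0 T)).SameCycle a b := by
          intro a b hab
          obtain ⟨n, hn, rfl⟩ := hab.exists_pow_eq'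
          clear hab hn
          induction n with
          | zero => exact Perm.SameCycle.refl _ _
          | succ n ihn =>
            rw [pow_succ', Perm.mul_apply]
            exact ihn.trans (h3 _)
        refine ⟨fun a => h4 _ _ (ih.1 a), fun a ha => ?_⟩
        rcases Finset.mem_insert.1 ha with rfl | ha
        · exact h2
        · exact h4 _ _ (ih.2 a ha)
  have huniv : g Finset.univ = α := by ext x; simp [hg]
  have hk := key Finset.univ
  rw [huniv] at hk
  exact hconn {y | (ρ * α).SameCycle x y} ⟨x, Perm.SameCycle.refl _ _⟩
    (fun a ha => ha.trans (hk.2 a (Finset.mem_univ a))) (fun a ha => ha.trans (hk.1 a)) y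

end faces

/-- Cyclic orders on the set `{0, ..., n}`, described by the cyclic permutation that sends every
element to the next one. -/
abbrev CycOrder (n : ℕ) : Type := {σ : Equiv.Perm (Fin (n + 1)) // σ.IsCycleOn Set.univ}

namespace CycOrder

section act

variable {I : Type} {c : I → ℕ} {d : ℕ}

/-- For a tree with cyclic orders on the half-edges of every vertex, the walk around the
corresponding planar tree: cross an edge; then stop if a leaf label is reached, otherwise turn to the
next half-edge of the vertex. -/
def nx (p : CycTree c d) (σ : ∀ i, CycOrder (c i)) (x : Port c d) : Port c d ⊕ Fin (d + 1) :=
  match p.inv x with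
  | Sum.inl ⟨i, k⟩ => Sum.inl (Sum.inl ⟨i, (σ i).1 k⟩)
  | Sum.inr k => Sum.inr k

/-- Crossing of edges. -/
def invPerm (p : CycTree c d) : Equiv.Perm (Port c d) := Function.Involutive.toPerm p.inv p.inv_inv

/-- Rotation around vertices. -/
def rot (σ : ∀ i, CycOrder (c i)) : Equiv.Perm (Port c d) :=
  Equiv.sumCongr (Equiv.sigmaCongrRight fun i => (σ i).1) (Equiv.refl _)

variable (p : CycTree c d) (σ : ∀ i, CycOrder (c i))

/-- One step of the walk around a planar tree. -/
def turn : Equiv.Perm (Port c d) := rot σ * invPerm p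

theorem nx_eq (x : Port c d) : Sum.elim id Sum.inr (nx p σ x) = turn p σ x := by
  change _ = rot σ (p.inv x)
  unfold nx
  rcases p.inv x with ⟨i, k⟩ | k <;> rfl

theorem face (x y : Port c d) : (turn p σ).SameCycle x y := by
  have := p.finite
  have := Fintype.ofFinite I
  let κ : Port c d → I ⊕ Fin (d + 1) := Sum.map Sigma.fst id
  refine one_face (rot σ) (invPerm p) κ p.inv_inv p.inv_ne ?_ ?_ ?_ ?_ x y
  · rintro (i | k)
    · exact ⟨Sum.inl ⟨i, 0⟩, rfl⟩
    · exact ⟨Sum.inr k, rfl⟩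
  · rintro (⟨i, k⟩ | k) <;> rfl
  · have := p.euler
    simp only [finsum_eq_sum_of_fintype, Nat.card_eq_fintype_card, Fintype.card_sum,
      Fintype.card_sigma, Fintype.card_fin, Finset.sum_add_distrib, Finset.sum_const,
      Finset.card_univ, smul_eq_mul, mul_one] at this ⊢
    omega
  · intro S hS h1 h2
    refine p.conn S hS h1 fun i k k' hk => ?_
    obtain ⟨n, hn, rfl⟩ := ((σ i).2.2 (Set.mem_univ k) (Set.mem_univ k')).exists_pow_eq'
    clear hn
    induction n with
    | zero => exact hk
    | succ n ih =>
      rw [pow_succ', Equiv.Perm.mul_apply]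
      exact h2 _ ih

theorem exists_out (k : Fin (d + 1)) : ∃ k', Go (nx p σ) (Sum.inr k) (Sum.inr k') := by
  have := p.finite
  refine Go.exists_out Sum.inr ?_ ?_ k
  · simp only [nx_eq]
    exact (turn p σ).injective
  · intro x o
    unfold nx
    rcases p.inv x with ⟨i, k⟩ | k <;> simp

/-- The next leaf of a planar tree. -/
noncomputable def next (k : Fin (d + 1)) : Fin (d + 1) := (exists_out p σ k).choose

theorem next_spec (k : Fin (d + 1)) : Go (nx p σ) (Sum.inr k) (Sum.inr (next p σ k)) :=
  (exists_out p σ k).choose_spec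

theorem next_eq {k k' : Fin (d + 1)} (h : Go (nx p σ) (Sum.inr k) (Sum.inr k')) :
    next p σ k = k' :=
  (next_spec p σ k).unique h

theorem next_trans (k k' : Fin (d + 1)) : ∃ m, (next p σ)^[m + 1] k = k' := by
  have := p.finite
  have key : ∀ n z, (turn p σ ^ n) (turn p σ z) = Sum.inr k' →
      ∃ l, Go (nx p σ) z (Sum.inr l) ∧ ∃ m, (next p σ)^[m] l = k' := by
    intro n
    induction n with
    | zero =>
      intro z hz
      rw [pow_zero, Equiv.Perm.one_apply, ← nx_eq] at hz
      refine ⟨k', Go.of_eq ?_, 0, rfl⟩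
      revert hz
      unfold nx
      rcases p.inv z with ⟨i, k⟩ | k <;> simp
    | succ n ih =>
      intro z hz
      rw [pow_succ, Equiv.Perm.mul_apply] at hz
      cases hn : nx p σ z with
      | inl z' =>
        have h1 : turn p σ z = z' := by rw [← nx_eq, hn]; rfl
        rw [h1] at hz
        obtain ⟨l, h2, h3⟩ := ih z' hz
        exact ⟨l, Go.cons hn h2, h3⟩
      | inr l =>
        have h1 : turn p σ z = Sum.inr l := by rw [← nx_eq, hn]; rfl
        rw [h1] at hz
        obtain ⟨l', h2, m, h3⟩ := ih _ hz
        refine ⟨l, Go.of_eq hn, m + 1, ?_⟩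
        rw [Function.iterate_succ_apply, next_eq p σ h2, h3]
  obtain ⟨n, _, hn⟩ := (face p σ (turn p σ (Sum.inr k)) (Sum.inr k')).exists_pow_eq'
  obtain ⟨l, h2, m, h3⟩ := key n _ hn
  exact ⟨m, by rw [Function.iterate_succ_apply, next_eq p σ h2, h3]⟩

theorem next_bij : Function.Bijective (next p σ) := by
  rw [← Finite.surjective_iff_bijective]
  intro k'
  obtain ⟨m, h⟩ := next_trans p σ k' k'
  rw [Function.iterate_succ_apply'] at h
  exact ⟨_, h⟩

/-- The cyclic order on the leaves of a planar tree. -/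
noncomputable def act : CycOrder d :=
  ⟨Equiv.ofBijective (next p σ) (next_bij p σ),
    ⟨Set.bijOn_univ.2 (Equiv.bijective _), fun k _ k' _ => by
      obtain ⟨m, h⟩ := next_trans p σ k k'
      refine ⟨((m + 1 : ℕ) : ℤ), ?_⟩
      rw [zpow_natCast, Equiv.Perm.coe_pow]
      exact h⟩⟩

theorem act_eq {τ : CycOrder d} (h : ∀ k, Go (nx p σ) (Sum.inr k) (Sum.inr (τ.1 k))) :
    act p σ = τ :=
  Subtype.ext (Equiv.ext fun k => next_eq p σ (h k))

end act

theorem act_one (n : ℕ) (σ : CycOrder n) : act (CycTree.one n) (fun _ => σ) = σ :=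
  act_eq _ _ fun k => Go.cons (x' := Sum.inl ⟨(), σ.1 k⟩) rfl (Go.of_eq rfl)

theorem act_map {I I' : Type} (e : I ≃ I') {c : I' → ℕ} {d : ℕ}
    (p : CycTree (fun i => c (e i)) d) (σ : ∀ i, CycOrder (c i)) :
    act (CycTree.map e (fun _ => rfl) rfl p) σ = act p (fun i => σ (e i)) := by
  let E : Port (fun i => c (e i)) d ≃ Port c d := CycTree.portEquiv e (fun _ => rfl) rfl
  refine act_eq _ _ fun k => ?_
  refine Go.sim (nx := nx p fun i => σ (e i)) (nx' := nx (CycTree.map e _ _ p) σ) E Sum.inr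
    (fun x => Go.of_eq ?_) (next_spec p _ k)
  have h := CycTree.map_inv_apply (c' := c) e (fun _ => rfl) rfl p x
  simp only [nx, E, h]
  rcases p.inv x with ⟨i, k⟩ | k <;> rfl

theorem act_comp {I : Type} {J : I → Type} {c : I → ℕ} {b : ∀ i, J i → ℕ} {d : ℕ}
    (p : CycTree c d) (q : ∀ i, CycTree (b i) (c i)) (σ : ∀ i j, CycOrder (b i j)) :
    act (CycTree.comp p q) (fun x : Σ i, J i => σ x.1 x.2) =
      act p (fun i => act (q i) (σ i)) := by
  let N : CycTree.CPort c b d → CycTree.CPort c b d ⊕ Fin (d + 1) := fun x =>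
    match CycTree.edge p q x with
    | Sum.inl ⟨i, Sum.inl ⟨j, k⟩⟩ => Sum.inl (Sum.inl ⟨i, Sum.inl ⟨j, (σ i j).1 k⟩⟩)
    | Sum.inl ⟨i, Sum.inr k⟩ => Sum.inl (Sum.inr (Sum.inl ⟨i, k⟩))
    | Sum.inr (Sum.inl ⟨i, k⟩) => Sum.inl (Sum.inl ⟨i, Sum.inr k⟩)
    | Sum.inr (Sum.inr k) => Sum.inr k
  -- the left hand side
  have hl : ∀ k, Go N (Sum.inr (Sum.inr k))
      (Sum.inr ((act (CycTree.comp p q) (fun x : Σ i, J i => σ x.1 x.2)).1 k)) := by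
    let ψ : Port (fun x : Σ i, J i => b x.1 x.2) d → CycTree.CPort c b d ⊕ Fin (d + 1) :=
      Sum.elim (fun x => Sum.inl (Sum.inl ⟨x.1.1, Sum.inl ⟨x.1.2, (σ x.1.1 x.1.2).1 x.2⟩⟩)) Sum.inr
    have h1 : ∀ o, Go N (CycTree.outer o) (ψ ((CycTree.comp p q).inv o)) := by
      intro o
      refine Go.sim id ψ (fun x => Go.of_eq ?_) (CycTree.compInv_spec p q o)
      simp only [N, CycTree.nx, id]
      rcases CycTree.edge p q x with ⟨i, ⟨j, l⟩ | l⟩ | ⟨i, l⟩ | l <;> rfl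
    intro k
    refine Go.sim (nx' := N) CycTree.outer Sum.inr ?_
      (next_spec (CycTree.comp p q) (fun x : Σ i, J i => σ x.1 x.2) k)
    intro x
    have h3 := h1 x
    unfold nx
    revert h3
    rcases (CycTree.comp p q).inv x with ⟨⟨i, j⟩, l⟩ | l <;> exact id
  -- the right hand side
  have hr : ∀ k, Go N (Sum.inr (Sum.inr k))
      (Sum.inr ((act p (fun i => act (q i) (σ i))).1 k)) := by
    have h1 : ∀ i k, Go N (Sum.inl ⟨i, Sum.inr k⟩)
        (Sum.inl (Sum.inr (Sum.inl ⟨i, (act (q i) (σ i)).1 k⟩))) := by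
      intro i k
      let φ : Port (b i) (c i) → CycTree.CPort c b d := fun x => Sum.inl ⟨i, x⟩
      let ψ : Fin (c i + 1) → CycTree.CPort c b d ⊕ Fin (d + 1) :=
        fun k => Sum.inl (Sum.inr (Sum.inl ⟨i, k⟩))
      refine Go.sim (nx := nx (q i) (σ i)) φ ψ (fun x => Go.of_eq ?_) (next_spec (q i) (σ i) k)
      simp only [N, CycTree.edge, nx, φ]
      rcases (q i).inv x with ⟨j, l⟩ | l <;> rfl
    intro k
    refine Go.sim (nx' := N) Sum.inr Sum.inr ?_ (next_spec p (fun i => act (q i) (σ i)) k)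
    intro x
    unfold nx
    cases hx : p.inv x with
    | inl y =>
      refine Go.cons (x' := Sum.inl ⟨y.1, Sum.inr y.2⟩) ?_ (h1 y.1 y.2)
      simp only [N, CycTree.edge, hx]
    | inr k =>
      refine Go.of_eq ?_
      simp only [N, CycTree.edge, hx]
      rfl
  exact act_eq _ _ fun k => (hl k).unique (hr k) ▸ next_spec _ _ k

end CycOrder

/-- The cyclic operad of associative monoids, as an algebra over `cOp`: its operations of arity `n`
are the cyclic orders on the input and output labels `0, ..., n`. A tree, whose vertices are marked
by cyclic orders, is evaluated to the cyclic order on the leaves of the corresponding planar tree. -/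
noncomputable def uAsC : cOp.Algebra where
  carrier n := CycOrder n
  act p σ := CycOrder.act p σ
  act_one := CycOrder.act_one
  act_map := CycOrder.act_map
  act_comp := CycOrder.act_comp

/-! ### Connes' cyclic category -/

/-- The objects `[0], [1], [2], ...` of the cyclic category. -/
structure ConnesCyclic where
  n : ℕ

namespace ConnesCyclic

/-- Nondecreasing maps `f : ℤ → ℤ` such that `f(i + m + 1) = f(i) + n + 1`. -/
@[ext] structure Lift (m n : ℕ) where
  toFun : ℤ → ℤ
  mono : Monotone toFun
  shift : ∀ i, toFun (i + (m + 1)) = toFun i + (n + 1)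

namespace Lift

variable {l m n r : ℕ}

/-- Two maps are equivalent, if they differ by a multiple of `n + 1`. -/
instance setoid (m n : ℕ) : Setoid (Lift m n) where
  r f g := ∃ k : ℤ, ∀ i, g.toFun i = f.toFun i + k * (n + 1)
  iseqv :=
    { refl := fun f => ⟨0, fun i => by ring⟩
      symm := by
        rintro f g ⟨k, h⟩
        exact ⟨-k, fun i => by rw [h]; ring⟩
      trans := by
        rintro f g h ⟨k, hk⟩ ⟨k', hk'⟩
        exact ⟨k + k', fun i => by rw [hk', hk]; ring⟩ }

/-- The identity map. -/
def id (n : ℕ) : Lift n n where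
  toFun i := i
  mono _ _ h := h
  shift _ := rfl

/-- Composition of maps. -/
def comp (f : Lift l m) (g : Lift m n) : Lift l n where
  toFun i := g.toFun (f.toFun i)
  mono := g.mono.comp f.mono
  shift i := by rw [f.shift, g.shift]

theorem shift_mul (f : Lift m n) (i k : ℤ) :
    f.toFun (i + k * (m + 1)) = f.toFun i + k * (n + 1) := by
  induction k using Int.induction_on with
  | zero => simp
  | succ k ih =>
    rw [show i + ((k : ℤ) + 1) * (m + 1) = i + k * (m + 1) + (m + 1) by ring, f.shift, ih]
    ring
  | pred k ih =>
    have h := f.shift (i + (-(k : ℤ) - 1) * (m + 1))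
    rw [show i + (-(k : ℤ) - 1) * (m + 1) + (m + 1) = i + -k * (m + 1) by ring, ih] at h
    linarith

theorem comp_equiv {f f' : Lift l m} {g g' : Lift m n} (hf : f ≈ f') (hg : g ≈ g') :
    comp f g ≈ comp f' g' := by
  obtain ⟨k, hk⟩ := hf
  obtain ⟨k', hk'⟩ := hg
  refine ⟨k + k', fun i => ?_⟩
  change g'.toFun (f'.toFun i) = g.toFun (f.toFun i) + _
  rw [hk', hk, shift_mul]
  ring

end Lift

/-- Connes' cyclic category: morphisms from `[m]` to `[n]` are nondecreasing maps `f : ℤ → ℤ` such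
that `f(i + m + 1) = f(i) + n + 1`, where maps that differ by a multiple of `n + 1` are identified. -/
instance : CategoryTheory.Category.{0} ConnesCyclic where
  Hom a b := Quotient (Lift.setoid a.n b.n)
  id a := Quotient.mk _ (Lift.id a.n)
  comp f g := Quotient.map₂ Lift.comp (fun _ _ hf _ _ hg => Lift.comp_equiv hf hg) f g
  id_comp f := Quotient.inductionOn f fun _ => rfl
  comp_id f := Quotient.inductionOn f fun _ => rfl
  assoc f g h := Quotient.inductionOn₃ f g h fun _ _ _ => rfl

end ConnesCyclic

end OperadTw

namespace OperadTw

open ConnesCyclic Operad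

/-! An expression with one variable over `uAsC` is a planar tree with a distinguished vertex whose
cyclic order is left open. Removing this vertex leaves one branch at each of its half-edges `0, ...,
m`. The other vertices carry cyclic orders, so the absorption relation contracts every branch to a
single vertex, whose half-edges are the edge towards the distinguished vertex and the leaves of the
branch; the tree becomes a star. A class of expressions is therefore a distribution of the leaves
into `m + 1` pieces, possibly empty, with a linear order on each piece. Equivalently, it is a
permutation `θ` of the half-edges of the distinguished vertex (the markers) and the leaves, such
that every cycle contains exactly one marker. For an arbitrary representative `θ` is obtained by
walking around the tree (`theta`).

If the distinguished vertex receives the cyclic order `σ`, the value of the tree is the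
concatenation of the pieces in the order of `σ`. If this value is `τ`, the pieces are consecutive
intervals of `τ`. Winding `ℤ` around `σ` and `τ`, let `f i` be the position where the `i`-th piece
starts. Then `f` is nondecreasing, `f (i + m + 1) = f i + n + 1`, and `f` is determined up to a
multiple of `n + 1`. Conversely, every such `f` cuts `τ` into pieces. Hence the morphisms from `σ`
to `τ` are the morphisms from `[m]` to `[n]` in the cyclic category. Substitution of expressions
glues two rotations along the half-edges of the middle vertex, and this merges pieces exactly as
composition of lifts does.

The relation between `θ` and `f` is `Shuffle.Rep`. It determines each of the two by the other
(`Rep.ext`, `Rep.equiv`), every lift arises (`exists_marked`), and so does every rotation with the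
correct value (`Marked.exists_rep`). Compatibility with composition is `theta_plug` together with
`Rep.glue`. The reduction to stars is `mk_eq_star`; it makes `theta` injective on classes, and
`exists_star` realizes all admissible rotations. Essential surjectivity only needs a cyclic order on
every `{0, ..., n}`. -/

theorem Go.tail {X O : Type} {nx : X → X ⊕ O} {x x' : X} {o : O} (h : nx x = Sum.inl x')
    (hx : Go nx x (Sum.inr o)) : Go nx x' (Sum.inr o) := by
  generalize ht : (Sum.inr o : X ⊕ O) = t at hx ⊢
  cases hx with
  | single => rw [h] at ht; cases ht
  | cons h1 h2 => rw [h] at h1; cases h1; exact h2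

/-! ### Winding the integers around a cyclic order -/

namespace CycOrder

variable {n : ℕ} (σ : CycOrder n)

/-- The winding of the integers around a cyclic order. -/
def wind (i : ℤ) : Fin (n + 1) := (σ.1 ^ i) 0

theorem wind_succ (i : ℤ) : σ.wind (i + 1) = σ.1 (σ.wind i) := by
  simp only [wind, add_comm i 1, zpow_add, zpow_one, Equiv.Perm.mul_apply]

theorem wind_surjective : Function.Surjective σ.wind := fun k =>
  σ.2.2 (Set.mem_univ 0) (Set.mem_univ k)

/-- A permutation that is one cycle on `n + 1` elements has powers that agree at a point exactly
when the exponents agree modulo `n + 1`. -/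
theorem wind_eq_iff {i j : ℤ} : σ.wind i = σ.wind j ↔ ∃ k : ℤ, j = i + k * (n + 1) := by
  have h : σ.1.IsCycleOn ((Finset.univ : Finset (Fin (n + 1))) : Set (Fin (n + 1))) := by
    rw [Finset.coe_univ]; exact σ.2
  rw [wind, wind, h.zpow_apply_eq_zpow_apply (Finset.mem_univ 0), Int.modEq_iff_dvd,
    Finset.card_univ, Fintype.card_fin]
  constructor
  · rintro ⟨k, hk⟩
    exact ⟨k, by push_cast at hk; linarith⟩
  · rintro ⟨k, hk⟩
    exact ⟨k, by push_cast; linarith⟩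

theorem wind_add_mul (i k : ℤ) : σ.wind (i + k * (n + 1)) = σ.wind i :=
  (σ.wind_eq_iff.2 ⟨k, rfl⟩).symm

/-- One full turn visits every element once. This turns the increments of a lift over one period
into a sum over all markers. -/
theorem sum_wind (h : Fin (n + 1) → ℤ) :
    ∑ i ∈ Finset.range (n + 1), h (σ.wind i) = ∑ k, h k := by
  rw [Finset.sum_range fun i => h (σ.wind i)]
  refine Function.Bijective.sum_comp (e := fun i : Fin (n + 1) => σ.wind (i : ℕ)) ?_ h
  rw [← Finite.injective_iff_bijective]
  intro i j hij
  obtain ⟨k, hk⟩ := σ.wind_eq_iff.1 hij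
  ext
  have hi := i.2
  have hj := j.2
  have h1 : k < 1 := by
    by_contra hc
    have : (1 : ℤ) * (n + 1) ≤ k * (n + 1) := mul_le_mul_of_nonneg_right (by omega) (by omega)
    omega
  have h2 : -1 < k := by
    by_contra hc
    have : k * (n + 1 : ℤ) ≤ -1 * (n + 1) := mul_le_mul_of_nonneg_right (by omega) (by omega)
    omega
  obtain rfl : k = 0 := by omega
  simpa using hk.symm

end CycOrder

/-! ### The pieces of a lift cover the integers -/

namespace ConnesCyclic.Lift

variable {m n : ℕ} (f : Lift m n)

/-- The intervals `[f i, f (i + 1))` partition `ℤ`, since `f` is nondecreasing and unbounded in both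
directions. As some intervals may be empty, `i` is taken to be the greatest index with `f i ≤ j`. -/
theorem exists_le_lt (j : ℤ) : ∃ i, f.toFun i ≤ j ∧ j < f.toFun (i + 1) := by
  have h := f.shift_mul 0
  simp only [zero_add] at h
  have hn : (1 : ℤ) ≤ n + 1 := by omega
  obtain ⟨i, h1, h2⟩ := Int.exists_greatest_of_bdd (P := fun i => f.toFun i ≤ j) (by
      -- Every turn raises `f` by `n + 1 ≥ 1`, so `|j - f 0| + 1` turns from `0` carry `f` beyond
      -- `j`.
      refine ⟨(|j - f.toFun 0| + 1) * (m + 1), fun i hi => ?_⟩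
      by_contra hc
      have h1 := f.mono (le_of_not_ge hc)
      rw [h] at h1
      nlinarith [le_abs_self (j - f.toFun 0), abs_nonneg (j - f.toFun 0)]) (by
      refine ⟨-|j - f.toFun 0| * (m + 1), ?_⟩
      rw [h]
      nlinarith [neg_abs_le (j - f.toFun 0), abs_nonneg (j - f.toFun 0)])
  refine ⟨i, h1, ?_⟩
  by_contra hc
  have := h2 (i + 1) (le_of_not_gt hc)
  omega

end ConnesCyclic.Lift

/-! ### Circular shuffles -/

namespace Shuffle

variable {l m n : ℕ}

/-- A morphism from `[m]` to `[n]` of the cyclic category cuts the cyclic order on `0, ..., n`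
into `m + 1` pieces. In the `i`-th piece, preceded by a marker for `i`, the position `j` is followed
by the next position, or by the marker if `j` is the last one. -/
def step (σ : CycOrder m) (τ : CycOrder n) (f : Lift m n) (i j : ℤ) :
    Fin (m + 1) ⊕ Fin (n + 1) :=
  if j < f.toFun (i + 1) then Sum.inr (τ.wind j) else Sum.inl (σ.wind i)

/-- The map `θ` rotates every piece of the lift `f`, together with its marker. -/
structure Rep (σ : CycOrder m) (τ : CycOrder n)
    (θ : Fin (m + 1) ⊕ Fin (n + 1) → Fin (m + 1) ⊕ Fin (n + 1)) (f : Lift m n) : Prop where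
  marker : ∀ i, θ (Sum.inl (σ.wind i)) = step σ τ f i (f.toFun i)
  piece : ∀ i j, f.toFun i ≤ j → j < f.toFun (i + 1) →
    θ (Sum.inr (τ.wind j)) = step σ τ f i (j + 1)

variable {σ : CycOrder m} {τ : CycOrder n} {f f' : Lift m n}
  {θ θ' : Fin (m + 1) ⊕ Fin (n + 1) → Fin (m + 1) ⊕ Fin (n + 1)}

theorem step_of_lt {i j : ℤ} (h : j < f.toFun (i + 1)) :
    step σ τ f i j = Sum.inr (τ.wind j) := if_pos h

theorem step_of_le {i j : ℤ} (h : f.toFun (i + 1) ≤ j) :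
    step σ τ f i j = Sum.inl (σ.wind i) := if_neg (not_lt.2 h)

/-- Shifting both arguments by full turns changes nothing, so `step` can be read off from any choice
of integers over a marker or a position. -/
theorem step_shift (i j k : ℤ) :
    step σ τ f (i + k * (m + 1)) (j + k * (n + 1)) = step σ τ f i j := by
  unfold step
  rw [show i + k * (m + 1 : ℤ) + 1 = (i + 1) + k * (m + 1) by ring, f.shift_mul,
    τ.wind_add_mul, σ.wind_add_mul]
  simp only [add_lt_add_iff_right]

theorem step_equiv {k : ℤ} (h : ∀ i, f'.toFun i = f.toFun i + k * (n + 1)) (i j : ℤ) :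
    step σ τ f' i (j + k * (n + 1)) = step σ τ f i j := by
  unfold step
  rw [h, τ.wind_add_mul]
  simp only [add_lt_add_iff_right]

theorem Rep.congr (H : Rep σ τ θ f) (h : f ≈ f') : Rep σ τ θ f' := by
  obtain ⟨k, hk⟩ := h
  constructor
  · intro i
    rw [hk, step_equiv hk]
    exact H.marker i
  · intro i j h1 h2
    rw [hk] at h1 h2
    obtain ⟨j, rfl⟩ : ∃ j', j = j' + k * (n + 1) := ⟨j - k * (n + 1), by ring⟩
    rw [τ.wind_add_mul, add_right_comm, step_equiv hk]
    exact H.piece i j (by linarith) (by linarith)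

theorem Rep.ext (H : Rep σ τ θ f) (H' : Rep σ τ θ' f) : θ = θ' := by
  funext o
  rcases o with k | k
  · obtain ⟨i, rfl⟩ := σ.wind_surjective k
    rw [H.marker, H'.marker]
  · obtain ⟨j, rfl⟩ := τ.wind_surjective k
    obtain ⟨i, h1, h2⟩ := f.exists_le_lt j
    rw [H.piece i j h1 h2, H'.piece i j h1 h2]

/-- The bound includes the case `f i + s = f (i + 1)`, in which the iterate has come back to the
marker. So the cycle of the `i`-th marker has `f (i + 1) - f i + 1` elements. -/
theorem Rep.iterate (H : Rep σ τ θ f) (i : ℤ) (s : ℕ) (hs : f.toFun i + s ≤ f.toFun (i + 1)) :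
    θ^[s + 1] (Sum.inl (σ.wind i)) = step σ τ f i (f.toFun i + s) := by
  induction s with
  | zero => simpa using H.marker i
  | succ s ih =>
    push_cast at hs
    rw [Function.iterate_succ_apply', ih (by omega), step, if_pos (by omega),
      H.piece i _ (by omega) (by omega)]
    push_cast
    rw [add_assoc]

/-- If the piece of `f'` were longer, the same iterate of `θ` would be the marker according to `f`
and a position according to `f'`. -/
theorem Rep.length_le (H : Rep σ τ θ f) (H' : Rep σ τ θ f') (i : ℤ) :
    f'.toFun (i + 1) - f'.toFun i ≤ f.toFun (i + 1) - f.toFun i := by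
  by_contra hc
  have h0 := f.mono (show i ≤ i + 1 by omega)
  obtain ⟨s, hs⟩ := Int.eq_ofNat_of_zero_le (sub_nonneg.2 h0)
  have h1 := H.iterate i s (by omega)
  have h2 := H'.iterate i s (by omega)
  rw [h1, step, step, if_neg (by omega), if_pos (by omega)] at h2
  cases h2

/-- The lengths of the pieces are read off from `θ`, so `f' - f` is constant. The first position of
a nonempty piece is also read off from `θ`, which makes the constant a multiple of `n + 1`. -/
theorem Rep.equiv (H : Rep σ τ θ f) (H' : Rep σ τ θ f') : f ≈ f' := by
  have h : ∀ i, f'.toFun i = f.toFun i + (f'.toFun 0 - f.toFun 0) := by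
    have h1 : ∀ i, f'.toFun (i + 1) - f'.toFun i = f.toFun (i + 1) - f.toFun i := fun i =>
      le_antisymm (H.length_le H' i) (H'.length_le H i)
    intro i
    induction i using Int.induction_on with
    | zero => ring
    | succ i ih => linarith [h1 i]
    | pred i ih =>
      have := h1 (-i - 1)
      rw [sub_add_cancel] at this
      linarith
  -- There are `n + 1 ≥ 1` positions, so some piece is nonempty; the one containing the position `0`
  -- is used.
  obtain ⟨i, h1, h2⟩ := f.exists_le_lt 0
  have h3 : f.toFun i < f.toFun (i + 1) := by omega
  have h4 := H.marker i
  rw [H'.marker, step, step, if_pos h3, if_pos (by rw [h, h (i + 1)]; omega)] at h4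
  obtain ⟨k, hk⟩ := τ.wind_eq_iff.1 (Sum.inr.inj h4).symm
  refine ⟨k, fun z => ?_⟩
  rw [h z]
  have := h i
  omega

theorem Rep.id (σ : CycOrder n) : Rep σ σ Sum.swap (Lift.id n) := by
  constructor
  · intro i
    simp [step, Lift.id]
  · intro i j h1 h2
    obtain rfl : j = i := by simp only [Lift.id] at h1 h2; omega
    simp [step, Lift.id]

/-! Gluing of rotations along the common part. -/

/-- The walk that follows two rotations on overlapping sets and crosses over from one to the other in
the common part. -/
def glueNx {A B C : Type} (θ : A ⊕ B → A ⊕ B) (θ' : B ⊕ C → B ⊕ C) :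
    (A ⊕ B) ⊕ (B ⊕ C) → ((A ⊕ B) ⊕ (B ⊕ C)) ⊕ (A ⊕ C)
  | Sum.inl y => match θ y with
    | Sum.inl a => Sum.inr (Sum.inl a)
    | Sum.inr b => Sum.inl (Sum.inr (Sum.inl b))
  | Sum.inr z => match θ' z with
    | Sum.inl b => Sum.inl (Sum.inl (Sum.inr b))
    | Sum.inr c => Sum.inr (Sum.inr c)

/-- The inclusion of the elements outside of the common part. -/
def glueIn {A B C : Type} : A ⊕ C → (A ⊕ B) ⊕ (B ⊕ C) := Sum.map Sum.inl Sum.inr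

/-- The map `Θ` is obtained by gluing of `θ` and `θ'` along the common part. -/
def Glue {A B C : Type} (θ : A ⊕ B → A ⊕ B) (θ' : B ⊕ C → B ⊕ C) (Θ : A ⊕ C → A ⊕ C) : Prop :=
  ∀ o, Go (glueNx θ θ') (glueIn o) (Sum.inr (Θ o))

theorem Glue.unique {A B C : Type} {θ : A ⊕ B → A ⊕ B} {θ' : B ⊕ C → B ⊕ C}
    {Θ Θ' : A ⊕ C → A ⊕ C} (h : Glue θ θ' Θ) (h' : Glue θ θ' Θ') : Θ = Θ' :=
  funext fun o => (h o).unique (h' o)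

/-- `Sum.swap` is the rotation of the identity expression: every piece consists of one position,
which bears the name of its marker. Gluing it on merely renames. -/
theorem glue_swap {A C : Type} (θ : A ⊕ C → A ⊕ C) : Glue Sum.swap θ θ := by
  have h : ∀ o, Go (glueNx Sum.swap θ) (Sum.inr o) (Sum.inr (θ o)) := by
    intro o
    cases ho : θ o with
    | inl a =>
      refine Go.cons (x' := Sum.inl (Sum.inr a)) ?_ (Go.of_eq rfl)
      simp only [glueNx, ho]
    | inr c =>
      refine Go.of_eq ?_
      simp only [glueNx, ho]
  rintro (a | c)
  · exact Go.cons (x' := Sum.inr (Sum.inl a)) rfl (h _)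
  · exact h _

/-- The `i`-th piece of the composite is the union of the pieces `[f j, f (j + 1))` for `g i ≤ j < g
(i + 1)`. The glued walk runs through them in order, and it skips an empty piece by passing from its
marker back to the first rotation and on to the next position there. -/
theorem Rep.glue {ρ : CycOrder l} {g : Lift l m}
    {η : Fin (l + 1) ⊕ Fin (m + 1) → Fin (l + 1) ⊕ Fin (m + 1)}
    {Θ : Fin (l + 1) ⊕ Fin (n + 1) → Fin (l + 1) ⊕ Fin (n + 1)}
    (H : Rep ρ σ η g) (H' : Rep σ τ θ f) (h : Glue η θ Θ) : Rep ρ τ Θ (g.comp f) := by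
  have hc : ∀ i, (g.comp f).toFun i = f.toFun (g.toFun i) := fun _ => rfl
  -- The induction is on the number `s` of positions of the first rotation that follow `j` in the
  -- piece `i`. An empty piece `j` costs one detour through the first rotation and leads to `j + 1`,
  -- with `f (j + 1) = f j`.
  have key : ∀ i, ∀ s : ℕ, ∀ j, j + s + 1 = g.toFun (i + 1) → g.toFun i ≤ j →
      Go (glueNx η θ) (Sum.inr (Sum.inl (σ.wind j)))
        (Sum.inr (step ρ τ (g.comp f) i (f.toFun j))) := by
    intro i s
    induction s with
    | zero =>
      intro j hj hi
      have hj' : g.toFun (i + 1) = j + 1 := by simpa using hj.symm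
      by_cases hf : f.toFun j < f.toFun (j + 1)
      · refine Go.of_eq ?_
        rw [step_of_lt (by rwa [hc, hj'])]
        simp only [glueNx, H'.marker, step_of_lt hf]
      · rw [not_lt] at hf
        rw [step_of_le (by rwa [hc, hj'])]
        refine Go.cons (x' := Sum.inl (Sum.inr (σ.wind j))) ?_ (Go.of_eq ?_)
        · simp only [glueNx, H'.marker, step_of_le hf]
        · simp only [glueNx, H.piece i j hi (by omega), step_of_le hj'.le]
    | succ s ih =>
      intro j hj hi
      push_cast at hj
      by_cases hf : f.toFun j < f.toFun (j + 1)
      · refine Go.of_eq ?_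
        rw [step_of_lt (by rw [hc]; exact hf.trans_le (f.mono (by omega)))]
        simp only [glueNx, H'.marker, step_of_lt hf]
      · have hf' : f.toFun j = f.toFun (j + 1) :=
          le_antisymm (f.mono (by omega)) (not_lt.1 hf)
        refine Go.cons (x' := Sum.inl (Sum.inr (σ.wind j))) ?_
          (Go.cons (x' := Sum.inr (Sum.inl (σ.wind (j + 1)))) ?_ ?_)
        · simp only [glueNx, H'.marker, step_of_le hf'.ge]
        · simp only [glueNx, H.piece i j hi (by omega), step_of_lt (show j + 1 < g.toFun (i + 1) by omega)]
        · rw [hf']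
          exact ih (j + 1) (by omega) (by omega)
  have key' : ∀ i j, g.toFun i ≤ j → j < g.toFun (i + 1) →
      Go (glueNx η θ) (Sum.inr (Sum.inl (σ.wind j)))
        (Sum.inr (step ρ τ (g.comp f) i (f.toFun j))) := by
    intro i j h1 h2
    exact key i (g.toFun (i + 1) - j - 1).toNat j (by omega) h1
  constructor
  · intro i
    refine (h _).unique ?_
    by_cases hg : g.toFun i < g.toFun (i + 1)
    · refine Go.cons (x' := Sum.inr (Sum.inl (σ.wind (g.toFun i)))) ?_ (key' i _ le_rfl hg)
      simp only [glueIn, Sum.map_inl, glueNx, H.marker, step_of_lt hg]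
    · refine Go.of_eq ?_
      rw [step_of_le (f := g.comp f) (by rw [hc, hc]; exact f.mono (not_lt.1 hg))]
      simp only [glueIn, Sum.map_inl, glueNx, H.marker, step_of_le (not_lt.1 hg)]
  · intro i j h1 h2
    refine (h _).unique ?_
    rw [hc] at h1 h2
    -- `z` is the piece of `f` that contains `j`; monotonicity of `f` places `z` in the `i`-th piece
    -- of `g`.
    obtain ⟨z, h3, h4⟩ := f.exists_le_lt j
    have h5 : g.toFun i ≤ z := by
      by_contra hc
      have := f.mono (show z + 1 ≤ g.toFun i by omega)
      omega
    have h6 : z < g.toFun (i + 1) := by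
      by_contra hc
      have := f.mono (not_lt.1 hc)
      omega
    by_cases hj : j + 1 < f.toFun (z + 1)
    · refine Go.of_eq ?_
      rw [step_of_lt (by rw [hc]; exact hj.trans_le (f.mono (by omega)))]
      simp only [glueIn, Sum.map_inr, glueNx, H'.piece z j h3 h4, step_of_lt hj]
    · have hj' : j + 1 = f.toFun (z + 1) := by omega
      refine Go.cons (x' := Sum.inl (Sum.inr (σ.wind z))) ?_ ?_
      · simp only [glueIn, Sum.map_inr, glueNx, H'.piece z j h3 h4, step_of_le hj'.ge]
      by_cases hz : z + 1 < g.toFun (i + 1)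
      · refine Go.cons (x' := Sum.inr (Sum.inl (σ.wind (z + 1)))) ?_ ?_
        · simp only [glueNx, H.piece i z h5 h6, step_of_lt hz]
        · rw [hj']
          exact key' i (z + 1) (by omega) hz
      · have hz' : z + 1 = g.toFun (i + 1) := by omega
        refine Go.of_eq ?_
        rw [step_of_le (by rw [hc, ← hz', hj'])]
        simp only [glueNx, H.piece i z h5 h6, step_of_le hz'.ge]

/-! ### Recovering the target cyclic order from a rotation -/

/-- The walk along a rotation `θ`, where markers are permuted by `σ`, until an unmarked position is
reached. -/
def ret {A B : Type} (σ : A → A) (θ : A ⊕ B → A ⊕ B) (x : A ⊕ B) : (A ⊕ B) ⊕ B :=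
  match θ x with
  | Sum.inl k => Sum.inl (Sum.inl (σ k))
  | Sum.inr k => Sum.inr k

/-- All pieces from `i` up to the one containing the position `f i` are empty, so the walk passes
from marker to marker until it meets this position. -/
theorem Rep.ret_marker (H : Rep σ τ θ f) (i : ℤ) :
    Go (ret σ.1 θ) (Sum.inl (σ.wind i)) (Sum.inr (τ.wind (f.toFun i))) := by
  obtain ⟨z, h1, h2⟩ := f.exists_le_lt (f.toFun i)
  have hz : i ≤ z := by
    by_contra hc
    have := f.mono (show z + 1 ≤ i by omega)
    omega
  have h3 := f.mono hz
  obtain ⟨s, hs⟩ := Int.eq_ofNat_of_zero_le (sub_nonneg.2 hz)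
  clear hz
  induction s generalizing i with
  | zero =>
    obtain rfl : i = z := by omega
    refine Go.of_eq ?_
    simp only [ret, H.marker, step, h2, if_true]
  | succ s ih =>
    have h4 := f.mono (show i ≤ i + 1 by omega)
    have h5 := f.mono (show i + 1 ≤ z by omega)
    have h6 : f.toFun (i + 1) = f.toFun i := by omega
    refine Go.cons (x' := Sum.inl (σ.wind (i + 1))) ?_ ?_
    · simp only [ret, H.marker, step, h6, lt_irrefl, if_false, σ.wind_succ]
    · rw [← h6] at h1 h2 ⊢
      exact ih (i + 1) (by omega) h2 h5 (by push_cast at hs; omega)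

/-- At the end of a piece the walk turns to the next marker by `σ`, and the next piece starts where
the previous one stopped. So the pieces concatenate to `τ`; this computes the value of an expression
whose rotation is represented by a lift. -/
theorem Rep.ret_piece (H : Rep σ τ θ f) (k : Fin (n + 1)) :
    Go (ret σ.1 θ) (Sum.inr k) (Sum.inr (τ.1 k)) := by
  obtain ⟨j, rfl⟩ := τ.wind_surjective k
  obtain ⟨i, h1, h2⟩ := f.exists_le_lt j
  rw [← τ.wind_succ]
  by_cases hj : j + 1 < f.toFun (i + 1)
  · refine Go.of_eq ?_
    simp only [ret, H.piece i j h1 h2, step, hj, if_true]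
  · refine Go.cons (x' := Sum.inl (σ.wind (i + 1))) ?_ ?_
    · simp only [ret, H.piece i j h1 h2, step, hj, if_false, σ.wind_succ]
    · rw [show j + 1 = f.toFun (i + 1) by omega]
      exact H.ret_marker _

/-! ### Rotations with one marker in every cycle, and their lifts -/

/-- Every cycle of `θ` contains exactly one marker; the marker in the cycle of `o` is `g o`. -/
structure Marked {A B : Type} (θ : A ⊕ B → A ⊕ B) (g : A ⊕ B → A) : Prop where
  inj : Function.Injective θ
  marker : ∀ k, g (Sum.inl k) = k
  map : ∀ o, g (θ o) = g o
  iterate : ∀ o, ∃ s, θ^[s] (Sum.inl (g o)) = o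

theorem Marked.map_iterate {A B : Type} {θ : A ⊕ B → A ⊕ B} {g : A ⊕ B → A} (M : Marked θ g)
    (s : ℕ) (o : A ⊕ B) : g (θ^[s] o) = g o := by
  induction s with
  | zero => rfl
  | succ s ih => rw [Function.iterate_succ_apply', M.map, ih]

theorem Marked.unique {A B : Type} {θ : A ⊕ B → A ⊕ B} {g g' : A ⊕ B → A} (M : Marked θ g)
    (M' : Marked θ g') : g = g' := by
  funext o
  obtain ⟨s, hs⟩ := M.iterate o
  rw [← hs, M.map_iterate, M.marker, M'.map_iterate, M'.marker]

-- The cycles through the markers are disjoint and cover everything, so their lengths add up to the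
-- number of all markers and positions.
open Function in
theorem Marked.sum_minimalPeriod
    {g : Fin (m + 1) ⊕ Fin (n + 1) → Fin (m + 1)} (M : Marked θ g) :
    ∑ k, minimalPeriod θ (Sum.inl k) = (m + 1) + (n + 1) := by
  have hp : ∀ x, 0 < minimalPeriod θ x := fun x =>
    minimalPeriod_pos_of_mem_periodicPts (M.inj.mem_periodicPts x)
  let e : (Σ k : Fin (m + 1), Fin (minimalPeriod θ (Sum.inl k : Fin (m + 1) ⊕ Fin (n + 1)))) →
      Fin (m + 1) ⊕ Fin (n + 1) := fun x => θ^[x.2] (Sum.inl x.1)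
  have he : Bijective e := by
    constructor
    · rintro ⟨k, s⟩ ⟨k', s'⟩ h
      have h1 := congrArg g h
      simp only [e, M.map_iterate, M.marker] at h1
      subst h1
      have h2 := iterate_injOn_Iio_minimalPeriod s.2 s'.2 h
      rw [Fin.ext h2]
    · intro o
      obtain ⟨s, hs⟩ := M.iterate o
      refine ⟨⟨g o, s % _, Nat.mod_lt _ (hp _)⟩, ?_⟩
      simp only [e]
      rw [iterate_mod_minimalPeriod_eq, hs]
  have := Fintype.card_of_bijective he
  simpa using this

-- If `τ.wind j` is the first position met from the marker `k`, the rest of the cycle must list the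
-- successive positions, because the walk realizes `τ`. After the last of them the walk turns to the
-- marker `σ k`, which hence meets the position right after this piece first, also when the piece is
-- empty.
open Function in
theorem Marked.ret_next {g : Fin (m + 1) ⊕ Fin (n + 1) → Fin (m + 1)} (M : Marked θ g)
    (H : ∀ k, Go (ret σ.1 θ) (Sum.inr k) (Sum.inr (τ.1 k))) (k : Fin (m + 1)) (j : ℤ)
    (hk : Go (ret σ.1 θ) (Sum.inl k) (Sum.inr (τ.wind j))) :
    (∀ s : ℕ, s + 1 < minimalPeriod θ (Sum.inl k) →
      θ^[s + 1] (Sum.inl k) = Sum.inr (τ.wind (j + s))) ∧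
    Go (ret σ.1 θ) (Sum.inl (σ.1 k))
      (Sum.inr (τ.wind (j + (minimalPeriod θ (Sum.inl k) - 1 : ℤ)))) := by
  set P := minimalPeriod θ (Sum.inl k) with hP
  have hp : 0 < P := minimalPeriod_pos_of_mem_periodicPts (M.inj.mem_periodicPts _)
  have h1 : ∀ s : ℕ, s + 1 < P → ∃ b, θ^[s + 1] (Sum.inl k) = Sum.inr b := by
    intro s hs
    cases h : θ^[s + 1] (Sum.inl k) with
    | inr b => exact ⟨b, rfl⟩
    | inl k' =>
      have h2 := congrArg g h
      rw [M.map_iterate, M.marker, M.marker] at h2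
      subst h2
      exact absurd h (not_isPeriodicPt_of_pos_of_lt_minimalPeriod (by omega) hs)
  have h2 : ∀ s : ℕ, s < P → Go (ret σ.1 θ) (θ^[s] (Sum.inl k)) (Sum.inr (τ.wind (j + s))) ∧
      (s + 1 < P → θ^[s + 1] (Sum.inl k) = Sum.inr (τ.wind (j + s))) := by
    intro s
    have aux : ∀ s : ℕ, Go (ret σ.1 θ) (θ^[s] (Sum.inl k)) (Sum.inr (τ.wind (j + s))) →
        s + 1 < P → θ^[s + 1] (Sum.inl k) = Sum.inr (τ.wind (j + s)) := by
      intro s h hs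
      obtain ⟨b, hb⟩ := h1 s hs
      rw [hb, h.unique (Go.of_eq (t := Sum.inr b) ?_)]
      rw [iterate_succ_apply'] at hb
      simp only [ret, hb]
    induction s with
    | zero =>
      intro hs
      have h3 : Go (ret σ.1 θ) (θ^[0] (Sum.inl k)) (Sum.inr (τ.wind (j + (0 : ℕ)))) := by
        simpa using hk
      exact ⟨h3, aux 0 h3⟩
    | succ s ih =>
      intro hs
      have h3 := (ih (by omega)).2 hs
      have h4 : Go (ret σ.1 θ) (θ^[s + 1] (Sum.inl k)) (Sum.inr (τ.wind (j + (s + 1 : ℕ)))) := by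
        rw [h3]
        have := H (τ.wind (j + s))
        rw [← τ.wind_succ] at this
        push_cast
        rwa [← add_assoc]
      exact ⟨h4, aux _ h4⟩
  refine ⟨fun s hs => (h2 s (by omega)).2 hs, ?_⟩
  have h3 := (h2 (P - 1) (by omega)).1
  rw [show (((P - 1 : ℕ) : ℤ)) = P - 1 by omega] at h3
  -- The last element of the cycle of `k` is mapped to `k`, so one step of the walk from it leads to
  -- the marker `σ k`.
  refine h3.tail ?_
  have h4 : θ (θ^[P - 1] (Sum.inl k)) = Sum.inl k := by
    rw [← iterate_succ_apply' θ, Nat.succ_eq_add_one, Nat.sub_add_cancel hp]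
    exact iterate_minimalPeriod
  simp only [ret, h4]

/-- A function on `ℤ` with prescribed increments is a partial sum in both directions; for every `j`
at most one of the two sums in `S` is nonempty. -/
theorem exists_telescope (h : ℤ → ℤ) (i a : ℤ) :
    ∃ F : ℤ → ℤ, F i = a ∧ ∀ j, F (j + 1) = F j + h j := by
  let S : ℤ → ℤ := fun j => ∑ x ∈ Finset.range j.toNat, h x -
    ∑ x ∈ Finset.range (-j).toNat, h (-x - 1)
  refine ⟨fun j => a + S j - S i, by ring, fun j => ?_⟩
  have : S (j + 1) = S j + h j := by
    simp only [S]
    rcases le_or_gt 0 j with hj | hj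
    · obtain ⟨k, rfl⟩ := Int.eq_ofNat_of_zero_le hj
      rw [show ((k : ℤ) + 1).toNat = k + 1 by omega, show (-((k : ℤ) + 1)).toNat = 0 by omega,
        show (-(k : ℤ)).toNat = 0 by omega, Finset.sum_range_succ, Int.toNat_natCast]
      simp
    · obtain ⟨k, rfl⟩ : ∃ k : ℕ, j = -k - 1 := ⟨(-j - 1).toNat, by omega⟩
      rw [show (-(k : ℤ) - 1 + 1).toNat = 0 by omega, show (-(k : ℤ) - 1).toNat = 0 by omega,
        show (-(-(k : ℤ) - 1 + 1)).toNat = k by omega, show (-(-(k : ℤ) - 1)).toNat = k + 1 by omega,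
        Finset.sum_range_succ]
      simp
  simp only [this]
  ring

-- Start the lift at a marker that is directly followed by a position, and let it grow by the number
-- of positions in each piece. By `Marked.ret_next` these values are the first positions met from
-- all markers, and by `Marked.sum_minimalPeriod` one turn around `σ` raises them by `n + 1`.
open Function in
theorem Marked.exists_rep {g : Fin (m + 1) ⊕ Fin (n + 1) → Fin (m + 1)} (M : Marked θ g)
    (H : ∀ k, Go (ret σ.1 θ) (Sum.inr k) (Sum.inr (τ.1 k))) : ∃ f, Rep σ τ θ f := by
  have hp : ∀ x, 0 < minimalPeriod θ x := fun x =>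
    minimalPeriod_pos_of_mem_periodicPts (M.inj.mem_periodicPts x)
  -- a marker that is followed by a position
  obtain ⟨i0, a, h0⟩ : ∃ i0 a, Go (ret σ.1 θ) (Sum.inl (σ.wind i0)) (Sum.inr (τ.wind a)) := by
    obtain ⟨i0, hi0⟩ := σ.wind_surjective (g (Sum.inr 0))
    cases h : θ (Sum.inl (σ.wind i0)) with
    | inr b =>
      obtain ⟨a, rfl⟩ := τ.wind_surjective b
      exact ⟨i0, a, Go.of_eq (by simp only [ret, h])⟩
    | inl k =>
      -- A marker that is followed by a marker is followed by itself; its cycle would then not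
      -- contain the position `0`.
      have h1 := M.map (Sum.inl (σ.wind i0))
      rw [h, M.marker, M.marker] at h1
      subst h1
      obtain ⟨s, hs⟩ := M.iterate (Sum.inr 0)
      rw [← hi0, iterate_fixed h] at hs
      cases hs
  -- The marker itself is not counted in the length of its piece.
  let h : ℤ → ℤ := fun i => minimalPeriod θ (Sum.inl (σ.wind i)) - 1
  obtain ⟨F, hF0, hF⟩ := exists_telescope h i0 a
  have hsum : ∀ i, F (i + (m + 1)) = F i + (n + 1) := by
    have h1 : ∀ k : ℕ, F k = F 0 + ∑ x ∈ Finset.range k, h x := by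
      intro k
      induction k with
      | zero => simp
      | succ k ih =>
        push_cast
        rw [hF, ih, Finset.sum_range_succ, add_assoc]
    have h2 := h1 (m + 1)
    have h3 := σ.sum_wind fun k => (minimalPeriod θ (Sum.inl k) : ℤ) - 1
    have h4 : ∑ k : Fin (m + 1), ((minimalPeriod θ (Sum.inl k) : ℤ) - 1) = n + 1 := by
      rw [Finset.sum_sub_distrib, ← Nat.cast_sum, M.sum_minimalPeriod]
      simp
    rw [show ∑ x ∈ Finset.range (m + 1), h x = (n + 1 : ℤ) from h3.trans h4] at h2
    have h5 : ∀ i, h (i + (m + 1)) = h i := by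
      intro i
      have := σ.wind_add_mul i 1
      rw [one_mul] at this
      simp only [h, this]
    intro i
    induction i using Int.induction_on with
    | zero => push_cast at h2; rw [zero_add, h2]
    | succ i ih => rw [show (i : ℤ) + 1 + (m + 1) = i + (m + 1) + 1 by ring, hF, hF, ih, h5]; ring
    | pred i ih =>
      have h6 := hF (-i - 1 + (m + 1))
      have h7 := hF (-i - 1)
      rw [show -(i : ℤ) - 1 + (m + 1) + 1 = -i + (m + 1) by ring, h5] at h6
      rw [sub_add_cancel] at h7
      linarith
  let f : Lift m n := ⟨F, monotone_int_of_le_succ fun i => by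
    have := hp (Sum.inl (σ.wind i))
    rw [hF]
    simp only [h]
    omega, hsum⟩
  have key : ∀ i, Go (ret σ.1 θ) (Sum.inl (σ.wind i)) (Sum.inr (τ.wind (F i))) := by
    have h1 : ∀ s : ℕ, Go (ret σ.1 θ) (Sum.inl (σ.wind (i0 + s))) (Sum.inr (τ.wind (F (i0 + s)))) := by
      intro s
      induction s with
      | zero => simpa [hF0] using h0
      | succ s ih =>
        have := (M.ret_next H _ _ ih).2
        push_cast
        rw [← add_assoc, hF, σ.wind_succ]
        exact this
    intro i
    -- The claim is known for indices from `i0` on. Adding `|i - i0|` full turns to `i` leads into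
    -- this range and changes neither the marker nor the position.
    have h2 := h1 (i + |i - i0| * (m + 1) - i0).toNat
    have h3 : 0 ≤ i + |i - i0| * (m + 1) - i0 := by
      nlinarith [neg_abs_le (i - i0), abs_nonneg (i - i0)]
    rw [Int.toNat_of_nonneg h3, add_sub_cancel, σ.wind_add_mul] at h2
    have h4 : F (i + |i - i0| * (m + 1)) = _ := f.shift_mul i |i - i0|
    rwa [h4, τ.wind_add_mul] at h2
  have key' : ∀ i, ∀ s : ℕ, F i + s ≤ F (i + 1) →
      θ^[s + 1] (Sum.inl (σ.wind i)) = step σ τ f i (F i + s) := by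
    intro i s hs
    have h1 := hp (Sum.inl (σ.wind i))
    rw [step]
    change _ = if _ < F (i + 1) then _ else _
    split_ifs with h2
    · refine (M.ret_next H _ _ (key i)).1 s ?_
      rw [hF] at h2
      simp only [h] at h2
      omega
    · have h3 : s + 1 = minimalPeriod θ (Sum.inl (σ.wind i)) := by
        rw [hF] at h2 hs
        simp only [h] at h2 hs
        omega
      rw [h3]
      exact iterate_minimalPeriod
  refine ⟨f, fun i => ?_, fun i j h1 h2 => ?_⟩
  · have := key' i 0 (by simpa using f.mono (show i ≤ i + 1 by omega))
    simpa using this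
  · obtain ⟨s, rfl⟩ : ∃ s : ℕ, j = F i + s := ⟨(j - F i).toNat, by
      have : F i ≤ j := h1
      omega⟩
    have h3 : F i + s < F (i + 1) := h2
    have h4 := key' i s h3.le
    have h5 := key' i (s + 1) (by push_cast; omega)
    rw [iterate_succ_apply', h4, step, if_pos h2] at h5
    rw [h5]
    push_cast
    rw [add_assoc]

/-- The rotation is defined by choosing integers over all markers and positions. Any other choice
differs by full turns made simultaneously in `σ` and `τ`, to which `step` is insensitive. -/
theorem exists_marked (σ : CycOrder m) (τ : CycOrder n) (f : Lift m n) :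
    ∃ θ g, Rep σ τ θ f ∧ Marked θ g := by
  choose iA hiA using σ.wind_surjective
  choose jB hjB using τ.wind_surjective
  choose iB hiB hiB' using fun b => f.exists_le_lt (jB b)
  let θ : Fin (m + 1) ⊕ Fin (n + 1) → Fin (m + 1) ⊕ Fin (n + 1) :=
    Sum.elim (fun a => step σ τ f (iA a) (f.toFun (iA a)))
      (fun b => step σ τ f (iB b) (jB b + 1))
  let g : Fin (m + 1) ⊕ Fin (n + 1) → Fin (m + 1) := Sum.elim id fun b => σ.wind (iB b)
  have hB : ∀ i j, f.toFun i ≤ j → j < f.toFun (i + 1) → ∃ k : ℤ,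
      i = iB (τ.wind j) + k * (m + 1) ∧ j = jB (τ.wind j) + k * (n + 1) := by
    intro i j h1 h2
    obtain ⟨k, hk⟩ := τ.wind_eq_iff.1 (hjB (τ.wind j))
    refine ⟨k, ?_, hk⟩
    have h3 := hiB (τ.wind j)
    have h4 := hiB' (τ.wind j)
    generalize iB (τ.wind j) = i' at *
    have h5 := f.shift_mul i' k
    have h6 := f.shift_mul (i' + 1) k
    -- After a shift by `k` turns, both `i'` and `i` index the piece containing `j`; monotonicity
    -- excludes that either index exceeds the other.
    have h7 : ¬ i' + 1 + k * (m + 1) ≤ i := fun hc => by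
      have := f.mono hc
      omega
    have h8 : ¬ i + 1 ≤ i' + k * (m + 1) := fun hc => by
      have := f.mono hc
      omega
    omega
  have R : Rep σ τ θ f := by
    constructor
    · intro i
      obtain ⟨k, hk⟩ := σ.wind_eq_iff.1 (hiA (σ.wind i))
      have h3 := step_shift (σ := σ) (τ := τ) (f := f) (iA (σ.wind i)) (f.toFun (iA (σ.wind i))) k
      rw [← f.shift_mul, ← hk] at h3
      exact h3.symm
    · intro i j h1 h2
      obtain ⟨k, hi, hj⟩ := hB i j h1 h2
      have h3 := step_shift (σ := σ) (τ := τ) (f := f) (iB (τ.wind j)) (jB (τ.wind j) + 1) k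
      rw [← hi, add_right_comm, ← hj] at h3
      exact h3.symm
  have gB : ∀ i j, f.toFun i ≤ j → j < f.toFun (i + 1) → g (Sum.inr (τ.wind j)) = σ.wind i := by
    intro i j h1 h2
    obtain ⟨k, hi, hj⟩ := hB i j h1 h2
    have h3 := σ.wind_add_mul (iB (τ.wind j)) k
    rw [← hi] at h3
    exact h3.symm
  have gs : ∀ i j, f.toFun i ≤ j → g (step σ τ f i j) = σ.wind i := by
    intro i j h1
    unfold step
    split_ifs with h2
    · exact gB i j h1 h2
    · rfl
  refine ⟨θ, g, R, ?_, fun _ => rfl, ?_, ?_⟩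
  · rw [Finite.injective_iff_surjective]
    rintro (a | b)
    · obtain ⟨i, rfl⟩ := σ.wind_surjective a
      have := f.mono (show i ≤ i + 1 by omega)
      obtain ⟨s, hs⟩ := Int.eq_ofNat_of_zero_le (sub_nonneg.2 this)
      have h1 := R.iterate i s (by omega)
      rw [Function.iterate_succ_apply', step, if_neg (by omega)] at h1
      exact ⟨_, h1⟩
    · obtain ⟨j, rfl⟩ := τ.wind_surjective b
      obtain ⟨i, h1, h2⟩ := f.exists_le_lt j
      obtain ⟨s, hs⟩ := Int.eq_ofNat_of_zero_le (sub_nonneg.2 h1)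
      have h3 := R.iterate i s (by omega)
      rw [Function.iterate_succ_apply', step, if_pos (by omega), ← hs, add_sub_cancel] at h3
      exact ⟨_, h3⟩
  · rintro (a | b)
    · obtain ⟨i, rfl⟩ := σ.wind_surjective a
      rw [R.marker, gs i _ le_rfl]
      rfl
    · obtain ⟨j, rfl⟩ := τ.wind_surjective b
      obtain ⟨i, h1, h2⟩ := f.exists_le_lt j
      rw [R.piece i j h1 h2, gs i _ (by omega), gB i j h1 h2]
  · rintro (a | b)
    · exact ⟨0, rfl⟩
    · obtain ⟨j, rfl⟩ := τ.wind_surjective b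
      obtain ⟨i, h1, h2⟩ := f.exists_le_lt j
      obtain ⟨s, hs⟩ := Int.eq_ofNat_of_zero_le (sub_nonneg.2 h1)
      have h3 := R.iterate i s (by omega)
      rw [step, if_pos (by omega), ← hs, add_sub_cancel] at h3
      rw [gB i j h1 h2]
      exact ⟨_, h3⟩

end Shuffle

/-! ### Injectivity of reversible walks -/

/-- With an injective transition function `x` is the only predecessor of `y`, so a walk that arrives
at `y` starts at `x` or passes through it. -/
theorem Go.last {X O : Type} {nx : X → X ⊕ O} {x y : X} (h : nx x = Sum.inl y)
    (hinj : ∀ x x', nx x = nx x' → x = x') {z : X} (hz : Go nx z (Sum.inl y)) :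
    z = x ∨ Go nx z (Sum.inl x) := by
  generalize ht : (Sum.inl y : X ⊕ O) = t at hz
  induction hz with
  | single z => exact Or.inl (hinj _ _ (ht.symm.trans h.symm))
  | cons h1 _ ih =>
    right
    rcases ih ht with rfl | h2
    · exact Go.of_eq h1
    · exact Go.cons h1 h2

/-- A reversible walk can be traced back from the border. -/
theorem Go.injective {X O : Type} {nx : X → X ⊕ O} (ι : O → X)
    (hι : Function.Injective ι) (hinj : ∀ x x', nx x = nx x' → x = x')
    (hne : ∀ x o, nx x ≠ Sum.inl (ι o)) {o o1 o2 : O} (h1 : Go nx (ι o1) (Sum.inr o))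
    (h2 : Go nx (ι o2) (Sum.inr o)) : o1 = o2 := by
  have hend : ∀ x o, ¬ Go nx x (Sum.inl (ι o)) := by
    intro x o h
    generalize ht : (Sum.inl (ι o) : X ⊕ O) = t at h
    induction h with
    | single x => exact hne x o ht.symm
    | cons _ _ ih => exact ih ht
  -- Traced back from their common output, two walks coincide until one of them begins. A border
  -- element is never entered by a walk, so neither of two walks from the border contains the start
  -- of the other one as a later state.
  have key : ∀ {x t}, Go nx x t → t = Sum.inr o → ∀ y, Go nx y (Sum.inr o) →
      x = y ∨ Go nx x (Sum.inl y) ∨ Go nx y (Sum.inl x) := by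
    intro x t h
    induction h with
    | single x =>
      intro hx y hy
      generalize ht : (Sum.inr o : X ⊕ O) = t at hy
      induction hy with
      | single y => exact Or.inl (hinj _ _ (hx.trans ht))
      | cons h1 _ ih =>
        rcases ih ht with rfl | h | h
        · exact Or.inr (Or.inr (Go.of_eq h1))
        · generalize hs : (Sum.inl _ : X ⊕ O) = s at h
          cases h with
          | single => rw [hx] at hs; cases hs
          | cons h3 _ => rw [hx] at h3; cases h3
        · exact Or.inr (Or.inr (Go.cons h1 h))
    | cons h1 _ ih =>
      intro ht y hy
      rcases ih ht y hy with rfl | h | h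
      · exact Or.inr (Or.inl (Go.of_eq h1))
      · exact Or.inr (Or.inl (Go.cons h1 h))
      · rcases h.last h1 hinj with rfl | h
        · exact Or.inl rfl
        · exact Or.inr (Or.inr h)
  rcases key h1 rfl _ h2 with h | h | h
  · exact hι h
  · exact absurd h (hend _ _)
  · exact absurd h (hend _ _)

/-- This is an instance of the fact that a reversible walk on a finite set that starts at the border
ends at the border. -/
theorem Shuffle.exists_glue {A B C : Type} [Finite A] [Finite B] [Finite C] {θ : A ⊕ B → A ⊕ B}
    {θ' : B ⊕ C → B ⊕ C} (h : Function.Injective θ) (h' : Function.Injective θ') (o : A ⊕ C) :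
    ∃ o', Go (glueNx θ θ') (glueIn o) (Sum.inr o') := by
  let W : (A ⊕ B) ⊕ (B ⊕ C) → (A ⊕ B) ⊕ (B ⊕ C) := fun x => match x with
    | Sum.inl (Sum.inl a) => Sum.inl (Sum.inl a)
    | Sum.inl (Sum.inr b) => Sum.inr (Sum.inl b)
    | Sum.inr (Sum.inl b) => Sum.inl (Sum.inr b)
    | Sum.inr (Sum.inr c) => Sum.inr (Sum.inr c)
  have hW : Function.Involutive W := by rintro ((a | b) | (b | c)) <;> rfl
  refine Go.exists_out glueIn ?_ ?_ o
  -- A step of the glued walk applies one of the two rotations and then exchanges the two copies of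
  -- the common part.
  · convert hW.injective.comp (h.sumMap h') using 1
    funext x
    rcases x with y | z
    · simp only [glueNx, Function.comp, Sum.map_inl]
      rcases θ y with a | b <;> rfl
    · simp only [glueNx, Function.comp, Sum.map_inr]
      rcases θ' z with a | b <;> rfl
  · rintro (y | z) o
    · simp only [glueNx]
      rcases θ y with a | b <;> rcases o with o | o <;> simp [glueIn]
    · simp only [glueNx]
      rcases θ' z with a | b <;> rcases o with o | o <;> simp [glueIn]

/-! ### Walks in trees with a distinguished vertex -/

section theta

variable {I : Type} {m n : ℕ} {col : I → ℕ}

/-- The walk around a planar tree with a distinguished vertex, which stops at the half-edges of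
the distinguished vertex and at leaves. -/
def markNx (p : CycTree (slots m col) n) (σ : ∀ i, CycOrder (col i)) (x : Port (slots m col) n) :
    Port (slots m col) n ⊕ (Fin (m + 1) ⊕ Fin (n + 1)) :=
  match p.inv x with
  | Sum.inl ⟨none, k⟩ => Sum.inr (Sum.inl k)
  | Sum.inl ⟨some i, k⟩ => Sum.inl (Sum.inl ⟨some i, (σ i).1 k⟩)
  | Sum.inr k => Sum.inr (Sum.inr k)

/-- The half-edges of the distinguished vertex and the leaf labels. -/
def border : Fin (m + 1) ⊕ Fin (n + 1) → Port (slots m col) n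
  | Sum.inl k => Sum.inl ⟨none, k⟩
  | Sum.inr k => Sum.inr k

theorem border_injective :
    Function.Injective (border : _ → Port (slots m col) n) := by
  rintro (k | k) (k' | k') h
  · exact congrArg Sum.inl (eq_of_heq (Sigma.mk.inj (Sum.inl.inj h)).2)
  · cases h
  · cases h
  · exact congrArg Sum.inr (Sum.inr.inj h)

/-- Rotation around the vertices that are not distinguished. -/
def markRot (σ : ∀ i, CycOrder (col i)) : Equiv.Perm (Port (slots m col) n) :=
  Equiv.sumCongr (Equiv.sigmaCongrRight fun o => match o with
    | none => Equiv.refl _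
    | some i => (σ i).1) (Equiv.refl _)

variable (p : CycTree (slots m col) n) (σ : ∀ i, CycOrder (col i))

theorem markNx_eq (x : Port (slots m col) n) :
    Sum.elim id border (markNx p σ x) = markRot σ (p.inv x) := by
  unfold markNx
  rcases p.inv x with ⟨_ | i, k⟩ | k <;> rfl

theorem markNx_injective : Function.Injective fun x => Sum.elim id border (markNx p σ x) := by
  simp only [markNx_eq]
  exact (markRot σ).injective.comp (Function.Involutive.injective p.inv_inv)

theorem markNx_ne (x : Port (slots m col) n) (o) : markNx p σ x ≠ Sum.inl (border o) := by
  unfold markNx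
  rcases p.inv x with ⟨_ | i, k⟩ | k
  · exact Sum.inr_ne_inl
  · rcases o with o | o <;> intro h
    · exact Option.some_ne_none i (congrArg Sigma.fst (Sum.inl.inj (Sum.inl.inj h)))
    · cases h
  · exact Sum.inr_ne_inl

theorem exists_theta (o : Fin (m + 1) ⊕ Fin (n + 1)) :
    ∃ o', Go (markNx p σ) (border o) (Sum.inr o') := by
  have := p.finite
  exact Go.exists_out border (markNx_injective p σ) (markNx_ne p σ) o

/-- The rotation of the half-edges of the distinguished vertex and the leaves: walk around the
planar tree until one of them is reached. -/
noncomputable def theta (o : Fin (m + 1) ⊕ Fin (n + 1)) : Fin (m + 1) ⊕ Fin (n + 1) :=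
  (exists_theta p σ o).choose

theorem theta_spec (o : Fin (m + 1) ⊕ Fin (n + 1)) :
    Go (markNx p σ) (border o) (Sum.inr (theta p σ o)) :=
  (exists_theta p σ o).choose_spec

/-- The walk around the tree can be reversed, since crossing edges and rotating around vertices are
both bijective. -/
theorem theta_injective : Function.Injective (theta p σ) := by
  intro o1 o2 h
  have h1 := theta_spec p σ o1
  rw [h] at h1
  exact Go.injective border border_injective (fun x x' hx => markNx_injective p σ (by simp only [hx]))
    (markNx_ne p σ) h1 (theta_spec p σ o2)

variable {p σ}

theorem theta_eq {o o' : Fin (m + 1) ⊕ Fin (n + 1)}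
    (h : Go (markNx p σ) (border o) (Sum.inr o')) : theta p σ o = o' :=
  (theta_spec p σ o).unique h

theorem theta_map {I' : Type} (e : I ≃ I') (col : I' → ℕ)
    (p : CycTree (slots m fun i => col (e i)) n) (σ : ∀ i, CycOrder (col i)) (h) :
    theta (CycTree.map (c' := slots m col) (Equiv.optionCongr e) h rfl p) σ =
      theta p fun i => σ (e i) := by
  let E : Port (slots m fun i => col (e i)) n ≃ Port (slots m col) n :=
    CycTree.portEquiv (Equiv.optionCongr e) h rfl
  have hE : ∀ o, E (border o) = border o := by rintro (k | k) <;> rfl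
  funext o
  refine theta_eq ?_
  rw [← hE]
  refine Go.sim E Sum.inr (fun x => Go.of_eq ?_) (theta_spec p _ o)
  have h := CycTree.map_inv_apply (c' := slots m col) (Equiv.optionCongr e) h rfl p x
  simp only [markNx, E, h]
  rcases p.inv x with ⟨_ | i, k⟩ | k <;> rfl

/-- The form with heterogeneous equalities is for relabellings such as `Empty ⊕ _ ≃ _`, where
colours agree only case by case. -/
theorem theta_map_of_heq {I' : Type} {col' : I' → ℕ} (e : I ≃ I') (h : ∀ i, col' (e i) = col i)
    {p : CycTree (slots m col) n} {σ : ∀ i, CycOrder (col i)} {σ' : ∀ i, CycOrder (col' i)}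
    (hσ : ∀ i, σ' (e i) ≍ σ i) (h') :
    theta (CycTree.map (c' := slots m col') (Equiv.optionCongr e) h' rfl p) σ' = theta p σ := by
  obtain rfl : col = fun i => col' (e i) := funext fun i => (h i).symm
  obtain rfl : σ = fun i => σ' (e i) := funext fun i => (eq_of_heq (hσ i)).symm
  exact theta_map e col' p σ' _

theorem idOp_inv_border (n : ℕ) (o : Fin (n + 1) ⊕ Fin (n + 1)) :
    (cOp.idOp n : CycTree (slots n Empty.elim) n).inv (border o) = border o.swap := by
  have h : ∀ x, _ = _ := CycTree.map_inv_apply (c' := slots n Empty.elim)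
    (Equiv.ofUnique Unit (Option Empty)) (fun _ => rfl) rfl (CycTree.one n)
  rcases o with k | k
  · exact h (Sum.inl ⟨(), k⟩)
  · exact h (Sum.inr k)

theorem theta_idOp (σ : ∀ i : Empty, CycOrder (Empty.elim i)) :
    theta (cOp.idOp n : CycTree (slots n Empty.elim) n) σ = Sum.swap := by
  funext o
  refine theta_eq (Go.of_eq ?_)
  unfold markNx
  rw [idOp_inv_border]
  rcases o with k | k <;> rfl

/-- The rotations of a tree that is plugged into the distinguished vertex of another tree are glued
along the half-edges of this vertex. -/
theorem theta_plug {I0 : Type} {J : I → Type} {l : ℕ} {col0 : I0 → ℕ} {b : ∀ i, J i → ℕ}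
    (q : CycTree (slots m col) n) (q0 : CycTree (slots l col0) m)
    (r : ∀ i, CycTree (b i) (col i)) (σ0 : ∀ i, CycOrder (col0 i))
    (s : ∀ i j, CycOrder (b i j))
    (σ : ∀ i, CycOrder (Sum.elim col0 (fun y : Σ i, J i => b y.1 y.2) i))
    (h0 : ∀ i, σ (Sum.inl i) = σ0 i) (hs : ∀ i j, σ (Sum.inr ⟨i, j⟩) = s i j) :
    Shuffle.Glue (theta q0 σ0) (theta q fun i => CycOrder.act (r i) (s i))
      (theta (cOp.plug (c := l) (c' := m) q q0 r :
        CycTree (slots l (Sum.elim col0 fun y : Σ i, J i => b y.1 y.2)) n) σ) := by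
  obtain rfl : σ0 = fun i => σ (Sum.inl i) := funext fun i => (h0 i).symm
  obtain rfl : s = fun i j => σ (Sum.inr ⟨i, j⟩) := funext fun i => funext fun j => (hs i j).symm
  let R : ∀ o, CycTree (plugCol (slots l col0) b o) (slots m col o) := cOp.plugOp q0 r
  let CP := CycTree.CPort (slots m col) (plugCol (J := J) (slots l col0) b) n
  -- One machine on the half-edges of all trees before composition: cross edges inside the trees,
  -- pass between a leaf of an inserted tree and the half-edge identified with it, and rotate at the
  -- inner vertices. Both sides of the gluing are compared with it.
  let N : CP → CP ⊕ (Fin (l + 1) ⊕ Fin (n + 1)) := fun x =>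
    match CycTree.edge q R x with
    | Sum.inl ⟨none, Sum.inl ⟨none, k⟩⟩ => Sum.inr (Sum.inl k)
    | Sum.inl ⟨none, Sum.inl ⟨some i, k⟩⟩ =>
      Sum.inl (Sum.inl ⟨none, Sum.inl ⟨some i, (σ (Sum.inl i)).1 k⟩⟩)
    | Sum.inl ⟨some i, Sum.inl ⟨j, k⟩⟩ => Sum.inl (Sum.inl ⟨some i, Sum.inl ⟨j, (σ (Sum.inr ⟨i, j⟩)).1 k⟩⟩)
    | Sum.inl ⟨none, Sum.inr k⟩ => Sum.inl (Sum.inr (Sum.inl ⟨none, k⟩))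
    | Sum.inl ⟨some i, Sum.inr k⟩ => Sum.inl (Sum.inr (Sum.inl ⟨some i, k⟩))
    | Sum.inr (Sum.inl ⟨none, k⟩) => Sum.inl (Sum.inl ⟨none, Sum.inr k⟩)
    | Sum.inr (Sum.inl ⟨some i, k⟩) => Sum.inl (Sum.inl ⟨some i, Sum.inr k⟩)
    | Sum.inr (Sum.inr k) => Sum.inr (Sum.inr k)
  let st : Fin (l + 1) ⊕ Fin (n + 1) → CP := fun o => match o with
    | Sum.inl k => Sum.inl ⟨none, Sum.inl ⟨none, k⟩⟩
    | Sum.inr k => Sum.inr (Sum.inr k)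
  -- the walk around the composed tree
  have hl : ∀ o, Go N (st o) (Sum.inr (theta (cOp.plug (c := l) (c' := m) q q0 r :
        CycTree (slots l (Sum.elim col0 fun y : Σ i, J i => b y.1 y.2)) n) σ o)) := by
    let P := CycTree.comp q R
    let c1 := fun x : Σ o, plugIdx (Option I0) J o => plugCol (slots l col0) b x.1 x.2
    let c2 := slots l (Sum.elim col0 fun y : Σ i, J i => b y.1 y.2)
    let E : Port c1 n ≃ Port c2 n :=
      CycTree.portEquiv (plugEquiv J) (plugCol_eq l col0 b) rfl
    have hE : ∀ x, (cOp.plug (c := l) (c' := m) q q0 r : CycTree c2 n).inv (E x) = E (P.inv x) :=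
      fun x => CycTree.map_inv_apply (plugEquiv J) (plugCol_eq l col0 b) rfl P x
    let ψ : Port c1 n → CP ⊕ (Fin (l + 1) ⊕ Fin (n + 1)) := fun x => match x with
      | Sum.inl ⟨⟨none, none⟩, k⟩ => Sum.inr (Sum.inl k)
      | Sum.inl ⟨⟨none, some i⟩, k⟩ => Sum.inl (Sum.inl ⟨none, Sum.inl ⟨some i, (σ (Sum.inl i)).1 k⟩⟩)
      | Sum.inl ⟨⟨some i, j⟩, k⟩ => Sum.inl (Sum.inl ⟨some i, Sum.inl ⟨j, (σ (Sum.inr ⟨i, j⟩)).1 k⟩⟩)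
      | Sum.inr k => Sum.inr (Sum.inr k)
    have h1 : ∀ x, Go N (CycTree.outer x) (ψ (P.inv x)) := by
      intro x
      refine Go.sim id ψ (fun x => Go.of_eq ?_) (CycTree.compInv_spec q R x)
      simp only [N, CycTree.nx, id]
      rcases CycTree.edge q R x with ⟨_ | i, ⟨j, k⟩ | k⟩ | ⟨_ | i, k⟩ | k
      · rcases j with _ | j <;> rfl
      all_goals rfl
    intro o
    have h2 : ∀ o, E.symm (border o) = (match o with
        | Sum.inl k => Sum.inl ⟨⟨none, none⟩, k⟩
        | Sum.inr k => Sum.inr k) := by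
      rintro (k | k) <;> rw [Equiv.symm_apply_eq] <;> rfl
    have h3 := Go.sim (nx' := N) (fun x => CycTree.outer (E.symm x)) Sum.inr ?_
      (theta_spec (cOp.plug (c := l) (c' := m) q q0 r : CycTree c2 n) σ o)
    · have h4 : CycTree.outer (E.symm (border o)) = st o := by
        rw [h2]
        rcases o with k | k <;> rfl
      rw [← h4]
      exact h3
    · intro x
      obtain ⟨y, rfl⟩ := E.surjective x
      have h5 := h1 y
      rw [Equiv.symm_apply_apply]
      unfold markNx
      rw [hE]
      revert h5
      rcases P.inv y with ⟨⟨_ | i, j⟩, k⟩ | k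
      · rcases j with _ | j
        · exact id
        · have h6 : E.symm (Sum.inl ⟨some (Sum.inl j), (σ (Sum.inl j)).1 k⟩) =
              Sum.inl ⟨⟨none, some j⟩, (σ (Sum.inl j)).1 k⟩ := by
            rw [Equiv.symm_apply_eq]; rfl
          exact (congrArg (fun z => Go N (CycTree.outer y) (Sum.inl (CycTree.outer z))) h6).mpr
      · have h6 : E.symm (Sum.inl ⟨some (Sum.inr ⟨i, j⟩), (σ (Sum.inr ⟨i, j⟩)).1 k⟩) =
            Sum.inl ⟨⟨some i, j⟩, (σ (Sum.inr ⟨i, j⟩)).1 k⟩ := by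
          rw [Equiv.symm_apply_eq]; rfl
        exact (congrArg (fun z => Go N (CycTree.outer y) (Sum.inl (CycTree.outer z))) h6).mpr
      · exact id
  -- the walks around the two trees
  intro o
  let η := theta q0 fun i => σ (Sum.inl i)
  let κ := theta q fun i => CycOrder.act (r i) (fun j => σ (Sum.inr ⟨i, j⟩))
  let φ : (Fin (l + 1) ⊕ Fin (m + 1)) ⊕ (Fin (m + 1) ⊕ Fin (n + 1)) → CP := fun x => match x with
    | Sum.inl (Sum.inl k) => Sum.inl ⟨none, Sum.inl ⟨none, k⟩⟩
    | Sum.inl (Sum.inr k) => Sum.inl ⟨none, Sum.inr k⟩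
    | Sum.inr (Sum.inl k) => Sum.inr (Sum.inl ⟨none, k⟩)
    | Sum.inr (Sum.inr k) => Sum.inr (Sum.inr k)
  -- It suffices that the glued walk stops somewhere: its simulation by `N` then ends with the same
  -- output, and the outputs of `N` are unique.
  obtain ⟨o', ho'⟩ : ∃ o', Go (Shuffle.glueNx η κ) (Shuffle.glueIn o) (Sum.inr o') := by
    exact Shuffle.exists_glue (theta_injective _ _) (theta_injective _ _) o
  have h1 : ∀ y, Go N (φ (Sum.inl y)) (match η y with
      | Sum.inl k => Sum.inr (Sum.inl k)
      | Sum.inr k => Sum.inl (Sum.inr (Sum.inl ⟨none, k⟩))) := by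
    intro y
    have h2 := Go.sim (nx' := N) (fun x => Sum.inl ⟨none, x⟩) (fun z => match z with
      | Sum.inl k => Sum.inr (Sum.inl k)
      | Sum.inr k => Sum.inl (Sum.inr (Sum.inl ⟨none, k⟩))) ?_ (theta_spec q0 (fun i => σ (Sum.inl i)) y)
    · have h4 : φ (Sum.inl y) = Sum.inl ⟨none, border y⟩ := by rcases y with k | k <;> rfl
      rw [h4]
      exact h2
    · intro x
      refine Go.of_eq ?_
      have h3 : R none = q0 := rfl
      simp only [N, CycTree.edge, markNx, h3]
      rcases q0.inv x with ⟨_ | i, k⟩ | k <;> rfl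
  have h2 : ∀ z, Go N (φ (Sum.inr z)) (match κ z with
      | Sum.inl k => Sum.inl (Sum.inl ⟨none, Sum.inr k⟩)
      | Sum.inr k => Sum.inr (Sum.inr k)) := by
    -- Turning at the vertex `i` of `q` by the cyclic order `act (r i)` amounts to walking around `r
    -- i` from one leaf to the next.
    have h3 : ∀ i k, Go N (Sum.inl ⟨some i, Sum.inr k⟩)
        (Sum.inl (Sum.inr (Sum.inl ⟨some i, (CycOrder.act (r i) (fun j => σ (Sum.inr ⟨i, j⟩))).1 k⟩))) := by
      intro i k
      refine Go.sim (nx' := N) (nx := CycOrder.nx (r i) (fun j => σ (Sum.inr ⟨i, j⟩))) (fun x => Sum.inl ⟨some i, x⟩)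
        (fun k => Sum.inl (Sum.inr (Sum.inl ⟨some i, k⟩))) (fun x => Go.of_eq ?_)
        (CycOrder.next_spec (r i) (fun j => σ (Sum.inr ⟨i, j⟩)) k)
      have h3 : R (some i) = r i := rfl
      simp only [N, CycTree.edge, CycOrder.nx, h3]
      rcases (r i).inv x with ⟨j, k⟩ | k <;> rfl
    intro z
    have h2 := Go.sim (nx' := N) Sum.inr (fun z => match z with
      | Sum.inl k => Sum.inl (Sum.inl ⟨none, Sum.inr k⟩)
      | Sum.inr k => Sum.inr (Sum.inr k)) ?_
      (theta_spec q (fun i => CycOrder.act (r i) (fun j => σ (Sum.inr ⟨i, j⟩))) z)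
    · have h4 : φ (Sum.inr z) = Sum.inr (border z) := by rcases z with k | k <;> rfl
      rw [h4]
      exact h2
    · intro x
      unfold markNx
      cases hx : q.inv x with
      | inl y =>
        obtain ⟨_ | i, k⟩ := y
        · refine Go.of_eq ?_
          simp only [N, CycTree.edge, hx]
          rfl
        · refine Go.cons (x' := Sum.inl ⟨some i, Sum.inr k⟩) ?_ (h3 i k)
          simp only [N, CycTree.edge, hx]
      | inr k =>
        refine Go.of_eq ?_
        simp only [N, CycTree.edge, hx]
        rfl
  have h3 := Go.sim (nx' := N) φ Sum.inr ?_ ho'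
  · have h4 : φ (Shuffle.glueIn o) = st o := by rcases o with k | k <;> rfl
    rw [h4] at h3
    rwa [(hl o).unique h3]
  · rintro (y | z)
    · have := h1 y
      simp only [Shuffle.glueNx]
      revert this
      rcases η y with k | k <;> exact id
    · have := h2 z
      simp only [Shuffle.glueNx]
      revert this
      rcases κ z with k | k <;> exact id

/-- The value of a tree with a distinguished vertex is determined by its rotation. -/
theorem ret_theta (p : CycTree (slots m col) n) (σ : ∀ i, CycOrder (col i)) (ρ : CycOrder m)
    (k : Fin (n + 1)) : Go (Shuffle.ret ρ.1 (theta p σ)) (Sum.inr k)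
      (Sum.inr ((CycOrder.act p (OneVar.fill (A := uAsC) (c := m) ρ σ)).1 k)) := by
  let w : ∀ i, CycOrder (slots m col i) := OneVar.fill (A := uAsC) (c := m) ρ σ
  have h1 : ∀ o, Go (CycOrder.nx p w) (border o)
      (Sum.elim (fun k => Sum.inl (Sum.inl ⟨none, ρ.1 k⟩)) Sum.inr (theta p σ o)) := by
    intro o
    refine Go.sim id (fun o => Sum.elim (fun k => Sum.inl (Sum.inl ⟨none, ρ.1 k⟩)) Sum.inr o)
      (fun x => Go.of_eq ?_) (theta_spec p σ o)
    simp only [CycOrder.nx, markNx, id]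
    rcases p.inv x with ⟨_ | i, k⟩ | k <;> rfl
  -- Termination comes from reversibility. The output is then identified with the next leaf by
  -- simulation, because `theta` cuts the full walk around the tree into segments at the
  -- distinguished vertex.
  obtain ⟨k', hk'⟩ : ∃ k', Go (Shuffle.ret ρ.1 (theta p σ)) (Sum.inr k) (Sum.inr k') := by
    refine Go.exists_out Sum.inr ?_ ?_ k
    · have h2 : Function.Injective (Sum.map ρ.1 (id : Fin (n + 1) → Fin (n + 1))) :=
        ρ.1.injective.sumMap Function.injective_id
      convert h2.comp (theta_injective p σ) using 1
      funext x
      simp only [Shuffle.ret, Function.comp]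
      rcases theta p σ x with k | k <;> rfl
    · intro x o
      simp only [Shuffle.ret]
      rcases theta p σ x with k | k <;> simp
  have h2 := Go.sim (nx' := CycOrder.nx p w) border Sum.inr (fun o => ?_) hk'
  · rw [show (CycOrder.act p w).1 k = k' from CycOrder.next_eq p w h2]
    exact hk'
  · have := h1 o
    simp only [Shuffle.ret]
    revert this
    rcases theta p σ o with k | k <;> exact id

end theta

/-! ### The rotation as an invariant of classes of expressions -/

/-- The rotation of an expression with one variable. -/
noncomputable def Operad.OneVar.theta {m n : ℕ} (t : OneVar uAsC m n) :
    Fin (m + 1) ⊕ Fin (n + 1) → Fin (m + 1) ⊕ Fin (n + 1) :=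
  OperadTw.theta (m := m) (n := n) (col := t.col) t.op t.arg

/-- For absorption, both expressions are compared by `theta_plug` with the identity plugged into the
variable. Its rotation is `Sum.swap`, and gluing with `Sum.swap` changes nothing. -/
theorem Operad.OneVar.theta_rel {m n : ℕ} {t t' : OneVar uAsC m n} (h : OneVar.Rel t t') :
    t.theta = t'.theta := by
  cases h with
  | relabel e col q arg => exact (theta_map e col q arg _).symm
  | @absorb I J col b q r arg =>
    let σ : ∀ i, CycOrder (Sum.elim (Empty.elim : Empty → ℕ) (fun y : Σ i, J i => b y.1 y.2) i) :=
      fun i => match i with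
        | Sum.inl i => i.elim
        | Sum.inr y => arg y.1 y.2
    have h1 := theta_plug (l := m) q (cOp.idOp m) r (fun i : Empty => i.elim) arg σ
      (fun i => i.elim) (fun _ _ => rfl)
    rw [theta_idOp] at h1
    have h2 := h1.unique (Shuffle.glue_swap _)
    refine Eq.trans ?_ h2
    refine theta_map_of_heq (Equiv.emptySum Empty (Σ i, J i)) ?_ ?_ _
    · rintro (i | x)
      exacts [i.elim, rfl]
    · rintro (i | x)
      exacts [i.elim, HEq.rfl]

namespace Operad.OneVar.Cls

/-- The rotation of a class of expressions with one variable. -/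
noncomputable def theta {m n : ℕ} (t : Cls uAsC m n) :
    Fin (m + 1) ⊕ Fin (n + 1) → Fin (m + 1) ⊕ Fin (n + 1) :=
  Quot.lift Operad.OneVar.theta (fun _ _ h => OneVar.theta_rel h) t

theorem theta_id (n : ℕ) : theta (Cls.id uAsC n) = Sum.swap := theta_idOp _

/-- Substitution plugs corollas into the other vertices of the outer tree; these leave their cyclic
orders unchanged, so `theta_plug` applies. -/
theorem glue_theta {l m n : ℕ} (t : OneVar.Cls uAsC l m) (t' : OneVar.Cls uAsC m n) :
    Shuffle.Glue (theta t) (theta t') (theta (t.comp t')) := by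
  obtain ⟨⟨I, col, q, arg⟩⟩ := t
  obtain ⟨⟨I', col', q', arg'⟩⟩ := t'
  have h := theta_plug (l := l) (m := m) (n := n) q' q (fun i => cOp.one (col' i)) arg
    (fun i _ => arg' i)
    (OneVar.comp (A := uAsC) ⟨I, col, q, arg⟩ ⟨I', col', q', arg'⟩).arg (fun _ => rfl) (fun _ _ => rfl)
  have h1 : (fun i => CycOrder.act (cOp.one (col' i)) fun _ => arg' i) = arg' :=
    funext fun i => CycOrder.act_one _ _
  rw [h1] at h
  exact h

theorem ret_theta {m n : ℕ} (t : OneVar.Cls uAsC m n) (ρ : CycOrder m) (k : Fin (n + 1)) :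
    Go (Shuffle.ret ρ.1 (theta t)) (Sum.inr k)
      (Sum.inr ((show CycOrder n from t.eval (A := uAsC) (c := m) ρ).1 k)) := by
  obtain ⟨t⟩ := t
  exact OperadTw.ret_theta (m := m) (n := n) t.op t.arg ρ k

end Operad.OneVar.Cls

/-! ### The Euler characteristic of connected graphs -/

/-- A connected graph with vertices `K` and half-edges `X` has at most one vertex more than edges. -/
theorem card_le_of_connected {X K : Type} [Finite X] [Finite K] [Nonempty X] (α : X → X) (κ : X → K)
    (hα : ∀ x, α (α x) = x) (hne : ∀ x, α x ≠ x) (hκ : Function.Surjective κ)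
    (hconn : ∀ S : Set X, S.Nonempty → (∀ x ∈ S, α x ∈ S) → (∀ x ∈ S, ∀ y, κ y = κ x → y ∈ S) →
      ∀ x, x ∈ S) : 2 * Nat.card K ≤ Nat.card X + 2 := by
  classical
  have := Fintype.ofFinite X
  have := Fintype.ofFinite K
  let G : SimpleGraph K := SimpleGraph.fromRel fun u v => ∃ x, κ x = u ∧ κ (α x) = v
  have hadj : ∀ x, G.Reachable (κ x) (κ (α x)) := by
    intro x
    by_cases h : κ x = κ (α x)
    · rw [← h]
    · refine SimpleGraph.Adj.reachable ?_
      rw [SimpleGraph.fromRel_adj]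
      exact ⟨h, Or.inl ⟨x, rfl, rfl⟩⟩
  obtain ⟨x0⟩ := ‹Nonempty X›
  have hall : ∀ x, G.Reachable (κ x0) (κ x) := by
    refine hconn {x | G.Reachable (κ x0) (κ x)} ⟨x0, SimpleGraph.Reachable.refl _⟩ ?_ ?_
    · exact fun x hx => SimpleGraph.Reachable.trans hx (hadj x)
    · intro x hx y hy
      change G.Reachable (κ x0) (κ y)
      rw [hy]
      exact hx
  have hc : G.Connected := by
    have : Nonempty K := ⟨κ x0⟩
    refine ⟨fun u v => ?_⟩
    obtain ⟨u, rfl⟩ := hκ u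
    obtain ⟨v, rfl⟩ := hκ v
    exact (hall u).symm.trans (hall v)
  have h1 := hc.card_vert_le_card_edgeSet_add_one
  let F : X → Sym2 K := fun x => s(κ x, κ (α x))
  have hE : Nat.card G.edgeSet ≤ (Finset.univ.image F).card := by
    rw [Nat.card_coe_set_eq, ← Set.ncard_coe_finset]
    refine Set.ncard_le_ncard ?_ (Finset.finite_toSet _)
    intro e
    refine Sym2.ind (fun u v huv => ?_) e
    rw [SimpleGraph.mem_edgeSet, SimpleGraph.fromRel_adj] at huv
    simp only [Finset.coe_image, Set.mem_image, Finset.mem_coe]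
    rcases huv.2 with ⟨x, rfl, rfl⟩ | ⟨x, rfl, rfl⟩
    · exact ⟨x, Finset.mem_univ _, rfl⟩
    · exact ⟨x, Finset.mem_univ _, Sym2.eq_swap⟩
  -- The half-edges `x` and `α x` are different and have the same image, so every fibre of `F` has
  -- at least two elements.
  have h2 : 2 * (Finset.univ.image F).card ≤ (Finset.univ : Finset X).card := by
    refine Finset.mul_card_image_le_card _ 2 ?_
    intro e he
    obtain ⟨x, hx, rfl⟩ := Finset.mem_image.1 he
    have h3 : ({x, α x} : Finset X).card = 2 := Finset.card_pair (hne x).symm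
    rw [← h3]
    refine Finset.card_le_card ?_
    intro z hz
    rw [Finset.mem_insert, Finset.mem_singleton] at hz
    rcases hz with rfl | rfl
    · simp
    · simp only [F, Finset.mem_filter, Finset.mem_univ, true_and, hα]
      exact Sym2.eq_swap
  rw [Finset.card_univ, ← Nat.card_eq_fintype_card] at h2
  omega

theorem card_port {I : Type} [Fintype I] (c : I → ℕ) (d : ℕ) :
    Nat.card (Port c d) = ∑ i, c i + Nat.card I + (d + 1) := by
  simp only [Nat.card_eq_fintype_card, Fintype.card_sum, Fintype.card_sigma, Fintype.card_fin,
    Finset.sum_add_distrib, Finset.sum_const, Finset.card_univ, smul_eq_mul, mul_one]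

/-- The Euler characteristic of a connected operadic graph is at most `1`. -/
theorem card_add_le_of_connected {I : Type} [Fintype I] {c : I → ℕ} {d : ℕ}
    (α : Port c d → Port c d) (hα : ∀ x, α (α x) = x) (hne : ∀ x, α x ≠ x)
    (hconn : ∀ S : Set (Port c d), S.Nonempty → (∀ x ∈ S, α x ∈ S) →
      (∀ i k k', Sum.inl ⟨i, k⟩ ∈ S → Sum.inl ⟨i, k'⟩ ∈ S) → ∀ x, x ∈ S) :
    d + Nat.card I ≤ ∑ i, c i + 1 := by
  have : Nonempty (Port c d) := ⟨Sum.inr 0⟩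
  have h := card_le_of_connected α (Sum.map Sigma.fst id) hα hne ?_ ?_
  · rw [card_port, Nat.card_sum, Nat.card_eq_fintype_card (α := Fin (d + 1)), Fintype.card_fin] at h
    omega
  · rintro (i | k)
    · exact ⟨Sum.inl ⟨i, 0⟩, rfl⟩
    · exact ⟨Sum.inr k, rfl⟩
  · intro S hS h1 h2
    exact hconn S hS h1 fun i k k' hk => h2 _ hk _ rfl

/-! ### Stars -/

section star

variable {m n : ℕ} (g : Fin (m + 1) ⊕ Fin (n + 1) → Fin (m + 1))

/-- The number of leaves in the piece `k`. -/
noncomputable def pieceLen (k : Fin (m + 1)) : ℕ := Nat.card {o // g o = k} - 1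

variable {g}

/-- The marker `k` lies in its own fibre, so the truncated subtraction in `pieceLen` is harmless.
The fibre, consisting of the marker and the leaves of its piece, is the set of half-edges of an
outer vertex of the star; an empty piece gives a vertex with one half-edge. -/
theorem pieceLen_add_one (hg : ∀ k, g (Sum.inl k) = k) (k : Fin (m + 1)) : pieceLen g k + 1 = Nat.card {o // g o = k} := by
  have : Nonempty {o // g o = k} := ⟨⟨Sum.inl k, hg k⟩⟩
  exact Nat.sub_add_cancel Nat.card_pos

/-- A numbering of the piece `k`. -/
noncomputable def pieceEquiv (hg : ∀ k, g (Sum.inl k) = k) (k : Fin (m + 1)) : Fin (pieceLen g k + 1) ≃ {o // g o = k} :=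
  (finCongr (pieceLen_add_one hg k)).trans (Finite.equivFin _).symm

theorem sum_pieceLen (hg : ∀ k, g (Sum.inl k) = k) : ∑ k, pieceLen g k = n + 1 := by
  have h := Fintype.card_congr ((Equiv.sigmaCongrRight (pieceEquiv hg)).trans
    (Equiv.sigmaFiberEquiv g))
  simp only [Fintype.card_sum, Fintype.card_sigma, Fintype.card_fin, Finset.sum_add_distrib,
    Finset.sum_const, Finset.card_univ, smul_eq_mul, mul_one] at h
  omega

variable (hg : ∀ k, g (Sum.inl k) = k)

/-- The half-edge of a star that corresponds to a half-edge of the central vertex or to a leaf. -/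
noncomputable def toStar (o : Fin (m + 1) ⊕ Fin (n + 1)) : Port (slots m (pieceLen g)) n :=
  Sum.inl ⟨some (g o), (pieceEquiv hg (g o)).symm ⟨o, rfl⟩⟩

theorem toStar_eq {o : Fin (m + 1) ⊕ Fin (n + 1)} {k : Fin (m + 1)} (h : g o = k) :
    toStar hg o = Sum.inl ⟨some k, (pieceEquiv hg k).symm ⟨o, h⟩⟩ := by
  subst h
  rfl

/-- The involution of a star. -/
noncomputable def starInv : Port (slots m (pieceLen g)) n → Port (slots m (pieceLen g)) n
  | Sum.inl ⟨none, k⟩ => toStar hg (Sum.inl k)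
  | Sum.inl ⟨some k, s⟩ => border (pieceEquiv hg k s).1
  | Sum.inr k => toStar hg (Sum.inr k)

theorem starInv_border (o : Fin (m + 1) ⊕ Fin (n + 1)) :
    starInv hg (border o) = toStar hg o := by
  rcases o with k | k <;> rfl

theorem starInv_toStar (o : Fin (m + 1) ⊕ Fin (n + 1)) :
    starInv hg (toStar hg o) = border o := by
  simp only [toStar, starInv, Equiv.apply_symm_apply]

/-- The tree with a distinguished vertex, and with one more vertex at every half-edge of the
distinguished vertex. The map `g` assigns to a leaf the piece to which it belongs. -/
noncomputable def star : CycTree (slots m (pieceLen g)) n where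
  finite := inferInstance
  inv := starInv hg
  inv_inv := by
    rintro (⟨_ | k, s⟩ | k)
    · exact starInv_toStar hg _
    · change starInv hg (border (pieceEquiv hg k s).1) = _
      rw [starInv_border, toStar_eq hg (pieceEquiv hg k s).2]
      exact congrArg (fun z : Fin (pieceLen g k + 1) =>
        (Sum.inl ⟨some k, z⟩ : Port (slots m (pieceLen g)) n)) ((pieceEquiv hg k).symm_apply_apply s)
    · exact starInv_toStar hg _
  inv_ne := by
    rintro (⟨_ | k, s⟩ | k) h
    · exact Option.some_ne_none _ (congrArg Sigma.fst (Sum.inl.inj h))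
    · change border (pieceEquiv hg k s).1 = _ at h
      revert h
      rcases (pieceEquiv hg k s).1 with o | o
      · exact fun h => Option.some_ne_none _ (congrArg Sigma.fst (Sum.inl.inj h)).symm
      · exact fun h => Sum.inr_ne_inl h
    · cases h
  conn := by
    intro S hS h1 h2
    have h3 : ∀ k s, Sum.inl ⟨some k, s⟩ ∈ S → ∀ o, g o = k → border o ∈ S := by
      intro k s hk o ho
      rw [← starInv_toStar hg, toStar_eq hg ho]
      exact h1 _ (h2 _ _ _ hk)
    have h4 : ∀ o, border o ∈ S → ∀ s, Sum.inl ⟨some (g o), s⟩ ∈ S := by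
      intro o ho s
      have := h1 _ ho
      rw [starInv_border] at this
      exact h2 _ _ _ this
    -- Every outer vertex is joined to the distinguished one through its marker, so every nonempty
    -- closed set reaches the distinguished vertex.
    have h5 : ∃ k, border (Sum.inl k) ∈ S := by
      obtain ⟨⟨_ | k, s⟩ | k, hx⟩ := hS
      · exact ⟨_, hx⟩
      · exact ⟨k, h3 k s hx _ (hg k)⟩
      · exact ⟨_, h3 _ 0 (h4 (Sum.inr k) hx 0) _ (hg _)⟩
    obtain ⟨k0, hk0⟩ := h5
    have h6 : ∀ k s, Sum.inl ⟨some k, s⟩ ∈ S := by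
      intro k s
      have := h4 (Sum.inl k) (h2 none _ _ hk0)
      rw [hg] at this
      exact this s
    rintro (⟨_ | k, s⟩ | k)
    · exact h2 none _ _ hk0
    · exact h6 k s
    · exact h3 _ 0 (h6 _ 0) (Sum.inr k) rfl
  euler := by
    rw [finsum_eq_sum_of_fintype, Fintype.sum_option]
    have := sum_pieceLen hg
    simp only [slots, this, Nat.card_eq_fintype_card, Fintype.card_option, Fintype.card_fin]
    omega

/-- The walk crosses to the outer vertex of the piece, turns once and crosses back. So the cycles of
the rotation are the cyclic orders at the outer vertices. -/
theorem theta_star (ω : ∀ k, CycOrder (pieceLen g k)) (k : Fin (m + 1))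
    (s : Fin (pieceLen g k + 1)) :
    theta (star hg) ω (pieceEquiv hg k s).1 = (pieceEquiv hg k ((ω k).1 s)).1 := by
  refine theta_eq (Go.cons (x' := Sum.inl ⟨some k, (ω k).1 s⟩) ?_ (Go.of_eq ?_))
  · have h : (star hg).inv (border (pieceEquiv hg k s).1) = Sum.inl ⟨some k, s⟩ := by
      change starInv hg _ = _
      rw [starInv_border, toStar_eq hg (pieceEquiv hg k s).2]
      simp
    simp only [markNx, h]
  · have h : (star hg).inv (Sum.inl ⟨some k, (ω k).1 s⟩) =
        border (pieceEquiv hg k ((ω k).1 s)).1 := rfl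
    simp only [markNx, h]
    rcases (pieceEquiv hg k ((ω k).1 s)).1 with o | o <;> rfl

theorem marked_star (ω : ∀ k, CycOrder (pieceLen g k)) :
    Shuffle.Marked (theta (star hg) ω) g := by
  have h1 : ∀ o, (pieceEquiv hg (g o) ((pieceEquiv hg (g o)).symm ⟨o, rfl⟩)).1 = o := by
    intro o
    rw [Equiv.apply_symm_apply]
  refine ⟨theta_injective _ _, hg, ?_, ?_⟩
  · intro o
    have h2 := theta_star hg ω (g o) ((pieceEquiv hg (g o)).symm ⟨o, rfl⟩)
    rw [h1] at h2
    rw [h2]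
    exact (pieceEquiv hg (g o) _).2
  · intro o
    let e := pieceEquiv hg (g o)
    obtain ⟨N, -, hN⟩ := ((ω (g o)).2.2 (Set.mem_univ (e.symm ⟨Sum.inl (g o), hg _⟩))
      (Set.mem_univ (e.symm ⟨o, rfl⟩))).exists_pow_eq'
    refine ⟨N, ?_⟩
    have h2 : ∀ (N : ℕ) s, (theta (star hg) ω)^[N] (e s).1 = (e (((ω (g o)).1 ^ N) s)).1 := by
      intro N s
      induction N with
      | zero => rfl
      | succ N ih =>
        rw [Function.iterate_succ_apply', ih, theta_star, pow_succ', Equiv.Perm.mul_apply]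
    have h3 := h2 N (e.symm ⟨Sum.inl (g o), hg _⟩)
    rw [hN, Equiv.apply_symm_apply, Equiv.apply_symm_apply] at h3
    exact h3

theorem star_ext {ω ω' : ∀ k, CycOrder (pieceLen g k)}
    (h : theta (star hg) ω = theta (star hg) ω') : ω = ω' := by
  funext k
  refine Subtype.ext (Equiv.ext fun s => ?_)
  have h1 := congrFun h (pieceEquiv hg k s).1
  rw [theta_star, theta_star] at h1
  exact (pieceEquiv hg k).injective (Subtype.ext h1)

/-- Every rotation with one marker in every cycle is the rotation of a star. -/
theorem exists_star {θ : Fin (m + 1) ⊕ Fin (n + 1) → Fin (m + 1) ⊕ Fin (n + 1)}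
    (M : Shuffle.Marked θ g) : ∃ ω, theta (star M.marker) ω = θ := by
  let e := pieceEquiv M.marker
  -- `θ` preserves the fibres of `g`, and `F k` is its restriction to a fibre. It is a single cycle,
  -- as everything in the fibre is an iterate of the marker.
  let F : ∀ k, Fin (pieceLen g k + 1) → Fin (pieceLen g k + 1) := fun k s =>
    (e k).symm ⟨θ (e k s).1, (M.map _).trans (e k s).2⟩
  have hF : ∀ k, Function.Bijective (F k) := by
    intro k
    rw [← Finite.injective_iff_bijective]
    intro s s' h
    have h1 := (e k).symm.injective h
    exact (e k).injective (Subtype.ext (M.inj (congrArg Subtype.val h1)))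
  have h0 : ∀ k s, (e k (F k s)).1 = θ (e k s).1 := by
    intro k s
    simp only [F, Equiv.apply_symm_apply]
  have h1 : ∀ k s, ∃ N : ℕ, (F k)^[N] ((e k).symm ⟨Sum.inl k, M.marker k⟩) = s := by
    intro k s
    obtain ⟨N, hN⟩ := M.iterate (e k s).1
    refine ⟨N, (e k).injective (Subtype.ext ?_)⟩
    rw [← hN, (e k s).2]
    clear hN
    induction N with
    | zero => simp
    | succ N ih => rw [Function.iterate_succ_apply', Function.iterate_succ_apply', h0, ih]
  let ω : ∀ k, CycOrder (pieceLen g k) := fun k => ⟨Equiv.ofBijective (F k) (hF k),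
    Set.bijOn_univ.2 (Equiv.bijective _), fun s _ s' _ => by
      have h2 : ∀ s, Equiv.Perm.SameCycle (Equiv.ofBijective (F k) (hF k))
          ((e k).symm ⟨Sum.inl k, M.marker k⟩) s := by
        intro s
        obtain ⟨N, hN⟩ := h1 k s
        refine ⟨N, ?_⟩
        rw [zpow_natCast, Equiv.Perm.coe_pow]
        exact hN
      exact (h2 s).symm.trans (h2 s')⟩
  refine ⟨ω, funext fun o => ?_⟩
  have h2 := theta_star M.marker ω (g o) ((e (g o)).symm ⟨o, rfl⟩)
  have h3 := h0 (g o) ((e (g o)).symm ⟨o, rfl⟩)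
  refine Eq.trans ?_ (h2.trans (h3.trans ?_)) <;> rw [Equiv.apply_symm_apply]

end star

/-! ### Branches at the distinguished vertex -/

section branch

variable {I : Type} {m n : ℕ} {col : I → ℕ} (p : CycTree (slots m col) n)

/-- Half-edges are joined, if they belong to one edge or to one vertex that is not
distinguished. -/
def Joined : Port (slots m col) n → Port (slots m col) n → Prop :=
  Relation.EqvGen fun x y => y = p.inv x ∨
    ∃ i k k', x = Sum.inl ⟨some i, k⟩ ∧ y = Sum.inl ⟨some i, k'⟩

theorem joined_inv (x) : Joined p x (p.inv x) := Relation.EqvGen.rel _ _ (Or.inl rfl)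

theorem joined_vertex (i : I) (k k') :
    Joined p (Sum.inl ⟨some i, k⟩) (Sum.inl ⟨some i, k'⟩) :=
  Relation.EqvGen.rel _ _ (Or.inr ⟨i, k, k', rfl, rfl⟩)

theorem mem_iff_of_joined {S : Set (Port (slots m col) n)} (h1 : ∀ x ∈ S, p.inv x ∈ S)
    (h2 : ∀ i k k', Sum.inl ⟨some i, k⟩ ∈ S → Sum.inl ⟨some i, k'⟩ ∈ S) {x y}
    (h : Joined p x y) : x ∈ S ↔ y ∈ S := by
  induction h with
  | rel x y h =>
    rcases h with rfl | ⟨i, k, k', rfl, rfl⟩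
    · refine ⟨h1 x, fun h => ?_⟩
      have := h1 _ h
      rwa [p.inv_inv] at this
    · exact ⟨h2 _ _ _, h2 _ _ _⟩
  | refl => rfl
  | symm _ _ _ ih => exact ih.symm
  | trans _ _ _ _ _ ih1 ih2 => exact ih1.trans ih2

/-- The half-edges joined to the distinguished vertex form a set closed under edges and all
vertices, so connectedness applies. -/
theorem exists_joined (x) : ∃ k, Joined p x (border (Sum.inl k)) := by
  refine p.conn {x | ∃ k, Joined p x (border (Sum.inl k))}
    ⟨border (Sum.inl 0), 0, Relation.EqvGen.refl _⟩ ?_ ?_ x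
  · rintro x ⟨k, hk⟩
    exact ⟨k, ((joined_inv p x).symm _ _).trans _ _ _ hk⟩
  · rintro (_ | i) k k' ⟨l, hl⟩
    · exact ⟨k', Relation.EqvGen.refl _⟩
    · exact ⟨l, (joined_vertex p i k' k).trans _ _ _ hl⟩

/-- Different half-edges of a vertex of a tree belong to different branches. -/
theorem eq_of_joined {k k' : Fin (m + 1)}
    (h : Joined p (border (Sum.inl k)) (border (Sum.inl k'))) : k = k' := by
  by_contra hne
  have := p.finite
  have : Finite I := Finite.of_injective some (Option.some_injective I)
  have := Fintype.ofFinite I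
  -- The distinguished vertex is split in two: `none` keeps only the half-edge `k`, and `some
  -- (Sum.inl none)` keeps the others. Leaf labels count as vertices. If `k` and `k'` were joined,
  -- the split graph would still be connected, with one vertex more than a tree with as many edges
  -- can have.
  let κ : Port (slots m col) n → Option (Option I ⊕ Fin (n + 1)) := fun x => match x with
    | Sum.inl ⟨none, l⟩ => if (show Fin (m + 1) from l) = k then none else some (Sum.inl none)
    | Sum.inl ⟨some i, _⟩ => some (Sum.inl (some i))
    | Sum.inr l => some (Sum.inr l)
  have hκ : ∀ l, κ (border (Sum.inl l)) = if l = k then none else some (Sum.inl none) :=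
    fun _ => rfl
  have : Nonempty (Port (slots m col) n) := ⟨Sum.inr 0⟩
  have hc := card_le_of_connected p.inv κ p.inv_inv p.inv_ne ?_ ?_
  · have he := p.euler
    rw [finsum_eq_sum_of_fintype] at he
    rw [card_port] at hc
    simp only [Nat.card_eq_fintype_card, Fintype.card_option, Fintype.card_sum,
      Fintype.card_fin] at hc he
    omega
  · rintro (_ | (_ | i) | l)
    · exact ⟨border (Sum.inl k), by rw [hκ, if_pos rfl]⟩
    · exact ⟨border (Sum.inl k'), by rw [hκ, if_neg (Ne.symm hne)]⟩
    · exact ⟨Sum.inl ⟨some i, 0⟩, rfl⟩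
    · exact ⟨Sum.inr l, rfl⟩
  · intro S hS h1 h2
    have h3 : ∀ i l l', Sum.inl ⟨some i, l⟩ ∈ S → Sum.inl ⟨some i, l'⟩ ∈ S :=
      fun i l l' hl => h2 _ hl _ rfl
    have h4 := mem_iff_of_joined p h1 h3 h
    have h5 : ∀ l l', l ≠ k → border (Sum.inl l) ∈ S → l' ≠ k → border (Sum.inl l') ∈ S :=
      fun l l' hl hS hl' => h2 _ hS _ (by rw [hκ, hκ, if_neg hl, if_neg hl'])
    have h6 : ∀ l, border (Sum.inl l) ∈ S → border (Sum.inl k') ∈ S := by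
      intro l hl
      by_cases h7 : l = k
      · subst h7
        exact h4.1 hl
      · exact h5 l k' h7 hl (Ne.symm hne)
    refine p.conn S hS h1 ?_
    rintro (_ | i) l l' hl
    · by_cases h7 : l' = k
      · subst h7
        exact h4.2 (h6 l hl)
      · exact h5 k' l' (Ne.symm hne) (h6 l hl) h7
    · exact h3 _ _ _ hl

/-- The branch at the distinguished vertex that contains a half-edge. -/
noncomputable def branch (x : Port (slots m col) n) : Fin (m + 1) := (exists_joined p x).choose

theorem branch_spec (x) : Joined p x (border (Sum.inl (branch p x))) :=
  (exists_joined p x).choose_spec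

theorem branch_eq_iff {x y} : branch p x = branch p y ↔ Joined p x y := by
  constructor
  · intro h
    have := branch_spec p x
    rw [h] at this
    exact this.trans _ _ _ ((branch_spec p y).symm _ _)
  · intro h
    exact eq_of_joined p
      (((branch_spec p x).symm _ _).trans _ _ _ (h.trans _ _ _ (branch_spec p y)))

theorem branch_inv (x) : branch p (p.inv x) = branch p x :=
  ((branch_eq_iff p).2 (joined_inv p x)).symm

/-- The branch of a leaf or of a half-edge of the distinguished vertex. -/
noncomputable def branchBorder (o : Fin (m + 1) ⊕ Fin (n + 1)) : Fin (m + 1) :=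
  branch p (border o)

theorem branchBorder_inl (k : Fin (m + 1)) : branchBorder p (Sum.inl k) = k :=
  (eq_of_joined p (branch_spec p (border (Sum.inl k)))).symm

/-- The branch of a vertex. -/
noncomputable def branchVertex (i : I) : Fin (m + 1) := branch p (Sum.inl ⟨some i, 0⟩)

theorem branch_vertex (i : I) (s) : branch p (Sum.inl ⟨some i, s⟩) = branchVertex p i :=
  (branch_eq_iff p).2 (joined_vertex p i s 0)

/-- The half-edges of a branch. -/
noncomputable def branchPort (k : Fin (m + 1)) :
    Port (fun j : {i // branchVertex p i = k} => col j.1) (pieceLen (branchBorder p) k) ≃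
      {x // branch p x = k} where
  toFun
    | Sum.inl ⟨j, s⟩ => ⟨Sum.inl ⟨some j.1, s⟩, (branch_vertex p j.1 s).trans j.2⟩
    | Sum.inr s => ⟨border (pieceEquiv (branchBorder_inl p) k s).1,
        (pieceEquiv (branchBorder_inl p) k s).2⟩
  invFun
    | ⟨Sum.inl ⟨none, l⟩, h⟩ => Sum.inr ((pieceEquiv (branchBorder_inl p) k).symm ⟨Sum.inl l, h⟩)
    | ⟨Sum.inl ⟨some i, s⟩, h⟩ => Sum.inl ⟨⟨i, (branch_vertex p i s).symm.trans h⟩, s⟩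
    | ⟨Sum.inr l, h⟩ => Sum.inr ((pieceEquiv (branchBorder_inl p) k).symm ⟨Sum.inr l, h⟩)
  left_inv := by
    rintro (⟨j, s⟩ | s)
    · rfl
    · have h : ∀ o : {o // branchBorder p o = k}, ∀ h : branch p (border o.1) = k,
          (match (⟨border o.1, h⟩ : {x // branch p x = k}) with
            | ⟨Sum.inl ⟨none, l⟩, h⟩ =>
              Sum.inr ((pieceEquiv (branchBorder_inl p) k).symm ⟨Sum.inl l, h⟩)
            | ⟨Sum.inl ⟨some i, s⟩, h⟩ => Sum.inl ⟨⟨i, (branch_vertex p i s).symm.trans h⟩, s⟩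
            | ⟨Sum.inr l, h⟩ =>
              Sum.inr ((pieceEquiv (branchBorder_inl p) k).symm ⟨Sum.inr l, h⟩) :
            Port (fun j : {i // branchVertex p i = k} => col j.1) (pieceLen (branchBorder p) k)) =
            Sum.inr ((pieceEquiv (branchBorder_inl p) k).symm o) := by
        rintro ⟨o | o, ho⟩ h <;> rfl
      exact (h _ _).trans (congrArg Sum.inr (Equiv.symm_apply_apply _ s))
  right_inv := by
    rintro ⟨⟨_ | i, s⟩ | l, h⟩
    · exact Subtype.ext (congrArg (fun o : {o // branchBorder p o = k} => border o.1)
        (Equiv.apply_symm_apply (pieceEquiv (branchBorder_inl p) k) ⟨Sum.inl s, h⟩))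
    · rfl
    · exact Subtype.ext (congrArg (fun o : {o // branchBorder p o = k} => border o.1)
        (Equiv.apply_symm_apply (pieceEquiv (branchBorder_inl p) k) ⟨Sum.inr l, h⟩))

/-- The involution of a branch. -/
noncomputable def branchInv (k : Fin (m + 1))
    (y : Port (fun j : {i // branchVertex p i = k} => col j.1) (pieceLen (branchBorder p) k)) :
    Port (fun j : {i // branchVertex p i = k} => col j.1) (pieceLen (branchBorder p) k) :=
  (branchPort p k).symm ⟨p.inv (branchPort p k y).1,
    (branch_inv p _).trans (branchPort p k y).2⟩

theorem branchInv_symm (k : Fin (m + 1)) (x : {x // branch p x = k}) :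
    branchInv p k ((branchPort p k).symm x) =
      (branchPort p k).symm ⟨p.inv x.1, (branch_inv p _).trans x.2⟩ := by
  simp only [branchInv, Equiv.apply_symm_apply]

theorem branchInv_branchInv (k : Fin (m + 1)) (y) : branchInv p k (branchInv p k y) = y := by
  obtain ⟨x, rfl⟩ := (branchPort p k).symm.surjective y
  rw [branchInv_symm, branchInv_symm]
  simp only [p.inv_inv]

theorem branchInv_ne (k : Fin (m + 1)) (y) : branchInv p k y ≠ y := by
  obtain ⟨x, rfl⟩ := (branchPort p k).symm.surjective y
  rw [branchInv_symm]
  intro h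
  exact p.inv_ne x.1 (congrArg Subtype.val ((branchPort p k).symm.injective h))

theorem branch_conn (k : Fin (m + 1))
    (S : Set (Port (fun j : {i // branchVertex p i = k} => col j.1) (pieceLen (branchBorder p) k)))
    (hS : S.Nonempty) (h1 : ∀ x ∈ S, branchInv p k x ∈ S)
    (h2 : ∀ i s s', Sum.inl ⟨i, s⟩ ∈ S → Sum.inl ⟨i, s'⟩ ∈ S) (y) : y ∈ S := by
  -- `T` is the image of `S` in the whole tree. It is closed under edges and under vertices other
  -- than the distinguished one, so with one half-edge it contains the whole branch.
  let T : Set (Port (slots m col) n) := {x | ∃ h : branch p x = k, (branchPort p k).symm ⟨x, h⟩ ∈ S}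
  obtain ⟨y0, hy0⟩ := hS
  obtain ⟨x0, rfl⟩ := (branchPort p k).symm.surjective y0
  obtain ⟨x, rfl⟩ := (branchPort p k).symm.surjective y
  have h := mem_iff_of_joined p (S := T) ?_ ?_ ((branch_eq_iff p).1 (x0.2.trans x.2.symm))
  · exact (h.1 ⟨x0.2, hy0⟩).2
  · rintro x ⟨hx, hS⟩
    refine ⟨(branch_inv p x).trans hx, ?_⟩
    have := h1 _ hS
    rwa [branchInv_symm] at this
  · rintro i s s' ⟨hi, hS⟩
    refine ⟨(branch_vertex p i s').trans ((branch_vertex p i s).symm.trans hi), ?_⟩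
    exact h2 _ _ _ hS

/-- Connectedness gives one inequality for every branch. Summed over all branches it becomes an
equality by the Euler formula of the whole tree, so every single inequality is an equality. -/
theorem branch_euler (k : Fin (m + 1)) :
    (∑ᶠ j : {i // branchVertex p i = k}, col j.1) + 1 =
      pieceLen (branchBorder p) k + Nat.card {i // branchVertex p i = k} := by
  have := p.finite
  have : Finite I := Finite.of_injective some (Option.some_injective I)
  have := Fintype.ofFinite I
  have := fun k => Fintype.ofFinite {i // branchVertex p i = k}
  have h1 : ∀ k ∈ Finset.univ, pieceLen (branchBorder p) k + Nat.card {i // branchVertex p i = k} ≤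
      ∑ j : {i // branchVertex p i = k}, col j.1 + 1 := fun k _ =>
    card_add_le_of_connected (branchInv p k) (branchInv_branchInv p k) (branchInv_ne p k)
      (branch_conn p k)
  rw [finsum_eq_sum_of_fintype]
  refine ((Finset.sum_eq_sum_iff_of_le h1).1 ?_ k (Finset.mem_univ k)).symm
  have h2 : ∑ k, Nat.card {i // branchVertex p i = k} = Nat.card I := by
    rw [← Nat.card_sigma]
    exact Nat.card_congr (Equiv.sigmaFiberEquiv (branchVertex p))
  have h3 : ∑ k, ∑ j : {i // branchVertex p i = k}, col j.1 = ∑ i, col i := by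
    rw [← Fintype.sum_sigma']
    exact Equiv.sum_comp (Equiv.sigmaFiberEquiv (branchVertex p)) col
  have h4 := p.euler
  rw [finsum_eq_sum_of_fintype, Fintype.sum_option, Nat.card_eq_fintype_card,
    Fintype.card_option] at h4
  simp only [slots] at h4
  rw [Finset.sum_add_distrib, Finset.sum_add_distrib, h2, h3, sum_pieceLen (branchBorder_inl p),
    Nat.card_eq_fintype_card]
  simp only [Finset.sum_const, Finset.card_univ, Fintype.card_fin, smul_eq_mul, mul_one]
  omega

/-- A branch of a tree at the distinguished vertex. -/
noncomputable def branchTree (k : Fin (m + 1)) :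
    CycTree (fun j : {i // branchVertex p i = k} => col j.1) (pieceLen (branchBorder p) k) where
  finite := by
    have := p.finite
    have : Finite I := Finite.of_injective some (Option.some_injective I)
    infer_instance
  inv := branchInv p k
  inv_inv := branchInv_branchInv p k
  inv_ne := branchInv_ne p k
  conn := branch_conn p k
  euler := branch_euler p k

end branch

/-! ### Reduction of every expression to a star -/

section normal

variable {I : Type} {m n : ℕ} {col : I → ℕ} (p : CycTree (slots m col) n)

/-- The vertices of a tree that are not distinguished are distributed among the branches. -/
noncomputable def branchSigma : I ≃ Empty ⊕ Σ k, {i // branchVertex p i = k} :=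
  (Equiv.sigmaFiberEquiv (branchVertex p)).symm.trans (Equiv.emptySum Empty _).symm

/-- A tree is the composition of a star with the branches. -/
theorem map_eq_plug_star (h) :
    CycTree.map (c' := slots m (Sum.elim (Empty.elim : Empty → ℕ)
        fun y : Σ k, {i // branchVertex p i = k} => col y.2.1))
      (Equiv.optionCongr (branchSigma p)) h rfl p =
    cOp.plug (c := m) (c' := m) (star (branchBorder_inl p)) (cOp.idOp m) (branchTree p) := by
  let J : Fin (m + 1) → Type := fun k => {i // branchVertex p i = k}
  let b : ∀ k, J k → ℕ := fun k j => col j.1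
  let q := star (branchBorder_inl p)
  let R : ∀ o, CycTree (plugCol (slots m (Empty.elim : Empty → ℕ)) b o)
      (slots m (pieceLen (branchBorder p)) o) := cOp.plugOp (cOp.idOp m) (branchTree p)
  let P := CycTree.comp q R
  let c1 := fun x : Σ o, plugIdx (Option Empty) J o =>
    plugCol (slots m (Empty.elim : Empty → ℕ)) b x.1 x.2
  let c2 := slots m (Sum.elim (Empty.elim : Empty → ℕ) fun y : Σ i, J i => b y.1 y.2)
  let E : Port c1 n ≃ Port c2 n :=
    CycTree.portEquiv (plugEquiv J) (plugCol_eq m (Empty.elim : Empty → ℕ) b) rfl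
  have hE : ∀ x, (cOp.plug (c := m) (c' := m) q (cOp.idOp m) (branchTree p) :
      CycTree c2 n).inv (E x) = E (P.inv x) :=
    fun x => CycTree.map_inv_apply (plugEquiv J) (plugCol_eq m (Empty.elim : Empty → ℕ) b) rfl P x
  -- The half-edges of `p` as half-edges of the composition: the distinguished vertex comes from the
  -- identity plugged into the star, any other vertex from its branch.
  let Ψ : Port (slots m col) n → Port c1 n := fun x => match x with
    | Sum.inl ⟨none, k⟩ => Sum.inl ⟨⟨none, none⟩, k⟩
    | Sum.inl ⟨some i, s⟩ => Sum.inl ⟨⟨some (branchVertex p i), ⟨i, rfl⟩⟩, s⟩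
    | Sum.inr k => Sum.inr k
  have hΨ : ∀ x, CycTree.portEquiv (c' := c2) (Equiv.optionCongr (branchSigma p)) h rfl x =
      E (Ψ x) := by
    rintro (⟨_ | i, s⟩ | k) <;> rfl
  let N := CycTree.nx q R
  let D : ∀ k, {x // branch p x = k} →
      CycTree.CPort (slots m (pieceLen (branchBorder p))) (plugCol (slots m Empty.elim) b) n :=
    fun k x => Sum.inl ⟨some k, (branchPort p k).symm x⟩
  have hq : ∀ k o h, q.inv (Sum.inl ⟨some k, (pieceEquiv (branchBorder_inl p) k).symm ⟨o, h⟩⟩) =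
      border o := by
    intro k o h
    rw [← toStar_eq _ h]
    exact starInv_toStar _ _
  have hR : ∀ o : Fin (m + 1) ⊕ Fin (m + 1), (R none).inv (border o) = border o.swap :=
    idOp_inv_border m
  -- the end of the walk inside a branch
  have hD : ∀ z k y, N z = CycTree.cross (D k y) → Go N z (Sum.inr (Ψ y.1)) := by
    rintro z k ⟨⟨_ | i, s⟩ | l, h⟩ hz
    · have hz' : N z = Sum.inl (Sum.inr (Sum.inl ⟨some k,
        (pieceEquiv (branchBorder_inl p) k).symm ⟨Sum.inl s, h⟩⟩)) := hz
      -- At the marker leaf of a branch the walk enters the star, crosses to its distinguished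
      -- vertex, and leaves through the identity corolla.
      refine Go.cons hz' (Go.cons (x' := Sum.inl ⟨none, Sum.inr s⟩) ?_ (Go.of_eq ?_))
      · exact congrArg (fun x => CycTree.cross (Sum.inr x)) (hq k (Sum.inl s) h)
      · exact congrArg (fun x => CycTree.cross (Sum.inl ⟨none, x⟩)) (hR (Sum.inr s))
    · obtain rfl : branchVertex p i = k := (branch_vertex p i s).symm.trans h
      exact Go.of_eq hz
    · have hz' : N z = Sum.inl (Sum.inr (Sum.inl ⟨some k,
        (pieceEquiv (branchBorder_inl p) k).symm ⟨Sum.inr l, h⟩⟩)) := hz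
      refine Go.cons hz' (Go.of_eq ?_)
      exact congrArg (fun x => CycTree.cross (Sum.inr x)) (hq k (Sum.inr l) h)
  have hU : ∀ k (x : {x // branch p x = k}), Go N (D k x) (Sum.inr (Ψ (p.inv x.1))) := by
    intro k x
    exact hD _ k ⟨p.inv x.1, (branch_inv p x.1).trans x.2⟩
      (congrArg (fun y => CycTree.cross (Sum.inl ⟨some k, y⟩)) (branchInv_symm p k x))
  have hV : ∀ x, Go N (CycTree.outer (Ψ x)) (Sum.inr (Ψ (p.inv x))) := by
    rintro (⟨_ | i, s⟩ | k)
    · refine Go.cons (x' := Sum.inr (Sum.inl ⟨none, s⟩)) ?_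
        (Go.cons (x' := D _ ⟨border (Sum.inl s), rfl⟩) rfl (hU _ ⟨border (Sum.inl s), rfl⟩))
      exact congrArg (fun x => CycTree.cross (Sum.inl ⟨none, x⟩)) (hR (Sum.inl s))
    · exact hU _ ⟨Sum.inl ⟨some i, s⟩, branch_vertex p i s⟩
    · exact Go.cons (x' := D _ ⟨Sum.inr k, rfl⟩) rfl (hU _ ⟨Sum.inr k, rfl⟩)
  refine CycTree.map_eq fun x => ?_
  rw [hΨ, hΨ]
  exact (hE (Ψ x)).trans (congrArg E (CycTree.comp_inv_eq (hV x)))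

/-- Every expression with one variable is equivalent to a star. -/
theorem mk_eq_star (σ : ∀ i, CycOrder (col i)) :
    (Quot.mk _ ⟨I, col, p, σ⟩ : OneVar.Cls uAsC m n) =
      Quot.mk _ ⟨Fin (m + 1), pieceLen (branchBorder p), star (branchBorder_inl p),
        fun k => CycOrder.act (branchTree p k) fun j => σ j.1⟩ :=
  OneVar.mk_absorb (A := uAsC) (J := fun k => {i // branchVertex p i = k})
    (b := fun k j => col j.1) (r := branchTree p) (m := fun k j => σ j.1) (branchSigma p)
    (by rintro (_ | i) <;> rfl) (fun i => ⟨branchVertex p i, ⟨i, rfl⟩⟩) (fun _ => rfl)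
    (fun _ => HEq.rfl) (fun _ => rfl) (map_eq_plug_star p _)

end normal

open CategoryTheory

/-! ### The equivalence -/

namespace Operad.OneVar.Cls

variable {m n : ℕ}

theorem exists_eq_star (t : Cls uAsC m n) : ∃ g, ∃ hg : ∀ k, g (Sum.inl k) = k, ∃ ω,
    t = Quot.mk _ ⟨Fin (m + 1), pieceLen g, star hg, ω⟩ := by
  obtain ⟨⟨I, col, p, σ⟩⟩ := t
  exact ⟨_, _, _, mk_eq_star p σ⟩

/-- A star has one marker in every cycle by construction, and the rotation depends only on the
class. -/
theorem exists_marked_theta (t : Cls uAsC m n) : ∃ g, Shuffle.Marked (theta t) g := by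
  obtain ⟨g, hg, ω, rfl⟩ := exists_eq_star t
  exact ⟨g, marked_star hg ω⟩

/-- A class of expressions with one variable is determined by its rotation. -/
theorem theta_injective : Function.Injective (theta : Cls uAsC m n → _) := by
  intro t t' h
  obtain ⟨g, hg, ω, rfl⟩ := exists_eq_star t
  obtain ⟨g', hg', ω', rfl⟩ := exists_eq_star t'
  -- The common rotation determines first the distribution of the leaves, hence the shape of the
  -- star, and then the cyclic orders at its outer vertices.
  have h1 : Shuffle.Marked (theta (Quot.mk Rel ⟨Fin (m + 1), pieceLen g, star hg, ω⟩)) g :=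
    marked_star hg ω
  rw [h] at h1
  obtain rfl := h1.unique (marked_star hg' ω')
  obtain rfl : ω = ω' := star_ext hg h
  rfl

theorem exists_theta_eq {θ : Fin (m + 1) ⊕ Fin (n + 1) → Fin (m + 1) ⊕ Fin (n + 1)} {g}
    (M : Shuffle.Marked θ g) : ∃ t : Cls uAsC m n, theta t = θ := by
  obtain ⟨ω, h⟩ := exists_star M
  exact ⟨Quot.mk _ ⟨Fin (m + 1), pieceLen g, star M.marker, ω⟩, h⟩

end Operad.OneVar.Cls

/-- A lift represents a morphism of the twisted arrow category. -/
def Represents {X Y : Tw uAsC} (t : X ⟶ Y) (f : ConnesCyclic.Lift X.colour Y.colour) : Prop :=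
  Shuffle.Rep X.elt Y.elt (OneVar.Cls.theta t.1) f

/-- The condition that `t` evaluates to `Y.elt` is what makes the walk along the rotation realize
`Y.elt`, so that the pieces are intervals of it. -/
theorem exists_represents {X Y : Tw uAsC} (t : X ⟶ Y) : ∃ f, Represents t f := by
  obtain ⟨g, M⟩ := OneVar.Cls.exists_marked_theta t.1
  refine M.exists_rep fun k => ?_
  have h := OneVar.Cls.ret_theta t.1 X.elt k
  rw [t.2] at h
  exact h

/-- The functor to the cyclic category. -/
noncomputable def toConnes : Tw uAsC ⥤ ConnesCyclic where
  obj X := ⟨X.colour⟩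
  map t := Quotient.mk _ (exists_represents t).choose
  map_id X := by
    -- A representing lift is unique up to equivalence, so the functor laws follow once the expected
    -- lift is shown to represent the morphism as well.
    refine Quotient.sound ((exists_represents (𝟙 X)).choose_spec.equiv ?_)
    rw [show OneVar.Cls.theta (𝟙 X : X ⟶ X).1 = Sum.swap from OneVar.Cls.theta_id _]
    exact Shuffle.Rep.id X.elt
  map_comp s t := Quotient.sound ((exists_represents (s ≫ t)).choose_spec.equiv
    ((exists_represents s).choose_spec.glue (exists_represents t).choose_spec
      (OneVar.Cls.glue_theta s.1 t.1)))

/-- Equivalent lifts represent the same rotation, and the rotation determines the class. -/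
instance : toConnes.Faithful where
  map_injective {_ _ t t'} h :=
    Subtype.ext (OneVar.Cls.theta_injective (((exists_represents t).choose_spec.congr
      (Quotient.exact h)).ext (exists_represents t').choose_spec))

/-- A lift determines a rotation with one marker in every cycle, which is the rotation of a star.
The value of this star at `X.elt` is `Y.elt`, since both are the output of the same walk. -/
instance : toConnes.Full where
  map_surjective {X Y} f := by
    obtain ⟨f⟩ := f
    obtain ⟨θ, g, H, M⟩ := Shuffle.exists_marked X.elt Y.elt f
    obtain ⟨t, rfl⟩ := OneVar.Cls.exists_theta_eq M
    have h : t.eval X.elt = Y.elt := Subtype.ext (Equiv.ext fun k =>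
      Go.unique (OneVar.Cls.ret_theta t X.elt k) (H.ret_piece k))
    exact ⟨⟨t, h⟩, Quotient.sound
      ((exists_represents (X := X) (Y := Y) ⟨t, h⟩).choose_spec.equiv H)⟩

theorem exists_cycOrder (n : ℕ) : Nonempty (CycOrder n) := by
  obtain ⟨σ, h, -⟩ := (Finset.univ : Finset (Fin (n + 1))).exists_cycleOn
  exact ⟨σ, by rwa [Finset.coe_univ] at h⟩

instance : toConnes.EssSurj where
  mem_essImage Y := ⟨⟨Y.n, (exists_cycOrder Y.n).some⟩, ⟨Iso.refl _⟩⟩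

instance : toConnes.IsEquivalence where

end OperadTw

theorem mainTheorem8 :
    Nonempty (CategoryTheory.Equivalence (OperadTw.Operad.Tw OperadTw.uAsC)
      OperadTw.ConnesCyclic) := ⟨OperadTw.toConnes.asEquivalence⟩
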